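/- **Notation.** Write $a=(a_0,a_1,a_2;a_3,a_4)$, $s(a)=a_3+a_4-a_0-a_1-a_2$, $\mathbf 1=(1,1,1;1,1)$, let $e_0,\dots,e_4$ be the standard basis of $\mathbb Z^5$, and $$f(a)=\sum_{k\ge 0}\frac{\Gamma(a_0+k)\Gamma(a_1+k)\Gamma(a_2+k)}{\Gamma(1+k)\Gamma(a_3+k)\Gamma(a_4+k)} .$$ The six companions of $f$ are $y^{(0)}_i(a)=f(\sigma^{(0)}_i(a))$ and $y^{(\infty)}_i(a)=e^{\mathrm i\pi s(a)}f(\sigma^{(\infty)}_i(a))$, $i=0,1,2$, where $\sigma_0^{(0)}(a)=a$, $\sigma_1^{(0)}(a)=(a_0+1-a_3,a_1+1-a_3,a_2+1-a_3;\,2-a_3,a_4+1-a_3)$, $\sigma_2^{(0)}(a)=(a_0+1-a_4,a_1+1-a_4,a_2+1-a_4;\,a_3+1-a_4,2-a_4)$, $\sigma_0^{(\infty)}(a)=(a_0,a_0+1-a_3,a_0+1-a_4;\,a_0+1-a_1,a_0+1-a_2)$, $\sigma_1^{(\infty)}(a)=(a_1+1-a_3,a_1,a_1+1-a_4;\,a_1+1-a_0,a_1+1-a_2)$,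 $\sigma_2^{(\infty)}(a)=(a_2+1-a_4,a_2+1-a_3,a_2;\,a_2+1-a_1,a_2+1-a_0)$. They are considered for generic $a\in\mathbb C^5$ (all $a_i\notin\mathbb Z$, and all $a_i-a_j\notin\mathbb Z$ for $i\ne j$) with $\operatorname{Re}s(a)>0$, where all six series converge. A relation among $h(a)$, $h(a+p)$, $h(a+q)$ (or two of them) is an identity of functions on the set of generic $a$ at which all the terms that occur converge and all coefficients are regular. Let $\varphi_1,\varphi_2,\varphi_3$ be the elementary symmetric polynomials in $a_0,a_1,a_2$. The contiguous matrices over $\mathbb Q(a)$ are, for $\{i,j,k\}=\{0,1,2\}$, $$A_i^+(a)=\begin{pmatrix}a_i&1\\ \frac{\varphi_3}{s(a)-2}&\frac{a_ja_k-(a_i-a_3+1)(a_i-a_4+1)}{s(a)-2}\end{pmatrix},$$ for $i=3,4$, with $d_i=(a_i-a_0)(a_i-a_1)(a_i-a_2)$, $$A_i^+(a)=\frac1{d_i}\begin{pmatrix}a_i^2-\varphi_1a_i+\varphi_2&-(s(a)-1)\\-\varphi_3&a_i(s(a)-1)\end{pmatrix},$$ and $A_i^-(a)=A_i^+(a-e_i)^{-1}$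 for all $i$. For $p\in\mathbb Z^5$ and any lattice path $0=p_0,p_1,\dots,p_m=p$ with $p_k-p_{k-1}=\varepsilon_ke_{i_k}$, $\varepsilon_k=\pm$, put $A(a;p)=A_{i_m}^{\varepsilon_m}(a+p_{m-1})\cdots A_{i_1}^{\varepsilon_1}(a+p_0)$; this does not depend on the path. Let $(r_1(a;p),\,r(a;p))$ be the upper row of $A(a;p)$ and $$\Delta(a;p,q)=r_1(a;p)\,r(a;q)-r(a;p)\,r_1(a;q),\qquad \delta(a;p)=\frac{(-1)^{p_0+p_1+p_2}\,(s(a)-1,s(p))\prod_{i=0}^2(a_i,p_i)}{\prod_{i=0}^2\prod_{j=3}^4(a_j-a_i,\,p_j-p_i)},$$ where in the last formula $p=(p_0,p_1,p_2;p_3,p_4)$ and $(x,n)=\Gamma(x+n)/\Gamma(x)\in\mathbb Q(x)$ for $n\in\mathbb Z$. **Proposition.** Let $p,q\in\mathbb Z^5$ be distinct. 1. $\Delta(a;p,q)=\delta(a;p)\,r(a+p;q-p)$, and it is nonzero in $\mathbb Q(a)$. 2. Let $K$ be a field of meromorphic functions of $a\in\mathbb C^5$ which is mapped into itself by the translation $g(a)\mapsto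 g(a+\mathbf 1)$ and over which $a_0,\dots,a_4$ are algebraically independent. Then, for each of the six companions $h$, the functions $h(a+p)$ and $h(a+q)$ are linearly independent over $K(a)$. 3. There are $u,v\in\mathbb Q(a)$ such that $h(a)=u(a)\,h(a+p)+v(a)\,h(a+q)$ for all six companions $h$, namely $$u(a)=\frac{r(a;q)}{\Delta(a;p,q)}=\frac{r(a;q)}{\delta(a;p)\,r(a+p;q-p)},\qquad v(a)=-\frac{r(a;p)}{\Delta(a;p,q)}=-\frac{r(a;p)}{\delta(a;p)\,r(a+p;q-p)},$$ and for each single companion $h$ this pair $(u,v)$ is the only pair of rational functions in $\mathbb Q(a)$ that satisfies the relation. -/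

import Mathlib

namespace HypThreeTerm

/-! ### Parameter vectors and the companions at unit argument -/

/-- The Saalschuetzian index `s(a) = a₃ + a₄ - a₀ - a₁ - a₂`
(for parameters in a field, and also for integer shift vectors). -/
def saal {R : Type*} [CommRing R] (a : Fin 5 → R) : R :=
  a 3 + a 4 - a 0 - a 1 - a 2

/-- The shifted parameter vector `a + p`, for `p ∈ ℤ⁵`. -/
def shift {R : Type*} [CommRing R] (a : Fin 5 → R) (p : Fin 5 → ℤ) : Fin 5 → R :=
  fun i => a i + (p i : R)

/-- Genericness: `a_i ∉ ℤ` and `a_i - a_j ∉ ℤ` for all `i ≠ j`. -/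
def Generic {R : Type*} [CommRing R] (a : Fin 5 → R) : Prop :=
  (∀ i, ∀ n : ℤ, a i ≠ (n : R)) ∧ (∀ i j, i ≠ j → ∀ n : ℤ, a i - a j ≠ (n : R))

/-- The renormalized hypergeometric series
`∑ₖ Γ(a₀+k) Γ(a₁+k) Γ(a₂+k) / (Γ(1+k) Γ(a₃+k) Γ(a₄+k)) zᵏ`. -/
noncomputable def hgf (a : Fin 5 → ℂ) (z : ℂ) : ℂ :=
  ∑' k : ℕ, Complex.Gamma (a 0 + k) * Complex.Gamma (a 1 + k) * Complex.Gamma (a 2 + k) /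
    (Complex.Gamma (1 + k) * Complex.Gamma (a 3 + k) * Complex.Gamma (a 4 + k)) * z ^ k

/-- The singular points `z = 0` and `z = ∞` of the hypergeometric equation. -/
inductive SingPt
  | zero
  | infty

/-- The six parameter involutions `σ_i^{(ν)}`, `ν ∈ {0, ∞}`, `i = 0, 1, 2`. -/
def invol : SingPt → Fin 3 → (Fin 5 → ℂ) → (Fin 5 → ℂ)
  | .zero, 0, a => a
  | .zero, 1, a => ![a 0 + 1 - a 3, a 1 + 1 - a 3, a 2 + 1 - a 3, 2 - a 3, a 4 + 1 - a 3]
  | .zero, 2, a => ![a 0 + 1 - a 4, a 1 + 1 - a 4, a 2 + 1 - a 4, a 3 + 1 - a 4, 2 - a 4]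
  | .infty, 0, a => ![a 0, a 0 + 1 - a 3, a 0 + 1 - a 4, a 0 + 1 - a 1, a 0 + 1 - a 2]
  | .infty, 1, a => ![a 1 + 1 - a 3, a 1, a 1 + 1 - a 4, a 1 + 1 - a 0, a 1 + 1 - a 2]
  | .infty, 2, a => ![a 2 + 1 - a 4, a 2 + 1 - a 3, a 2, a 2 + 1 - a 1, a 2 + 1 - a 0]

/-- The six solutions `y_i^{(ν)}(a; z)` of the third-order hypergeometric equation:
`z^{1-b_i} hgf(σ_i^{(0)}(a); z)` with `(b₀, b₁, b₂) = (1, a₃, a₄)` at `z = 0`, and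
`e^{iπ s(a)} z^{-a_i} hgf(σ_i^{(∞)}(a); 1/z)` at `z = ∞`. -/
noncomputable def sol : SingPt → Fin 3 → (Fin 5 → ℂ) → ℂ → ℂ
  | .zero, i, a, z => z ^ (1 - (![1, a 3, a 4] : Fin 3 → ℂ) i) * hgf (invol .zero i a) z
  | .infty, i, a, z => Complex.exp (Complex.I * Real.pi * saal a) *
      z ^ (-(![a 0, a 1, a 2] : Fin 3 → ℂ) i) * hgf (invol .infty i a) (1 / z)

/-- The six companions `y_i^{(ν)}(a) = y_i^{(ν)}(a; 1)`. -/
noncomputable def companion (ν : SingPt) (i : Fin 3) (a : Fin 5 → ℂ) : ℂ :=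
  sol ν i a 1

/-- The set of generic `a ∈ ℂ⁵` such that the series of the companions converge at `a + p`,
that is, `Re s(a + p) > 0`. -/
def convSet (p : Fin 5 → ℤ) : Set (Fin 5 → ℂ) :=
  {a | Generic a ∧ 0 < (saal (shift a p)).re}

/-! ### Contiguous matrices and connection matrices -/

section Matrices

variable {F : Type*} [Field F]

/-- `A_i^+(a)` for `i = 0, 1, 2`, where `x = a_i`, `{y, z} = {a_j, a_k}`,
`{i, j, k} = {0, 1, 2}` and `(b, c) = (a₃, a₄)`. -/
def numUp (x y z b c : F) : Matrix (Fin 2) (Fin 2) F :=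
  !![x, 1;
     x * y * z / (b + c - x - y - z - 2),
     (y * z - (x - b + 1) * (x - c + 1)) / (b + c - x - y - z - 2)]

/-- `A_i^-(a)` for `i = 0, 1, 2`, with the same conventions. -/
def numDown (x y z b c : F) : Matrix (Fin 2) (Fin 2) F :=
  !![((x - b) * (x - c) - y * z) / ((x - 1) * (x - b) * (x - c)),
     (b + c - x - y - z - 1) / ((x - 1) * (x - b) * (x - c));
     y * z / ((x - b) * (x - c)),
     -((b + c - x - y - z - 1) / ((x - b) * (x - c)))]

/-- `A_i^+(a)` for `i = 3, 4`, where `b = a_i`, `c` is the other denominator parameter and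
`(x, y, z) = (a₀, a₁, a₂)`. -/
def denUp (b c x y z : F) : Matrix (Fin 2) (Fin 2) F :=
  !![(b ^ 2 - (x + y + z) * b + (x * y + y * z + z * x)) / ((b - x) * (b - y) * (b - z)),
     -((b + c - x - y - z - 1) / ((b - x) * (b - y) * (b - z)));
     -(x * y * z / ((b - x) * (b - y) * (b - z))),
     b * (b + c - x - y - z - 1) / ((b - x) * (b - y) * (b - z))]

/-- `A_i^-(a)` for `i = 3, 4`, with the same conventions. -/
def denDown (b c x y z : F) : Matrix (Fin 2) (Fin 2) F :=
  !![b - 1, 1;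
     x * y * z / (b + c - x - y - z - 2),
     ((b - 1) ^ 2 - (x + y + z) * (b - 1) + (x * y + y * z + z * x)) /
       (b + c - x - y - z - 2)]

/-- The contiguous matrix `A_i^ε(a)`; the sign `ε = +` is `true` and `ε = -` is `false`. -/
def contig (a : Fin 5 → F) : Fin 5 → Bool → Matrix (Fin 2) (Fin 2) F
  | 0, true => numUp (a 0) (a 1) (a 2) (a 3) (a 4)
  | 1, true => numUp (a 1) (a 2) (a 0) (a 3) (a 4)
  | 2, true => numUp (a 2) (a 0) (a 1) (a 3) (a 4)
  | 3, true => denUp (a 3) (a 4) (a 0) (a 1) (a 2)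
  | 4, true => denUp (a 4) (a 3) (a 0) (a 1) (a 2)
  | 0, false => numDown (a 0) (a 1) (a 2) (a 3) (a 4)
  | 1, false => numDown (a 1) (a 2) (a 0) (a 3) (a 4)
  | 2, false => numDown (a 2) (a 0) (a 1) (a 3) (a 4)
  | 3, false => denDown (a 3) (a 4) (a 0) (a 1) (a 2)
  | 4, false => denDown (a 4) (a 3) (a 0) (a 1) (a 2)

/-- The lattice step `ε e_i`. -/
def step (i : Fin 5) (ε : Bool) : Fin 5 → ℤ :=
  Pi.single i (if ε then 1 else -1)

/-- The end point of the lattice path that starts at the origin and takes the listed steps. -/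
def endPt : List (Fin 5 × Bool) → (Fin 5 → ℤ)
  | [] => 0
  | (i, ε) :: w => step i ε + endPt w

/-- The product `A_{i_m}^{ε_m}(a + p_{m-1}) ⋯ A_{i_2}^{ε_2}(a + p_1) A_{i_1}^{ε_1}(a)` along
a lattice path. -/
def pathMat (a : Fin 5 → F) : List (Fin 5 × Bool) → Matrix (Fin 2) (Fin 2) F
  | [] => 1
  | (i, ε) :: w => pathMat (shift a (step i ε)) w * contig a i ε

/-- A lattice path from the origin to `p`, moving along one axis after the other. -/
def axisPath (p : Fin 5 → ℤ) : List (Fin 5 × Bool) :=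
  (List.finRange 5).flatMap fun i => List.replicate (p i).natAbs (i, decide (0 ≤ p i))

/-- The connection matrix `A(a; p)`. It is independent of the lattice path from the origin to `p`
(`pathMat_eq_connMat`). -/
def connMat (a : Fin 5 → F) (p : Fin 5 → ℤ) : Matrix (Fin 2) (Fin 2) F :=
  pathMat a (axisPath p)

/-- `r₁(a; p)`, the upper left entry of `A(a; p)`. -/
def rOne (a : Fin 5 → F) (p : Fin 5 → ℤ) : F := connMat a p 0 0

/-- `r(a; p)`, the upper right entry of `A(a; p)`. -/
def rTwo (a : Fin 5 → F) (p : Fin 5 → ℤ) : F := connMat a p 0 1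

/-- The determinant `Δ(a; p, q)`. -/
def bigDelta (a : Fin 5 → F) (p q : Fin 5 → ℤ) : F :=
  Matrix.det !![rOne a p, rTwo a p; rOne a q, rTwo a q]

/-- The factorial `(x, n) = Γ(x + n) / Γ(x)`, `n ∈ ℤ`, as a rational function of `x`. -/
def poch (x : F) : ℤ → F
  | Int.ofNat m => ∏ k ∈ Finset.range m, (x + (k : F))
  | Int.negSucc m => (∏ k ∈ Finset.range (m + 1), (x - ((k : F) + 1)))⁻¹

/-- `δ(a; p)`, the closed form of `det A(a; p)`. -/
def smallDelta (a : Fin 5 → F) (p : Fin 5 → ℤ) : F :=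
  (-1) ^ (p 0 + p 1 + p 2) * poch (saal a - 1) (saal p) *
      (∏ i ∈ ({0, 1, 2} : Finset (Fin 5)), poch (a i) (p i)) /
    ∏ i ∈ ({0, 1, 2} : Finset (Fin 5)), ∏ j ∈ ({3, 4} : Finset (Fin 5)),
      poch (a j - a i) (p j - p i)

/-! #### Independence of the lattice path -/

lemma shift_shift (a : Fin 5 → F) (p q : Fin 5 → ℤ) :
    shift (shift a p) q = shift a (p + q) := by
  funext i; simp [shift, add_assoc]

lemma shift_zero (a : Fin 5 → F) : shift a 0 = a := by
  funext i; simp [shift]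

/-- No denominator and no determinant of a contiguous matrix vanishes at an integer shift
of `a`. -/
def Regular (a : Fin 5 → F) : Prop :=
  Generic a ∧ ∀ n : ℤ, saal a ≠ (n : F)

lemma Regular.shift {a : Fin 5 → F} (h : Regular a) (p : Fin 5 → ℤ) :
    Regular (shift a p) := by
  obtain ⟨⟨h1, h2⟩, h3⟩ := h
  refine ⟨⟨fun i n e => h1 i (n - p i) ?_, fun i j hij n e => h2 i j hij (n - p i + p j) ?_⟩,
    fun n e => h3 (n - saal p) ?_⟩
  · simp only [HypThreeTerm.shift] at e; push_cast; linear_combination e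
  · simp only [HypThreeTerm.shift] at e; push_cast; linear_combination e
  · simp only [HypThreeTerm.shift, saal] at e ⊢; push_cast; linear_combination e

lemma num_mul_one {x y z b c : F} (h0 : x ≠ 0) (h1 : x + 1 - b ≠ 0) (h2 : x + 1 - c ≠ 0)
    (h3 : b + c - x - y - z - 2 ≠ 0) :
    numDown (x + 1) y z b c * numUp x y z b c = 1 := by
  have h3' : b + c - (x + 1) - y - z - 1 ≠ 0 := fun e => h3 (by linear_combination e)
  have h0' : x + 1 - 1 ≠ 0 := fun e => h0 (by linear_combination e)
  ext i j
  fin_cases i <;> fin_cases j <;>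
    simp [numDown, numUp, Matrix.mul_apply, Fin.sum_univ_two] <;> field_simp <;> ring

lemma den_mul_one {b c x y z : F} (h0 : b + c - x - y - z - 1 ≠ 0) (h1 : b - x ≠ 0)
    (h2 : b - y ≠ 0) (h3 : b - z ≠ 0) :
    denDown (b + 1) c x y z * denUp b c x y z = 1 := by
  have h0' : b + 1 + c - x - y - z - 2 ≠ 0 := fun e => h0 (by linear_combination e)
  ext i j
  fin_cases i <;> fin_cases j <;>
    simp [denDown, denUp, Matrix.mul_apply, Fin.sum_univ_two] <;> field_simp <;> ring

lemma num_num {x y z b c : F} (h0 : b + c - x - y - z - 2 ≠ 0)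
    (h1 : b + c - x - y - z - 3 ≠ 0) :
    numUp y z (x + 1) b c * numUp x y z b c = numUp x (y + 1) z b c * numUp y z x b c := by
  have e1 : b + c - y - z - (x + 1) - 2 = b + c - x - y - z - 3 := by ring
  have e2 : b + c - x - (y + 1) - z - 2 = b + c - x - y - z - 3 := by ring
  have e3 : b + c - y - z - x - 2 = b + c - x - y - z - 2 := by ring
  ext i j
  fin_cases i <;> fin_cases j <;>
    simp [numUp, Matrix.mul_apply, Fin.sum_univ_two, e1, e2, e3] <;> field_simp <;> ring

lemma den_num {x y z b c : F} (h0 : b + c - x - y - z - 2 ≠ 0)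
    (h0' : b + c - x - y - z - 1 ≠ 0)
    (h1 : b - x ≠ 0) (h1' : b - x - 1 ≠ 0) (h2 : b - y ≠ 0) (h3 : b - z ≠ 0) :
    denUp b c (x + 1) y z * numUp x y z b c = numUp x y z (b + 1) c * denUp b c x y z := by
  have e1 : b + c - (x + 1) - y - z - 1 = b + c - x - y - z - 2 := by ring
  have e2 : b + 1 + c - x - y - z - 2 = b + c - x - y - z - 1 := by ring
  have e3 : b - (x + 1) = b - x - 1 := by ring
  ext i j
  fin_cases i <;> fin_cases j <;>
    simp [numUp, denUp, Matrix.mul_apply, Fin.sum_univ_two, e1, e2, e3] <;> field_simp <;> ring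

lemma den_den {x y z b c : F} (h1 : b - x ≠ 0) (h2 : b - y ≠ 0) (h3 : b - z ≠ 0)
    (h4 : c - x ≠ 0) (h5 : c - y ≠ 0) (h6 : c - z ≠ 0) :
    denUp c (b + 1) x y z * denUp b c x y z = denUp b (c + 1) x y z * denUp c b x y z := by
  ext i j
  fin_cases i <;> fin_cases j <;>
    simp [denUp, Matrix.mul_apply, Fin.sum_univ_two] <;> field_simp <;> ring

lemma numUp_swap (x y z b c : F) : numUp x y z b c = numUp x z y b c := by
  ext i j
  fin_cases i <;> fin_cases j <;> simp [numUp] <;> ring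

lemma numUp_swap' (x y z b c : F) : numUp x y z b c = numUp x y z c b := by
  ext i j
  fin_cases i <;> fin_cases j <;> simp [numUp] <;> ring

lemma denUp_rot (b c x y z : F) : denUp b c x y z = denUp b c y z x := by
  ext i j
  fin_cases i <;> fin_cases j <;> simp [denUp] <;> ring

lemma step_not (i : Fin 5) (ε : Bool) : step i ε + step i (!ε) = 0 := by
  cases ε <;> simp [step, ← Pi.single_add]

lemma shift_step (a : Fin 5 → F) (i j : Fin 5) :
    shift a (step i true) j = if j = i then a j + 1 else a j := by
  by_cases h : j = i
  · subst h; simp [shift, step]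
  · simp [shift, step, h]

/-- `A_i^-(a + e_i) A_i^+(a) = 1`. -/
lemma contig_down_up {a : Fin 5 → F} (h : Regular a) (i : Fin 5) :
    contig (shift a (step i true)) i false * contig a i true = 1 := by
  have hd : ∀ i j : Fin 5, i ≠ j → a i - a j ≠ 0 := fun i j hij => by
    simpa using h.1.2 i j hij 0
  have hd1 : ∀ i j : Fin 5, i ≠ j → a i + 1 - a j ≠ 0 := fun i j hij e =>
    h.1.2 i j hij (-1) (by push_cast; linear_combination e)
  have h0 : ∀ i, a i ≠ 0 := fun i => by simpa using h.1.1 i 0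
  have hs : ∀ n : ℤ, a 3 + a 4 - a 0 - a 1 - a 2 ≠ (n : F) := h.2
  fin_cases i <;> simp [contig, shift_step]
  · exact num_mul_one (h0 _) (hd1 _ _ (by decide)) (hd1 _ _ (by decide))
      fun e => hs 2 (by push_cast; linear_combination e)
  · exact num_mul_one (h0 _) (hd1 _ _ (by decide)) (hd1 _ _ (by decide))
      fun e => hs 2 (by push_cast; linear_combination e)
  · exact num_mul_one (h0 _) (hd1 _ _ (by decide)) (hd1 _ _ (by decide))
      fun e => hs 2 (by push_cast; linear_combination e)
  · exact den_mul_one (fun e => hs 1 (by push_cast; linear_combination e))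
      (hd _ _ (by decide)) (hd _ _ (by decide)) (hd _ _ (by decide))
  · exact den_mul_one (fun e => hs 1 (by push_cast; linear_combination e))
      (hd _ _ (by decide)) (hd _ _ (by decide)) (hd _ _ (by decide))

lemma contig_inv {a : Fin 5 → F} (h : Regular a) (i : Fin 5) (ε : Bool) :
    contig (shift a (step i ε)) i (!ε) * contig a i ε = 1 := by
  cases ε
  · have := contig_down_up (h.shift (step i false)) i
    rw [shift_shift, show step i false + step i true = 0 from step_not i false,
      shift_zero] at this
    exact mul_eq_one_comm.mp this
  · exact contig_down_up h i

/-- `A_i^+(a + e_j) A_j^+(a) = A_j^+(a + e_i) A_i^+(a)`. -/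
lemma contig_up_up {a : Fin 5 → F} (h : Regular a) (i j : Fin 5) :
    contig (shift a (step j true)) i true * contig a j true =
      contig (shift a (step i true)) j true * contig a i true := by
  have hd : ∀ i j : Fin 5, i ≠ j → a i - a j ≠ 0 := fun i j hij => by
    simpa using h.1.2 i j hij 0
  have hd1 : ∀ i j : Fin 5, i ≠ j → a i - a j - 1 ≠ 0 := fun i j hij e =>
    h.1.2 i j hij 1 (by push_cast; linear_combination e)
  have hs : ∀ n : ℤ, a 3 + a 4 - a 0 - a 1 - a 2 ≠ (n : F) := h.2
  have s1 : a 3 + a 4 - a 0 - a 1 - a 2 - 1 ≠ 0 :=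
    fun e => hs 1 (by push_cast; linear_combination e)
  have s2 : a 3 + a 4 - a 0 - a 1 - a 2 - 2 ≠ 0 :=
    fun e => hs 2 (by push_cast; linear_combination e)
  have s3 : a 3 + a 4 - a 0 - a 1 - a 2 - 3 ≠ 0 :=
    fun e => hs 3 (by push_cast; linear_combination e)
  have key : ∀ i j : Fin 5, i < j → contig (shift a (step j true)) i true * contig a j true =
      contig (shift a (step i true)) j true * contig a i true := by
    intro i j hij
    have d30 := hd 3 0 (by decide)
    have d31 := hd 3 1 (by decide)
    have d32 := hd 3 2 (by decide)
    have d40 := hd 4 0 (by decide)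
    have d41 := hd 4 1 (by decide)
    have d42 := hd 4 2 (by decide)
    have f30 := hd1 3 0 (by decide)
    have f31 := hd1 3 1 (by decide)
    have f32 := hd1 3 2 (by decide)
    have f40 := hd1 4 0 (by decide)
    have f41 := hd1 4 1 (by decide)
    have f42 := hd1 4 2 (by decide)
    fin_cases i <;> fin_cases j <;> first | (exact absurd hij (by decide)) | skip
    all_goals simp [contig, shift_step]
    · exact (num_num s2 s3).symm
    · exact (num_num (fun e => s2 (by linear_combination e)) (fun e => s3 (by linear_combination e)))
    · exact (den_num s2 s1 d30 f30 d31 d32).symm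
    · rw [numUp_swap' _ _ _ (a 3), numUp_swap' _ _ _ (a 3)]
      exact (den_num (fun e => s2 (by linear_combination e)) (fun e => s1 (by linear_combination e)) d40 f40 d41 d42).symm
    · exact (num_num (fun e => s2 (by linear_combination e)) (fun e => s3 (by linear_combination e))).symm
    · rw [denUp_rot, denUp_rot _ _ (a 0) (a 1 + 1)]
      exact (den_num (fun e => s2 (by linear_combination e)) (fun e => s1 (by linear_combination e)) d31 f31 d32 d30).symm
    · rw [numUp_swap' _ _ _ (a 3), numUp_swap' _ _ _ (a 3), denUp_rot, denUp_rot _ _ (a 0) (a 1 + 1)]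
      exact (den_num (fun e => s2 (by linear_combination e)) (fun e => s1 (by linear_combination e)) d41 f41 d42 d40).symm
    · rw [← denUp_rot, ← denUp_rot _ _ (a 2 + 1)]
      exact (den_num (fun e => s2 (by linear_combination e)) (fun e => s1 (by linear_combination e)) d32 f32 d30 d31).symm
    · rw [numUp_swap' _ _ _ (a 3), numUp_swap' _ _ _ (a 3), ← denUp_rot, ← denUp_rot _ _ (a 2 + 1)]
      exact (den_num (fun e => s2 (by linear_combination e)) (fun e => s1 (by linear_combination e)) d42 f42 d40 d41).symm
    · exact (den_den d30 d31 d32 d40 d41 d42).symm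
  rcases lt_trichotomy i j with hij | hij | hij
  · exact key i j hij
  · rw [hij]
  · exact (key j i hij).symm

/-- The compatibility condition
`A_i^{ε}(a + ε' e_j) A_j^{ε'}(a) = A_j^{ε'}(a + ε e_i) A_i^{ε}(a)`. -/
lemma contig_compat {a : Fin 5 → F} (h : Regular a) (i j : Fin 5) (ε ε' : Bool) :
    contig (shift a (step j ε')) i ε * contig a j ε' =
      contig (shift a (step i ε)) j ε' * contig a i ε := by
  -- a sign at `j` can be reversed by conjugation with inverse matrices
  have flip : ∀ (i j : Fin 5) (ε ε' : Bool),
      (∀ {a : Fin 5 → F}, Regular a → contig (shift a (step j ε')) i ε * contig a j ε' =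
        contig (shift a (step i ε)) j ε' * contig a i ε) →
      ∀ {a : Fin 5 → F}, Regular a →
        contig (shift a (step j (!ε'))) i ε * contig a j (!ε') =
          contig (shift a (step i ε)) j (!ε') * contig a i ε := by
    intro i j ε ε' H a h
    have hb := H (h.shift (step j (!ε')))
    have z : step j (!ε') + step j ε' = 0 := by rw [add_comm]; exact step_not j ε'
    have i1 := contig_inv h j (!ε')
    have i2 := contig_inv ((h.shift (step i ε)).shift (step j (!ε'))) j ε'
    simp only [shift_shift, z, shift_zero] at hb
    simp only [shift_shift, add_assoc, z, add_zero] at i2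
    rw [Bool.not_not] at i1
    have e : step j (!ε') + step i ε = step i ε + step j (!ε') := add_comm _ _
    rw [e] at hb
    calc _ = (contig (shift a (step i ε)) j (!ε') *
          contig (shift a (step i ε + step j (!ε'))) j ε') *
          (contig (shift a (step j (!ε'))) i ε * contig a j (!ε')) := by rw [i2, one_mul]
      _ = contig (shift a (step i ε)) j (!ε') * (contig (shift a (step i ε + step j (!ε'))) j ε' *
          contig (shift a (step j (!ε'))) i ε) * contig a j (!ε') := by
            simp only [mul_assoc]
      _ = contig (shift a (step i ε)) j (!ε') * contig a i ε *
          (contig (shift a (step j (!ε'))) j ε' * contig a j (!ε')) := by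
            rw [← hb]; simp only [mul_assoc]
      _ = _ := by rw [i1, mul_one]
  have up : ∀ (i j : Fin 5) (ε' : Bool) {a : Fin 5 → F}, Regular a →
      contig (shift a (step j ε')) i true * contig a j ε' =
        contig (shift a (step i true)) j ε' * contig a i true := by
    intro i j ε' a h
    cases ε'
    · exact flip i j true true (fun h => contig_up_up h i j) h
    · exact contig_up_up h i j
  cases ε
  · exact (flip j i ε' true (fun h => (up i j ε' h).symm) h).symm
  · exact up i j ε' h

lemma pathMat_append (a : Fin 5 → F) (w w' : List (Fin 5 × Bool)) :
    pathMat a (w ++ w') = pathMat (shift a (endPt w)) w' * pathMat a w := by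
  induction w generalizing a with
  | nil => simp [pathMat, endPt, shift_zero]
  | cons x w ih => simp [pathMat, endPt, ih, shift_shift, mul_assoc]

lemma endPt_append (w w' : List (Fin 5 × Bool)) : endPt (w ++ w') = endPt w + endPt w' := by
  induction w with
  | nil => simp [endPt]
  | cons x w ih => simp [endPt, ih, add_assoc]

lemma endPt_perm {w w' : List (Fin 5 × Bool)} (h : w.Perm w') : endPt w = endPt w' := by
  induction h with
  | nil => rfl
  | cons x _ ih => simp [endPt, ih]
  | swap x y l => simp [endPt, add_left_comm]
  | trans _ _ ih ih' => exact ih.trans ih'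

lemma pathMat_perm {w w' : List (Fin 5 × Bool)} (h : w.Perm w') {a : Fin 5 → F}
    (ha : Regular a) : pathMat a w = pathMat a w' := by
  induction h generalizing a with
  | nil => rfl
  | cons x _ ih => simp [pathMat, ih (ha.shift _)]
  | swap x y l =>
    simp only [pathMat, shift_shift, mul_assoc, contig_compat ha x.1 y.1 x.2 y.2]
    rw [add_comm (step y.1 y.2)]
  | trans _ _ ih ih' => exact (ih ha).trans (ih' ha)

lemma endPt_apply_of_not_mem {w : List (Fin 5 × Bool)} {i : Fin 5} {ε : Bool}
    (h : (i, !ε) ∉ w) : 0 ≤ (if ε then 1 else -1) * endPt w i := by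
  induction w with
  | nil => simp [endPt]
  | cons x w ih =>
    obtain ⟨j, δ⟩ := x
    simp only [List.mem_cons, not_or, Prod.mk.injEq, not_and] at h
    have := ih h.2
    simp only [endPt, Pi.add_apply, mul_add]
    refine add_nonneg ?_ this
    by_cases hj : i = j
    · subst hj
      have := h.1 rfl
      cases ε <;> cases δ <;> simp_all [step]
    · simp [step, hj]

/-- The product along a closed path is the identity matrix. -/
lemma pathMat_loop {a : Fin 5 → F} (ha : Regular a) (w : List (Fin 5 × Bool))
    (h : endPt w = 0) : pathMat a w = 1 := by
  induction hn : w.length using Nat.strong_induction_on generalizing w with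
  | _ n ih =>
    match w with
    | [] => rfl
    | (i, ε) :: w =>
      have hm : (i, !ε) ∈ w := by
        by_contra hm
        have h1 := endPt_apply_of_not_mem hm
        have h2 := congrFun h i
        simp only [endPt, Pi.add_apply, Pi.zero_apply, step, Pi.single_eq_same] at h2
        cases ε <;> simp at h1 h2 <;> omega
      have hp := List.perm_cons_erase hm
      have hp' := hp.cons (i, ε)
      rw [pathMat_perm hp' ha]
      have h3 : endPt (w.erase (i, !ε)) = 0 := by
        rw [endPt_perm hp'] at h
        simpa only [endPt, ← add_assoc, step_not, zero_add] using h
      simp only [pathMat, shift_shift, step_not, shift_zero, mul_assoc, contig_inv ha i ε,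
        mul_one]
      refine ih _ ?_ _ h3 rfl
      have := hp.length_eq
      simp only [List.length_cons] at this hn
      omega

/-- The path with all steps inverted. -/
def revPath (w : List (Fin 5 × Bool)) : List (Fin 5 × Bool) :=
  (w.map fun x => (x.1, !x.2))

lemma endPt_revPath (w : List (Fin 5 × Bool)) : endPt (revPath w) = -endPt w := by
  induction w with
  | nil => simp [endPt, revPath]
  | cons x w ih =>
    have : step x.1 (!x.2) = -step x.1 x.2 :=
      eq_neg_of_add_eq_zero_right (step_not x.1 x.2)
    simp only [revPath, List.map_cons, endPt] at ih ⊢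
    rw [ih, this]; abel

/-- The product depends only on the end point of the path. -/
lemma pathMat_eq_of_endPt_eq {a : Fin 5 → F} (ha : Regular a) {w w' : List (Fin 5 × Bool)}
    (h : endPt w = endPt w') : pathMat a w = pathMat a w' := by
  have h1 : pathMat a (w' ++ (revPath w' ++ w)) = pathMat a w' := by
    rw [pathMat_append, pathMat_loop (ha.shift _), one_mul]
    rw [endPt_append, endPt_revPath, h]; simp
  have h2 : pathMat a ((w' ++ revPath w') ++ w) = pathMat a w := by
    have h0 : endPt (w' ++ revPath w') = 0 := by rw [endPt_append, endPt_revPath]; simp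
    rw [pathMat_append, pathMat_loop ha _ h0, mul_one, h0, shift_zero]
  rw [← h1, ← h2, List.append_assoc]

lemma endPt_axisPath (p : Fin 5 → ℤ) : endPt (axisPath p) = p := by
  have hrep : ∀ (i : Fin 5) (ε : Bool) (n : ℕ),
      endPt (List.replicate n (i, ε)) = n • step i ε := by
    intro i ε n
    induction n with
    | zero => simp [endPt]
    | succ n ih => rw [List.replicate_succ, endPt, ih, succ_nsmul']
  have hst : ∀ i : Fin 5, (p i).natAbs • step i (decide (0 ≤ p i)) = Pi.single i (p i) := by
    intro i
    rw [step, ← Pi.single_smul]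
    congr 1
    by_cases h : 0 ≤ p i
    · simp [h]
    · simp [h, abs_of_neg (not_le.mp h)]
  have : axisPath p = List.replicate (p 0).natAbs (0, decide (0 ≤ p 0)) ++
      (List.replicate (p 1).natAbs (1, decide (0 ≤ p 1)) ++
      (List.replicate (p 2).natAbs (2, decide (0 ≤ p 2)) ++
      (List.replicate (p 3).natAbs (3, decide (0 ≤ p 3)) ++
      (List.replicate (p 4).natAbs (4, decide (0 ≤ p 4)))))) := by
    simp [axisPath, List.finRange_succ, List.flatMap_cons]
  rw [this]
  simp only [endPt_append, hrep, hst]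
  funext i
  fin_cases i <;> simp

/-- The connection matrix may be computed along any lattice path from the origin to `p`. -/
theorem pathMat_eq_connMat {a : Fin 5 → F} (ha : Regular a) {w : List (Fin 5 × Bool)}
    {p : Fin 5 → ℤ} (h : endPt w = p) : pathMat a w = connMat a p :=
  pathMat_eq_of_endPt_eq ha (h.trans (endPt_axisPath p).symm)

end Matrices

/-! ### The rational function field `ℚ(a)` and its elements as functions on `ℂ⁵` -/

/-- The rational function field `ℚ(a) = ℚ(a₀, a₁, a₂, a₃, a₄)`. -/
abbrev RatA : Type := FractionRing (MvPolynomial (Fin 5) ℚ)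

/-- The vector `a = (a₀, a₁, a₂; a₃, a₄)` of variables of `ℚ(a)`. -/
noncomputable def varA : Fin 5 → RatA :=
  fun i => algebraMap (MvPolynomial (Fin 5) ℚ) RatA (MvPolynomial.X i)

/-- The variables of `ℚ(a)` satisfy the hypotheses of `pathMat_eq_connMat`. -/
theorem regular_varA : Regular varA := by
  have key : ∀ (P : MvPolynomial (Fin 5) ℚ) (n : ℤ) (x : Fin 5 → ℚ),
      MvPolynomial.eval x P ≠ n → algebraMap (MvPolynomial (Fin 5) ℚ) RatA P ≠ (n : RatA) := by
    intro P n x hx e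
    have : P = (n : MvPolynomial (Fin 5) ℚ) := by
      apply IsFractionRing.injective (MvPolynomial (Fin 5) ℚ) RatA
      rw [e]; simp
    apply hx
    rw [this]; simp
  refine ⟨⟨fun i n => key _ n (fun _ => n + 1) (by simp), fun i j hij n => ?_⟩, fun n => ?_⟩
  · rw [varA, varA, ← map_sub]
    refine key _ n (fun k => if k = i then n + 1 else 0) ?_
    simp [hij.symm]
  · simp only [saal, varA]
    rw [← map_add, ← map_sub, ← map_sub, ← map_sub]
    refine key _ n (fun k => if k = 3 then n + 1 else 0) ?_
    simp

/-- The rational function `u` has no pole at `x ∈ ℂ⁵`: its reduced denominator does not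
vanish at `x`. -/
def RegularAt (u : RatA) (x : Fin 5 → ℂ) : Prop :=
  MvPolynomial.aeval x (IsFractionRing.den (MvPolynomial (Fin 5) ℚ) u :
    MvPolynomial (Fin 5) ℚ) ≠ 0

/-- The value of the rational function `u` at `x ∈ ℂ⁵`. -/
noncomputable def valueAt (u : RatA) (x : Fin 5 → ℂ) : ℂ :=
  MvPolynomial.aeval x (IsFractionRing.num (MvPolynomial (Fin 5) ℚ) u) /
    MvPolynomial.aeval x (IsFractionRing.den (MvPolynomial (Fin 5) ℚ) u :
      MvPolynomial (Fin 5) ℚ)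

/-- The three-term relation `h(a) = u(a) h(a + p) + v(a) h(a + q)`: it holds at every generic `a`
such that the series at `a`, `a + p` and `a + q` converge, and `u` and `v` have no pole
at `a`. -/
def ThreeTermRel (h : (Fin 5 → ℂ) → ℂ) (p q : Fin 5 → ℤ) (u v : RatA) : Prop :=
  ∀ a ∈ convSet 0 ∩ convSet p ∩ convSet q, RegularAt u a → RegularAt v a →
    h a = valueAt u a * h (shift a p) + valueAt v a * h (shift a q)

/-! ### Meromorphic functions on `ℂ⁵` and linear independence -/

/-- The ring of entire functions on `ℂ⁵`. -/
def Entire : Subalgebra ℂ ((Fin 5 → ℂ) → ℂ) where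
  carrier := {f | AnalyticOnNhd ℂ f Set.univ}
  mul_mem' hf hg := hf.mul hg
  add_mem' hf hg := hf.add hg
  algebraMap_mem' _ := analyticOnNhd_const

instance : NoZeroDivisors Entire where
  eq_zero_or_eq_zero_of_mul_eq_zero := by
    intro f g h
    by_contra! hc
    obtain ⟨hf, hg⟩ := hc
    apply hg
    obtain ⟨x, hx⟩ : ∃ x, f.1 x ≠ 0 := by
      by_contra! hx
      exact hf (Subtype.ext (funext hx))
    apply Subtype.ext
    refine AnalyticOnNhd.eq_of_eventuallyEq (z₀ := x) g.2 analyticOnNhd_const ?_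
    have hfx : ∀ᶠ y in nhds x, f.1 y ≠ 0 :=
      (f.2 x (Set.mem_univ x)).continuousAt.eventually_ne hx
    filter_upwards [hfx] with y hy
    have : f.1 y * g.1 y = 0 := congrFun (congrArg Subtype.val h) y
    exact (mul_eq_zero.mp this).resolve_left hy

instance : IsDomain Entire := NoZeroDivisors.to_isDomain _

/-- The field of meromorphic functions on `ℂ⁵`. Every meromorphic function on `ℂⁿ` is a quotient of
two entire functions (Poincare, Cousin). -/
abbrev Mero : Type := FractionRing Entire

/-- The coordinate function `a_i` as a meromorphic function. -/
noncomputable def coordA (i : Fin 5) : Mero :=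
  algebraMap Entire Mero
    ⟨fun a => a i, (ContinuousLinearMap.proj (R := ℂ) (φ := fun _ : Fin 5 => ℂ) i).analyticOnNhd _⟩

/-- The translation `f(a) ↦ f(a + 𝟏)` on entire functions, where `𝟏 = (1,1,1;1,1)`. -/
def translateEntire : Entire →+* Entire where
  toFun f := ⟨fun a => f.1 (a + 1), fun a _ =>
    (f.2 (a + 1) (Set.mem_univ _)).fun_comp (f := fun a : Fin 5 → ℂ => a + 1)
      (analyticAt_id.add analyticAt_const)⟩
  map_one' := rfl
  map_mul' _ _ := rfl
  map_zero' := rfl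
  map_add' _ _ := rfl

lemma translateEntire_injective : Function.Injective translateEntire := by
  intro f g h
  apply Subtype.ext
  funext a
  have := congrFun (congrArg Subtype.val h) (a - 1)
  simpa [translateEntire] using this

/-- The translation `f(a) ↦ f(a + 𝟏)` on meromorphic functions. -/
noncomputable def meroShift : Mero →+* Mero :=
  IsFractionRing.map translateEntire_injective

/-- The field `K(a)` generated by `K` and the coordinate functions. -/
noncomputable def adjoinA (K : Subfield Mero) : Subfield Mero :=
  Subfield.closure ((K : Set Mero) ∪ Set.range coordA)

/-- The relation `x f + y g = 0` on `U`, for meromorphic functions `x`, `y` on `ℂ⁵` and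
functions `f`, `g` on `U`; it is written with a common denominator of `x` and `y`. -/
def LinRel (U : Set (Fin 5 → ℂ)) (f g : (Fin 5 → ℂ) → ℂ) (x y : Mero) : Prop :=
  ∃ X Y Z : Entire, Z ≠ 0 ∧ x = algebraMap Entire Mero X / algebraMap Entire Mero Z ∧
    y = algebraMap Entire Mero Y / algebraMap Entire Mero Z ∧
    ∀ a ∈ U, X.1 a * f a + Y.1 a * g a = 0

/-- The functions `f` and `g` on `U` are linearly independent over the field `L` of meromorphic
functions on `ℂ⁵`. -/
def LinIndepOver (L : Subfield Mero) (U : Set (Fin 5 → ℂ)) (f g : (Fin 5 → ℂ) → ℂ) : Prop :=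
  ∀ x ∈ L, ∀ y ∈ L, LinRel U f g x y → x = 0 ∧ y = 0

end HypThreeTerm

open HypThreeTerm

namespace HypThreeTerm
open Filter Topology

/-! ### The hypergeometric series at unit argument -/

/-! All six companions h satisfy the same contiguity relations, so one and the same matrix A(a; p)
carries the vector (h(a), h(a + 𝟏)) to (h(a + p), h(a + p + 𝟏)). For f the relations are termwise:
the shifts by e₀, e₁, e₂ multiply the k-th coefficient by a_i + k, the shifts by -e₃, -e₄ multiply
it by a_i - 1 + k, and multiplication by k amounts to the shift by 𝟏 after reindexing. A telescoping
sum gives the recurrence (s - 2) f(a + 2·𝟏) = φ₃ f(a) + ψ f(a + 𝟏). The linear parts of the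
involutions permute the six directions 𝟏, e₀, e₁, e₂, -e₃, -e₄, and the factor exp(iπs) corrects a
sign, so the companions inherit these relations (`isContiguous_companion`).

The determinant. The formula for Δ(a; p, q) is the cocycle identity A(a; q) = A(a + p; q - p) A(a;
p) together with det A(a; p) = δ(a; p) (`bigDelta_eq`, `det_connMat`). It is nonzero because r(a; p)
≠ 0 for p ≠ 0 (`rTwo_varA_ne_zero`): if r(a; p) vanished, all translates of A(a; p) would be
diagonal, and comparison with A(a; 𝟏) would make ψ(a) ψ(a + 𝟏) / (φ₃(a + 𝟏) (s(a) - 2)) periodic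
with period p, which special points exclude.

Linear independence. A relation between h(a + p) and h(a + q) over K(a) becomes U(a) h(a) + V(a) h(a
+ 𝟏) = 0. Eliminating h(a + 𝟏) and h(a + 2·𝟏) with the help of its translate and the recurrence
leaves the Riccati equation U(a) ((s - 2) U(a + 𝟏) + ψ V(a + 𝟏)) = φ₃ V(a) V(a + 𝟏)
(`riccati_of_relation`). Its only solution in K(a) is zero (`riccati_closure`), by a parity argument
for the degree with weights (1, 1, 1; 2, 0). Invertibility of the matrix with determinant Δ then
kills the original coefficients.

The three-term relation. The coefficients come from Cramer's rule for the upper rows of A(a; p) and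
A(a; q). Uniqueness is linear independence with K the field of rational constants. The delicate
point is the domain: where Re s(a) is only positive, h(a + 𝟏) need not converge and the matrices may
meet poles. `threeTermRel_of_rows` therefore works from the base point a - 𝟏, along paths that stay
in Re s > 1 (`exists_goodPath`), and compares values of rational functions through `HasValue`. -/

lemma Generic.shift {R : Type*} [CommRing R] {a : Fin 5 → R} (h : Generic a) (p : Fin 5 → ℤ) :
    Generic (shift a p) := by
  obtain ⟨h1, h2⟩ := h
  refine ⟨fun i n e => h1 i (n - p i) ?_, fun i j hij n e => h2 i j hij (n - p i + p j) ?_⟩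
  · simp only [HypThreeTerm.shift] at e; push_cast; linear_combination e
  · simp only [HypThreeTerm.shift] at e; push_cast; linear_combination e

lemma saal_shift {R : Type*} [CommRing R] (a : Fin 5 → R) (p : Fin 5 → ℤ) :
    saal (shift a p) = saal a + ((saal p : ℤ) : R) := by
  simp only [saal, shift]; push_cast; ring

lemma saal_one : saal (1 : Fin 5 → ℤ) = -1 := rfl

lemma Generic.ne_neg_nat {a : Fin 5 → ℂ} (h : Generic a) (i : Fin 5) (m : ℕ) : a i ≠ -m := by
  have := h.1 i (-m); push_cast at this; exact this

lemma Generic.add_nat_ne_zero {a : Fin 5 → ℂ} (h : Generic a) (i : Fin 5) (m : ℕ) :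
    a i + m ≠ 0 := fun e => h.ne_neg_nat i m (by linear_combination e)

lemma Generic.Gamma_ne_zero {a : Fin 5 → ℂ} (h : Generic a) (i : Fin 5) (k : ℕ) :
    Complex.Gamma (a i + k) ≠ 0 :=
  Complex.Gamma_ne_zero fun m e => h.ne_neg_nat i (k + m) (by push_cast; linear_combination e)

/-- The coefficients of the hypergeometric series. -/
noncomputable def hgTerm (a : Fin 5 → ℂ) (k : ℕ) : ℂ :=
  Complex.Gamma (a 0 + k) * Complex.Gamma (a 1 + k) * Complex.Gamma (a 2 + k) /
    (Complex.Gamma (1 + k) * Complex.Gamma (a 3 + k) * Complex.Gamma (a 4 + k))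

lemma hgf_one (a : Fin 5 → ℂ) : hgf a 1 = ∑' k, hgTerm a k := by
  simp [hgf, hgTerm]

/-! ### Asymptotics of the coefficients and convergence. -/

lemma Gamma_add_nat_succ (s : ℂ) (hs : ∀ m : ℕ, s ≠ -m) (n : ℕ) :
    Complex.Gamma (s + (n + 1 : ℕ)) = (∏ j ∈ Finset.range (n + 1), (s + j)) * Complex.Gamma s := by
  induction n with
  | zero =>
    have : s ≠ 0 := by simpa using hs 0
    simp [Complex.Gamma_add_one s this]
  | succ n ih =>
    have h : s + (n + 1 : ℕ) ≠ 0 := fun e => hs (n + 1) (by linear_combination e)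
    rw [Finset.prod_range_succ, mul_right_comm, ← ih, mul_comm,
      ← Complex.Gamma_add_one _ h]
    congr 1; push_cast; ring

/-- The quotient is Γ(s) divided by the n-th term of Euler's limit for Γ(s). -/
lemma tendsto_Gamma_ratio (s : ℂ) (hs : ∀ m : ℕ, s ≠ -m) :
    Tendsto (fun n : ℕ => Complex.Gamma (s + (n + 1 : ℕ)) / ((n.factorial : ℂ) * (n : ℂ) ^ s))
      atTop (𝓝 1) := by
  have hG := Complex.Gamma_ne_zero hs
  have h := (Complex.GammaSeq_tendsto_Gamma s).inv₀ hG |>.const_mul (Complex.Gamma s)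
  rw [mul_inv_cancel₀ hG] at h
  refine h.congr fun n => ?_
  rw [Gamma_add_nat_succ s hs, Complex.GammaSeq, inv_div, ← mul_div_assoc]
  congr 1 <;> ring

/-- The Gamma ratios for the five parameters combine to n^(-s(a)), and Γ(1 + (n + 1)) contributes
the extra factor n + 1. So the coefficients decay like n^(-s(a) - 1), which gives both the
convergence for Re s(a) > 0 and the vanishing of the boundary term in the recurrence. -/
lemma tendsto_hgTerm {a : Fin 5 → ℂ} (ha : Generic a) :
    Tendsto (fun n : ℕ => hgTerm a (n + 1) * (n + 1 : ℕ) * (n : ℂ) ^ saal a) atTop (𝓝 1) := by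
  have g i := tendsto_Gamma_ratio (a i) (ha.ne_neg_nat i)
  have h := (((g 0).mul (g 1)).mul (g 2)).div ((g 3).mul (g 4)) (by simp)
  simp only [one_mul, div_one] at h
  refine h.congr' ?_
  filter_upwards [eventually_ge_atTop 1] with n hn
  have hn0 : (n : ℂ) ≠ 0 := by exact_mod_cast (by omega : n ≠ 0)
  have hf : (n.factorial : ℂ) ≠ 0 := by exact_mod_cast n.factorial_ne_zero
  have hpow : (n : ℂ) ^ saal a =
      (n : ℂ) ^ a 3 * (n : ℂ) ^ a 4 / ((n : ℂ) ^ a 0 * (n : ℂ) ^ a 1 * (n : ℂ) ^ a 2) := by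
    simp only [saal, Complex.cpow_sub _ _ hn0, Complex.cpow_add _ _ hn0]
    rw [div_div, div_div, mul_assoc]
  have hc i : (n : ℂ) ^ a i ≠ 0 := by simp [Complex.cpow_eq_zero_iff, hn0]
  have h1 : Complex.Gamma (1 + (n + 1 : ℕ)) = (n + 1 : ℕ) * n.factorial := by
    rw [add_comm, Complex.Gamma_nat_eq_factorial, Nat.factorial_succ]; push_cast; ring
  have hn1 : ((n + 1 : ℕ) : ℂ) ≠ 0 := by exact_mod_cast (by omega : n + 1 ≠ 0)
  have g3 := ha.Gamma_ne_zero 3 (n + 1)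
  have g4 := ha.Gamma_ne_zero 4 (n + 1)
  rw [Pi.div_apply, hpow, hgTerm, h1]
  generalize ((n + 1 : ℕ) : ℂ) = N at *
  have := hc 0; have := hc 1; have := hc 2; have := hc 3; have := hc 4
  field_simp

lemma tendsto_nat_cpow_zero {s : ℂ} (hs : s.re < 0) :
    Tendsto (fun n : ℕ => (n : ℂ) ^ s) atTop (𝓝 0) := by
  rw [tendsto_zero_iff_norm_tendsto_zero]
  have h := (tendsto_rpow_neg_atTop (neg_pos.2 hs)).comp tendsto_natCast_atTop_atTop
  refine h.congr' ?_
  filter_upwards [eventually_ge_atTop 1] with n hn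
  simp [Complex.norm_natCast_cpow_of_pos (by omega : 0 < n)]

lemma summable_hgTerm {a : Fin 5 → ℂ} (ha : Generic a) (hs : 0 < (saal a).re) :
    Summable (hgTerm a) := by
  rw [← summable_nat_add_iff 1]
  have hO := (tendsto_hgTerm ha).norm.isBoundedUnder_le
  have hsum : Summable fun n : ℕ => (n : ℝ) ^ (-(saal a).re - 1) :=
    Real.summable_nat_rpow.2 (by linarith)
  obtain ⟨C, hC⟩ := hO
  rw [eventually_map] at hC
  refine summable_of_isBigO_nat hsum (Asymptotics.IsBigO.of_bound C ?_)
  filter_upwards [hC, eventually_ge_atTop 1] with n hn h1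
  have hp : 0 < (n : ℝ) := by exact_mod_cast h1
  rw [norm_mul, norm_mul, Complex.norm_natCast_cpow_of_pos (by omega : 0 < n),
    Complex.norm_natCast] at hn
  rw [Real.norm_of_nonneg (by positivity)]
  have e : (n : ℝ) ^ (-(saal a).re - 1) = ((n : ℝ) * (n : ℝ) ^ (saal a).re)⁻¹ := by
    rw [Real.rpow_sub hp, Real.rpow_neg hp.le, Real.rpow_one, mul_inv, div_eq_mul_inv, mul_comm]
  rw [e, ← div_eq_mul_inv, le_div_iff₀ (by positivity)]
  refine le_trans ?_ hn
  rw [mul_assoc]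
  gcongr
  simp

/-! ### Contiguity relations of the series. -/

lemma hgTerm_shift_one (a : Fin 5 → ℂ) (k : ℕ) :
    hgTerm (shift a 1) k = hgTerm a (k + 1) * (k + 1 : ℕ) := by
  have e : ∀ x : ℂ, x + 1 + k = x + (k + 1 : ℕ) := fun x => by push_cast; ring
  have h1 : Complex.Gamma (1 + (k + 1 : ℕ)) = (k + 1 : ℕ) * Complex.Gamma (1 + k) := by
    rw [add_comm, Complex.Gamma_add_one _ (by exact_mod_cast (by omega : k + 1 ≠ 0))]
    congr 2; push_cast; ring
  have hk : ((k + 1 : ℕ) : ℂ) ≠ 0 := by exact_mod_cast (by omega : k + 1 ≠ 0)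
  simp only [hgTerm, shift, Pi.one_apply, Int.cast_one, e, h1]
  generalize ((k + 1 : ℕ) : ℂ) = N at *
  field_simp

lemma hgTerm_succ {a : Fin 5 → ℂ} (ha : Generic a) (k : ℕ) :
    hgTerm a (k + 1) * (k + 1) * (a 3 + k) * (a 4 + k) =
      (a 0 + k) * (a 1 + k) * (a 2 + k) * hgTerm a k := by
  have e : ∀ i, Complex.Gamma (a i + (k + 1 : ℕ)) = (a i + k) * Complex.Gamma (a i + k) := fun i => by
    rw [← Complex.Gamma_add_one _ (ha.add_nat_ne_zero i k)]; congr 1; push_cast; ring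
  have h1 : Complex.Gamma (1 + (k + 1 : ℕ)) = (k + 1) * Complex.Gamma (1 + k) := by
    rw [add_comm, Complex.Gamma_add_one _ (by exact_mod_cast (by omega : k + 1 ≠ 0))]
    push_cast; congr 2; ring
  have hk : (k + 1 : ℂ) ≠ 0 := by exact_mod_cast (by omega : k + 1 ≠ 0)
  have g3 := ha.Gamma_ne_zero 3 k
  have g4 := ha.Gamma_ne_zero 4 k
  have n3 := ha.add_nat_ne_zero 3 k
  have n4 := ha.add_nat_ne_zero 4 k
  have g1 : Complex.Gamma (1 + k) ≠ 0 := Complex.Gamma_ne_zero fun m e => by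
    have h : (1 + k + m : ℕ) = (0 : ℂ) := by push_cast; linear_combination e
    have : 1 + k + m = 0 := by exact_mod_cast h
    omega
  simp only [hgTerm, e, h1]
  field_simp

/-- The weight k removes the term k = 0, and reindexing the rest gives the series at a + 𝟏. Since s
drops by 1 under this shift, the bound is 1 and not 0. -/
lemma hasSum_mul_nat {a : Fin 5 → ℂ} (ha : Generic a) (hs : 1 < (saal a).re) :
    HasSum (fun k : ℕ => hgTerm a k * k) (hgf (shift a 1) 1) := by
  have h : Summable (hgTerm (shift a 1)) := summable_hgTerm (ha.shift 1) (by
    rw [saal_shift, saal_one]; simp; linarith)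
  rw [← hasSum_nat_add_iff' 1]
  have h' := h.hasSum
  rw [← hgf_one, funext (hgTerm_shift_one a)] at h'
  simpa only [Finset.sum_range_one, Nat.cast_zero, mul_zero, sub_zero] using h'

lemma hasSum_hgTerm {a : Fin 5 → ℂ} (ha : Generic a) (hs : 0 < (saal a).re) :
    HasSum (hgTerm a) (hgf a 1) := by
  rw [hgf_one]; exact (summable_hgTerm ha hs).hasSum

lemma hgTerm_up {a : Fin 5 → ℂ} (ha : Generic a) (i : Fin 5) (hi : i < 3) (k : ℕ) :
    hgTerm (shift a (step i true)) k = (a i + k) * hgTerm a k := by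
  have e : Complex.Gamma (a i + 1 + k) = (a i + k) * Complex.Gamma (a i + k) := by
    rw [← Complex.Gamma_add_one _ (ha.add_nat_ne_zero i k)]; congr 1; ring
  simp only [hgTerm, shift_step]
  fin_cases i <;> simp at hi e ⊢ <;> rw [e] <;> ring

lemma hgTerm_down {a : Fin 5 → ℂ} (ha : Generic a) (i : Fin 5) (hi : 3 ≤ i) (k : ℕ) :
    hgTerm (shift a (step i false)) k = (a i - 1 + k) * hgTerm a k := by
  have h0 : a i - 1 + k ≠ 0 := fun e => ha.1 i (1 - k) (by push_cast; linear_combination e)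
  have e : Complex.Gamma (a i + k) = (a i - 1 + k) * Complex.Gamma (a i - 1 + k) := by
    rw [← Complex.Gamma_add_one _ h0]; congr 1; ring
  have hj : ∀ j, shift a (step i false) j = if j = i then a j - 1 else a j := fun j => by
    by_cases h : j = i
    · subst h; simp [shift, step, sub_eq_add_neg]
    · simp [shift, step, h]
  simp only [hgTerm, hj]
  fin_cases i <;> simp at hi e h0 ⊢ <;> rw [e] <;> field_simp

lemma hgf_up {a : Fin 5 → ℂ} (ha : Generic a) (hs : 1 < (saal a).re) (i : Fin 5) (hi : i < 3) :
    hgf (shift a (step i true)) 1 = a i * hgf a 1 + hgf (shift a 1) 1 := by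
  have h := ((hasSum_hgTerm ha (by linarith)).mul_left (a i)).add (hasSum_mul_nat ha hs)
  rw [hgf_one (shift a (step i true)), ← h.tsum_eq]
  exact tsum_congr fun k => by rw [hgTerm_up ha i hi]; ring

lemma hgf_down {a : Fin 5 → ℂ} (ha : Generic a) (hs : 1 < (saal a).re) (i : Fin 5) (hi : 3 ≤ i) :
    hgf (shift a (step i false)) 1 = (a i - 1) * hgf a 1 + hgf (shift a 1) 1 := by
  have h := ((hasSum_hgTerm ha (by linarith)).mul_left (a i - 1)).add (hasSum_mul_nat ha hs)
  rw [hgf_one (shift a (step i false)), ← h.tsum_eq]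
  exact tsum_congr fun k => by rw [hgTerm_down ha i hi]; ring

/-- The coefficient `1 + φ₁ + φ₂ - a₃ a₄` of the recurrence in the direction `𝟏`. -/
def psi {R : Type*} [CommRing R] (a : Fin 5 → R) : R :=
  1 + (a 0 + a 1 + a 2) + (a 0 * a 1 + a 1 * a 2 + a 2 * a 0) - a 3 * a 4

/-- `φ₃ = a₀ a₁ a₂`. -/
def phiThree {R : Type*} [CommRing R] (a : Fin 5 → R) : R := a 0 * a 1 * a 2

/-- This is the boundary term of the telescoping sum in `hgf_recurrence`; it has order k^(2 - s(a)),
which is where the bound 2 comes from. -/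
lemma tendsto_telescope {a : Fin 5 → ℂ} (ha : Generic a) (hs : 2 < (saal a).re) :
    Tendsto (fun k : ℕ => k * (a 3 + k - 1) * (a 4 + k - 1) * hgTerm a k) atTop (𝓝 0) := by
  rw [← tendsto_add_atTop_iff_nat 1]
  have h1 : ∀ x : ℂ, Tendsto (fun n : ℕ => x / (n : ℂ) + 1) atTop (𝓝 (0 + 1)) := fun x =>
    (tendsto_const_div_atTop_nhds_zero_nat x).add_const 1
  have h2 : Tendsto (fun n : ℕ => (n : ℂ) ^ (2 - saal a)) atTop (𝓝 0) :=
    tendsto_nat_cpow_zero (by simp; linarith)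
  have h := (((tendsto_hgTerm ha).mul (h1 (a 3))).mul (h1 (a 4))).mul h2
  simp only [mul_zero] at h
  refine h.congr' ?_
  filter_upwards [eventually_ge_atTop 1] with n hn
  have hn0 : (n : ℂ) ≠ 0 := by exact_mod_cast (by omega : n ≠ 0)
  have hc : (n : ℂ) ^ saal a ≠ 0 := by simp [Complex.cpow_eq_zero_iff, hn0]
  rw [Complex.cpow_sub _ _ hn0, Complex.cpow_ofNat]
  push_cast
  field_simp
  ring

lemma hgf_recurrence {a : Fin 5 → ℂ} (ha : Generic a) (hs : 2 < (saal a).re) :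
    (saal a - 2) * hgf (shift a 2) 1 = phiThree a * hgf a 1 + psi a * hgf (shift a 1) 1 := by
  have e2 : shift (shift a 1) 1 = shift a 2 := by rw [shift_shift]; rfl
  have hs1 : 1 < (saal (shift a 1)).re := by rw [saal_shift, saal_one]; simp; linarith
  have h0 := hasSum_hgTerm ha (by linarith)
  have h1 := hasSum_mul_nat ha (by linarith)
  have h2 : HasSum (fun k : ℕ => hgTerm a k * (k * (k - 1))) (hgf (shift a 2) 1) := by
    have h := hasSum_mul_nat (ha.shift 1) hs1
    rw [e2] at h
    rw [← hasSum_nat_add_iff' 1]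
    simp only [hgTerm_shift_one] at h
    simpa [mul_assoc] using h
  have h := ((h0.mul_left (phiThree a)).add (h1.mul_left (psi a))).sub
    (h2.mul_left (saal a - 2))
  -- With G(k) = k (a₃ + k - 1) (a₄ + k - 1) t_k, the ratio of consecutive coefficients gives G(k +
  -- 1) = (a₀ + k)(a₁ + k)(a₂ + k) t_k. The summand is G(k + 1) - G(k), and G(0) = 0.
  have ht : ∀ n, ∑ k ∈ Finset.range n, (phiThree a * hgTerm a k + psi a * (hgTerm a k * k) -
      (saal a - 2) * (hgTerm a k * (k * (k - 1)))) =
      n * (a 3 + n - 1) * (a 4 + n - 1) * hgTerm a n := by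
    intro n
    induction n with
    | zero => simp
    | succ n ih =>
      rw [Finset.sum_range_succ, ih]
      have := hgTerm_succ ha n
      simp only [phiThree, psi, saal]
      push_cast
      linear_combination -this
  have h3 := h.tendsto_sum_nat
  simp only [ht] at h3
  have := tendsto_nhds_unique h3 (tendsto_telescope ha hs)
  linear_combination -this

/-- The series is positive at positive real parameters. -/
lemma hgf_ne_zero {a : Fin 5 → ℂ} (ha : Generic a) (hs : 0 < (saal a).re)
    (hre : ∀ i, (a i).im = 0) (hpos : ∀ i, 0 < (a i).re) : hgf a 1 ≠ 0 := by
  have hr : ∀ i, a i = ((a i).re : ℂ) := fun i => Complex.ext rfl (by simp [hre i])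
  set g : ℕ → ℝ := fun k => Real.Gamma ((a 0).re + k) * Real.Gamma ((a 1).re + k) *
    Real.Gamma ((a 2).re + k) / (Real.Gamma (1 + k) * Real.Gamma ((a 3).re + k) *
    Real.Gamma ((a 4).re + k)) with hg
  have hgT : ∀ k, hgTerm a k = (g k : ℂ) := fun k => by
    rw [hgTerm, hr 0, hr 1, hr 2, hr 3, hr 4]
    simp only [hg, Complex.ofReal_div, Complex.ofReal_mul]
    simp only [← Complex.Gamma_ofReal]
    push_cast
    rfl
  have hG : ∀ i (k : ℕ), 0 < Real.Gamma ((a i).re + k) := fun i k =>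
    Real.Gamma_pos_of_pos (by have := hpos i; positivity)
  have hgp : ∀ k, 0 < g k := fun k => by
    have := hG 0 k; have := hG 1 k; have := hG 2 k; have := hG 3 k; have := hG 4 k
    have : 0 < Real.Gamma (1 + (k : ℝ)) := Real.Gamma_pos_of_pos (by positivity)
    simp only [hg]; positivity
  have hsum : Summable g := by
    have h := summable_hgTerm ha hs
    simp only [funext hgT] at h
    exact Complex.summable_ofReal.1 h
  rw [hgf_one, tsum_congr hgT, ← Complex.ofReal_tsum]
  exact_mod_cast (hsum.tsum_pos (fun k => (hgp k).le) 0 (hgp 0)).ne'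

/-! ### Contiguity relations of the companions -/

/-- The projection to `ℂ / ℤ`. -/
def modInt : ℂ →+ ℂ ⧸ AddSubgroup.zmultiples (1 : ℂ) :=
  QuotientAddGroup.mk' _

lemma modInt_eq_zero_iff {x : ℂ} : modInt x = 0 ↔ ∃ n : ℤ, x = n := by
  rw [modInt, QuotientAddGroup.mk'_apply, QuotientAddGroup.eq_zero_iff,
    AddSubgroup.mem_zmultiples_iff]
  simp [eq_comm]

lemma modInt_one : modInt 1 = 0 := modInt_eq_zero_iff.2 ⟨1, by simp⟩

lemma modInt_two : modInt 2 = 0 := modInt_eq_zero_iff.2 ⟨2, by simp⟩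

/-- Genericity only concerns classes modulo ℤ, where the constants 1 and 2 in the involutions
disappear. -/
lemma generic_iff_modInt {a : Fin 5 → ℂ} : Generic a ↔
    (∀ i, modInt (a i) ≠ 0) ∧ ∀ i j, i < j → modInt (a i) ≠ modInt (a j) := by
  have h (i j) : modInt (a i) = modInt (a j) ↔ ∃ n : ℤ, a i - a j = n := by
    rw [← modInt_eq_zero_iff, map_sub, sub_eq_zero]
  simp only [Generic, Ne, modInt_eq_zero_iff, h, not_exists]
  refine and_congr_right fun _ => ⟨fun H i j hij => H i j hij.ne, fun H i j hij n e => ?_⟩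
  rcases lt_or_gt_of_ne hij with hij | hij
  · exact H i j hij n e
  · exact H j i hij (-n) (by push_cast; linear_combination -e)

lemma Generic.invol {a : Fin 5 → ℂ} (ha : Generic a) (ν : SingPt) (i : Fin 3) :
    Generic (invol ν i a) := by
  rw [generic_iff_modInt] at ha ⊢
  obtain ⟨h1, h2⟩ := ha
  have h01 := h2 0 1 (by decide)
  have h02 := h2 0 2 (by decide)
  have h03 := h2 0 3 (by decide)
  have h04 := h2 0 4 (by decide)
  have h12 := h2 1 2 (by decide)
  have h13 := h2 1 3 (by decide)
  have h14 := h2 1 4 (by decide)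
  have h23 := h2 2 3 (by decide)
  have h24 := h2 2 4 (by decide)
  have h34 := h2 3 4 (by decide)
  refine ⟨fun j => ?_, fun j k hjk => ?_⟩
  · cases ν <;> fin_cases i <;> fin_cases j <;>
    simp [HypThreeTerm.invol, modInt_one, modInt_two, h1, sub_eq_zero, h01, h02, h03, h04, h12, h13,
      h14, h23, h24, h34, h01.symm, h02.symm, h12.symm, h34.symm]
  · cases ν <;> fin_cases i <;> fin_cases j <;> fin_cases k <;>
    first
    | exact absurd hjk (by decide)
    | simp [HypThreeTerm.invol, modInt_one, modInt_two, h1, h01, h02, h03, h04, h12, h13,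
      h14, h23, h24, h34, h01.symm, h34.symm, sub_eq_neg_add, eq_comm (a := modInt _)]

lemma saal_invol (ν : SingPt) (i : Fin 3) (a : Fin 5 → ℂ) : saal (invol ν i a) = saal a := by
  cases ν <;> fin_cases i <;> simp [invol, saal] <;> ring

lemma invol_invol (ν : SingPt) (i : Fin 3) (a : Fin 5 → ℂ) : invol ν i (invol ν i a) = a := by
  funext j
  cases ν <;> fin_cases i <;> fin_cases j <;> simp [invol] <;> ring

/-- The linear part of `invol`, acting on lattice vectors. -/
def involShift : SingPt → Fin 3 → (Fin 5 → ℤ) → (Fin 5 → ℤ)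
  | .zero, 0, a => a
  | .zero, 1, a => ![a 0 - a 3, a 1 - a 3, a 2 - a 3, - a 3, a 4 - a 3]
  | .zero, 2, a => ![a 0 - a 4, a 1 - a 4, a 2 - a 4, a 3 - a 4, - a 4]
  | .infty, 0, a => ![a 0, a 0 - a 3, a 0 - a 4, a 0 - a 1, a 0 - a 2]
  | .infty, 1, a => ![a 1 - a 3, a 1, a 1 - a 4, a 1 - a 0, a 1 - a 2]
  | .infty, 2, a => ![a 2 - a 4, a 2 - a 3, a 2, a 2 - a 1, a 2 - a 0]

lemma invol_shift (ν : SingPt) (i : Fin 3) (a : Fin 5 → ℂ) (p : Fin 5 → ℤ) :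
    invol ν i (shift a p) = shift (invol ν i a) (involShift ν i p) := by
  funext j
  cases ν <;> fin_cases i <;> fin_cases j <;> simp [invol, shift, involShift] <;> ring

/-- The six directions `𝟏, e₀, e₁, e₂, -e₃, -e₄`. -/
def dir : Fin 6 → Fin 5 → ℤ :=
  ![1, step 0 true, step 1 true, step 2 true, step 3 false, step 4 false]

/-- The coefficient of `h(a)` in `h(a + dir k)`. -/
def dirCoeff (a : Fin 5 → ℂ) : Fin 6 → ℂ := ![0, a 0, a 1, a 2, a 3 - 1, a 4 - 1]

/-- The permutation of the six directions induced by `invol`. -/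
def dirPerm : SingPt → Fin 3 → Fin 6 → Fin 6
  | .zero, 0 => ![0, 1, 2, 3, 4, 5]
  | .zero, 1 => ![4, 1, 2, 3, 0, 5]
  | .zero, 2 => ![5, 1, 2, 3, 4, 0]
  | .infty, 0 => ![1, 0, 4, 5, 2, 3]
  | .infty, 1 => ![2, 4, 0, 5, 1, 3]
  | .infty, 2 => ![3, 5, 4, 0, 2, 1]

/-- The sign of `exp(iπ s(a))` under the shift by `𝟏`. -/
def dirSign : SingPt → ℂ
  | .zero => 1
  | .infty => -1

lemma involShift_dir (ν : SingPt) (i : Fin 3) (k : Fin 6) :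
    involShift ν i (dir k) = dir (dirPerm ν i k) := by
  cases ν <;> revert i k <;> decide

lemma saal_dir (k : Fin 6) : saal (dir k) = -1 := by
  revert k; decide

/-- The contiguity relations, in the domain of convergence. -/
structure IsContiguous (h : (Fin 5 → ℂ) → ℂ) : Prop where
  one : ∀ {a}, Generic a → 1 < (saal a).re → ∀ k,
    h (shift a (dir k)) = dirCoeff a k * h a + h (shift a 1)
  two : ∀ {a}, Generic a → 2 < (saal a).re →
    (saal a - 2) * h (shift a 2) = phiThree a * h a + psi a * h (shift a 1)

lemma hgf_dir {b : Fin 5 → ℂ} (hb : Generic b) (hs : 1 < (saal b).re) (k : Fin 6) :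
    hgf (shift b (dir k)) 1 = dirCoeff b k * hgf b 1 + hgf (shift b 1) 1 := by
  fin_cases k
  · simp [dir, dirCoeff]
  · exact hgf_up hb hs 0 (by decide)
  · exact hgf_up hb hs 1 (by decide)
  · exact hgf_up hb hs 2 (by decide)
  · exact hgf_down hb hs 3 (by decide)
  · exact hgf_down hb hs 4 (by decide)

lemma dirCoeff_shift_dir (b : Fin 5 → ℂ) (k : Fin 6) :
    dirCoeff (shift b (dir k)) k = dirCoeff b k + (![0, 1, 1, 1, -1, -1] : Fin 6 → ℂ) k := by
  fin_cases k <;> simp [dirCoeff, dir, shift, step] <;> ring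

lemma dirCoeff_shift_one (b : Fin 5 → ℂ) (k : Fin 6) :
    dirCoeff (shift b 1) k = dirCoeff b k + (![0, 1, 1, 1, 1, 1] : Fin 6 → ℂ) k := by
  fin_cases k <;> simp [dirCoeff, shift]

lemma hgf_dir_two {b : Fin 5 → ℂ} (hb : Generic b) (hs : 2 < (saal b).re) (k : Fin 6) :
    hgf (shift b (dir k + dir k)) 1 =
      (dirCoeff b k + (![0, 1, 1, 1, -1, -1] : Fin 6 → ℂ) k) * hgf (shift b (dir k)) 1 +
      (dirCoeff b k + (![0, 1, 1, 1, 1, 1] : Fin 6 → ℂ) k) * hgf (shift b 1) 1 +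
      hgf (shift b 2) 1 := by
  have e1 := hgf_dir (hb.shift (dir k)) (by rw [saal_shift, saal_dir]; simp; linarith) k
  have e2 := hgf_dir (hb.shift 1) (by rw [saal_shift, saal_one]; simp; linarith) k
  rw [shift_shift, shift_shift, dirCoeff_shift_dir] at e1
  rw [shift_shift, shift_shift, add_comm (1 : Fin 5 → ℤ), dirCoeff_shift_one] at e2
  rw [e1, e2, show (1 + 1 : Fin 5 → ℤ) = 2 from rfl]
  ring

/-- A common factor of the companions. -/
noncomputable def compFactor : SingPt → (Fin 5 → ℂ) → ℂ
  | .zero, _ => 1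
  | .infty, a => Complex.exp (Complex.I * Real.pi * saal a)

lemma companion_eq (ν : SingPt) (i : Fin 3) (a : Fin 5 → ℂ) :
    companion ν i a = compFactor ν a * hgf (invol ν i a) 1 := by
  cases ν <;> simp [companion, sol, compFactor]

lemma compFactor_ne_zero (ν : SingPt) (a : Fin 5 → ℂ) : compFactor ν a ≠ 0 := by
  cases ν <;> simp [compFactor, Complex.exp_ne_zero]

lemma compFactor_shift (ν : SingPt) (a : Fin 5 → ℂ) {p : Fin 5 → ℤ} (hp : saal p = -1) :
    compFactor ν (shift a p) = dirSign ν * compFactor ν a := by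
  cases ν
  · simp [compFactor, dirSign]
  · simp only [compFactor, dirSign, saal_shift, hp]
    have : Complex.I * Real.pi * (saal a + ((-1 : ℤ) : ℂ)) =
        Complex.I * Real.pi * saal a - Real.pi * Complex.I := by push_cast; ring
    rw [this, Complex.exp_sub, Complex.exp_pi_mul_I]
    ring

/-- The contiguity relation of a companion in direction k is the difference of two relations of f at
the transformed point, in the directions `dirPerm ν i k` and `dirPerm ν i 0`. This identity says
that the difference has the coefficient required, up to the sign that the exponential factor
compensates. -/
lemma dirCoeff_invol (ν : SingPt) (i : Fin 3) (a : Fin 5 → ℂ) (k : Fin 6) :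
    dirCoeff (invol ν i a) (dirPerm ν i k) =
      dirSign ν * dirCoeff a k + dirCoeff (invol ν i a) (dirPerm ν i 0) := by
  cases ν <;> fin_cases i <;> fin_cases k <;>
    simp [dirCoeff, invol, dirPerm, dirSign] <;> ring

lemma isContiguous_companion (ν : SingPt) (i : Fin 3) : IsContiguous (companion ν i) := by
  refine ⟨fun {a} ha hs k => ?_, fun {a} ha hs => ?_⟩
  · have hb := ha.invol ν i
    have hsb : 1 < (saal (invol ν i a)).re := by rwa [saal_invol]
    rw [companion_eq, companion_eq, companion_eq, compFactor_shift ν a (saal_dir k),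
      compFactor_shift ν a saal_one, invol_shift, invol_shift, involShift_dir,
      show (1 : Fin 5 → ℤ) = dir 0 from rfl, involShift_dir, hgf_dir hb hsb, hgf_dir hb hsb,
      dirCoeff_invol]
    cases ν <;> simp [dirSign] <;> ring
  · have hb := ha.invol ν i
    have hsb : 2 < (saal (invol ν i a)).re := by rwa [saal_invol]
    have e2 : shift a 2 = shift (shift a 1) 1 := by rw [shift_shift]; rfl
    have h1 := hgf_dir hb (by linarith) (dirPerm ν i 0)
    -- The translation by 2·𝟏 becomes twice a direction that need not be 𝟏, so the value there is
    -- first expressed through f at b, b + 𝟏 and b + 2·𝟏, where b is the transformed point; the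
    -- recurrence of f applies to these.
    have h2 := hgf_dir_two hb hsb (dirPerm ν i 0)
    have h3 := hgf_recurrence hb hsb
    rw [saal_invol] at h3
    rw [companion_eq, companion_eq, companion_eq, e2, compFactor_shift ν _ saal_one,
      compFactor_shift ν a saal_one, invol_shift, invol_shift,
      show (1 : Fin 5 → ℤ) = dir 0 from rfl, involShift_dir, shift_shift, h2, h1]
    generalize compFactor ν a = c
    generalize hgf (invol ν i a) 1 = f at *
    generalize hgf (shift (invol ν i a) 1) 1 = g at *
    generalize hgf (shift (invol ν i a) 2) 1 = w at *
    cases ν <;> fin_cases i <;>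
    simp [dirCoeff, invol, dirPerm, dirSign, saal, phiThree, psi] at h3 ⊢ <;>
    linear_combination c * h3

/-! ### Values of fractions under a ring homomorphism to `ℂ` -/

section Values

variable {R : Type*} [CommRing R] [IsDomain R]

/-- The fraction `u` has a representative without pole at `φ`, and its value there is `c`. -/
def HasValue (φ : R →+* ℂ) (u : FractionRing R) (c : ℂ) : Prop :=
  ∃ P Q : R, φ Q ≠ 0 ∧ u = algebraMap R (FractionRing R) P / algebraMap R (FractionRing R) Q ∧
    c = φ P / φ Q

variable {φ : R →+* ℂ} {u v : FractionRing R} {c d : ℂ}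

lemma algebraMap_ne_zero_of_value {Q : R} (h : φ Q ≠ 0) : algebraMap R (FractionRing R) Q ≠ 0 := by
  rw [Ne, IsFractionRing.to_map_eq_zero_iff]
  rintro rfl
  simp at h

lemma hasValue_algebraMap (P : R) : HasValue φ (algebraMap R (FractionRing R) P) (φ P) :=
  ⟨P, 1, by simp, by simp, by simp⟩

lemma HasValue.add (hu : HasValue φ u c) (hv : HasValue φ v d) : HasValue φ (u + v) (c + d) := by
  obtain ⟨P, Q, hQ, rfl, rfl⟩ := hu
  obtain ⟨P', Q', hQ', rfl, rfl⟩ := hv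
  have h1 := algebraMap_ne_zero_of_value hQ
  have h2 := algebraMap_ne_zero_of_value hQ'
  exact ⟨P * Q' + Q * P', Q * Q', by simp [hQ, hQ'], by simp [div_add_div _ _ h1 h2],
    by simp [div_add_div _ _ hQ hQ']⟩

lemma HasValue.mul (hu : HasValue φ u c) (hv : HasValue φ v d) : HasValue φ (u * v) (c * d) := by
  obtain ⟨P, Q, hQ, rfl, rfl⟩ := hu
  obtain ⟨P', Q', hQ', rfl, rfl⟩ := hv
  exact ⟨P * P', Q * Q', by simp [hQ, hQ'], by simp [div_mul_div_comm], by simp [div_mul_div_comm]⟩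

lemma HasValue.neg (hu : HasValue φ u c) : HasValue φ (-u) (-c) := by
  obtain ⟨P, Q, hQ, rfl, rfl⟩ := hu
  exact ⟨-P, Q, hQ, by simp [neg_div], by simp [neg_div]⟩

lemma HasValue.sub (hu : HasValue φ u c) (hv : HasValue φ v d) : HasValue φ (u - v) (c - d) := by
  rw [sub_eq_add_neg, sub_eq_add_neg]; exact hu.add hv.neg

lemma HasValue.inv (hu : HasValue φ u c) (hc : c ≠ 0) : HasValue φ u⁻¹ c⁻¹ := by
  obtain ⟨P, Q, hQ, rfl, rfl⟩ := hu
  exact ⟨Q, P, fun h => hc (by simp [h]), by simp, by simp⟩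

lemma HasValue.div (hu : HasValue φ u c) (hv : HasValue φ v d) (hd : d ≠ 0) :
    HasValue φ (u / v) (c / d) := by
  rw [div_eq_mul_inv, div_eq_mul_inv]; exact hu.mul (hv.inv hd)

lemma HasValue.pow (hu : HasValue φ u c) (n : ℕ) : HasValue φ (u ^ n) (c ^ n) := by
  obtain ⟨P, Q, hQ, rfl, rfl⟩ := hu
  exact ⟨P ^ n, Q ^ n, by simp [hQ], by simp [div_pow], by simp [div_pow]⟩

lemma hasValue_int (n : ℤ) : HasValue φ (n : FractionRing R) n := by
  simpa using hasValue_algebraMap (φ := φ) (n : R)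

lemma hasValue_one : HasValue φ (1 : FractionRing R) 1 := by
  simpa using hasValue_int (φ := φ) 1

lemma hasValue_zero : HasValue φ (0 : FractionRing R) 0 := by
  simpa using hasValue_int (φ := φ) 0

lemma hasValue_two : HasValue φ (2 : FractionRing R) 2 := by
  simpa using hasValue_int (φ := φ) 2

/-- A value is defined through some pole-free representative; cross-multiplication in the domain
shows that the choice is irrelevant. An identity between fractions therefore yields an identity
between their values, also where an intermediate formula over ℂ would divide by zero. -/
lemma HasValue.unique (hu : HasValue φ u c) (hv : HasValue φ u d) : c = d := by
  obtain ⟨P, Q, hQ, rfl, rfl⟩ := hu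
  obtain ⟨P', Q', hQ', e, rfl⟩ := hv
  rw [div_eq_div_iff (algebraMap_ne_zero_of_value hQ) (algebraMap_ne_zero_of_value hQ'),
    ← map_mul, ← map_mul] at e
  have := congrArg φ (IsFractionRing.injective R (FractionRing R) e)
  rw [map_mul, map_mul] at this
  rw [div_eq_div_iff hQ hQ', this]

variable {x : Fin 5 → FractionRing R} {b : Fin 5 → ℂ}

lemma hasValue_shift (hx : ∀ i, HasValue φ (x i) (b i)) (p : Fin 5 → ℤ) (i : Fin 5) :
    HasValue φ (shift x p i) (shift b p i) :=
  (hx i).add (hasValue_int _)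

lemma hasValue_saal (hx : ∀ i, HasValue φ (x i) (b i)) : HasValue φ (saal x) (saal b) :=
  ((((hx 3).add (hx 4)).sub (hx 0)).sub (hx 1)).sub (hx 2)

lemma hasValue_phiThree (hx : ∀ i, HasValue φ (x i) (b i)) :
    HasValue φ (phiThree x) (phiThree b) :=
  ((hx 0).mul (hx 1)).mul (hx 2)

lemma hasValue_psi (hx : ∀ i, HasValue φ (x i) (b i)) : HasValue φ (psi x) (psi b) :=
  ((hasValue_one.add (((hx 0).add (hx 1)).add (hx 2))).add
    ((((hx 0).mul (hx 1)).add ((hx 1).mul (hx 2))).add ((hx 2).mul (hx 0)))).sub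
    ((hx 3).mul (hx 4))

section Entries

variable {x y z b c : FractionRing R} {x' y' z' b' c' : ℂ}

lemma hasValue_numUp (hx : HasValue φ x x') (hy : HasValue φ y y') (hz : HasValue φ z z')
    (hb : HasValue φ b b') (hc : HasValue φ c c') (h : b' + c' - x' - y' - z' - 2 ≠ 0)
    (r k : Fin 2) : HasValue φ (numUp x y z b c r k) (numUp x' y' z' b' c' r k) := by
  have h1 := hasValue_one (φ := φ)
  have hs := ((((hb.add hc).sub hx).sub hy).sub hz).sub (hasValue_two (φ := φ))
  fin_cases r <;> fin_cases k
  · exact hx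
  · exact h1
  · exact ((hx.mul hy).mul hz).div hs h
  · exact ((hy.mul hz).sub (((hx.sub hb).add h1).mul ((hx.sub hc).add h1))).div hs h

lemma hasValue_numDown (hx : HasValue φ x x') (hy : HasValue φ y y') (hz : HasValue φ z z')
    (hb : HasValue φ b b') (hc : HasValue φ c c') (h : x' - 1 ≠ 0) (h' : x' - b' ≠ 0)
    (h'' : x' - c' ≠ 0)
    (r k : Fin 2) : HasValue φ (numDown x y z b c r k) (numDown x' y' z' b' c' r k) := by
  have h1 := hasValue_one (φ := φ)
  have hs := ((((hb.add hc).sub hx).sub hy).sub hz).sub h1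
  have hd := (hx.sub hb).mul (hx.sub hc)
  have hd0 := mul_ne_zero h' h''
  have he := ((hx.sub h1).mul (hx.sub hb)).mul (hx.sub hc)
  have he0 := mul_ne_zero (mul_ne_zero h h') h''
  fin_cases r <;> fin_cases k
  · exact (hd.sub (hy.mul hz)).div he he0
  · exact hs.div he he0
  · exact (hy.mul hz).div hd hd0
  · exact (hs.div hd hd0).neg

lemma hasValue_denUp (hb : HasValue φ b b') (hc : HasValue φ c c') (hx : HasValue φ x x')
    (hy : HasValue φ y y') (hz : HasValue φ z z') (h : b' - x' ≠ 0) (h' : b' - y' ≠ 0)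
    (h'' : b' - z' ≠ 0)
    (r k : Fin 2) : HasValue φ (denUp b c x y z r k) (denUp b' c' x' y' z' r k) := by
  have h1 := hasValue_one (φ := φ)
  have hs := ((((hb.add hc).sub hx).sub hy).sub hz).sub h1
  have he := ((hb.sub hx).mul (hb.sub hy)).mul (hb.sub hz)
  have he0 := mul_ne_zero (mul_ne_zero h h') h''
  fin_cases r <;> fin_cases k
  · exact (((hb.pow 2).sub (((hx.add hy).add hz).mul hb)).add
      (((hx.mul hy).add (hy.mul hz)).add (hz.mul hx))).div he he0
  · exact (hs.div he he0).neg
  · exact (((hx.mul hy).mul hz).div he he0).neg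
  · exact (hb.mul hs).div he he0

lemma hasValue_denDown (hb : HasValue φ b b') (hc : HasValue φ c c') (hx : HasValue φ x x')
    (hy : HasValue φ y y') (hz : HasValue φ z z') (h : b' + c' - x' - y' - z' - 2 ≠ 0)
    (r k : Fin 2) : HasValue φ (denDown b c x y z r k) (denDown b' c' x' y' z' r k) := by
  have h1 := hasValue_one (φ := φ)
  have hs := ((((hb.add hc).sub hx).sub hy).sub hz).sub (hasValue_two (φ := φ))
  fin_cases r <;> fin_cases k
  · exact hb.sub h1
  · exact h1
  · exact ((hx.mul hy).mul hz).div hs h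
  · exact ((((hb.sub h1).pow 2).sub (((hx.add hy).add hz).mul (hb.sub h1))).add
      (((hx.mul hy).add (hy.mul hz)).add (hz.mul hx))).div hs h

end Entries

/-- At a generic point the only possible pole of a contiguous matrix is s = 2, and only for a step
that lowers s. -/
lemma hasValue_contig (hx : ∀ i, HasValue φ (x i) (b i)) (hb : Generic b) (i : Fin 5) (ε : Bool)
    (hs : saal (step i ε) = -1 → saal b ≠ 2) (r k : Fin 2) :
    HasValue φ (contig x i ε r k) (contig b i ε r k) := by
  have hd : ∀ i j : Fin 5, i ≠ j → b i - b j ≠ 0 := fun i j hij => by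
    simpa using hb.2 i j hij 0
  have h1 : ∀ i, b i - 1 ≠ 0 := fun i e => hb.1 i 1 (by push_cast; linear_combination e)
  cases ε <;> fin_cases i
  · exact hasValue_numDown (hx 0) (hx 1) (hx 2) (hx 3) (hx 4) (h1 _) (hd _ _ (by decide))
      (hd _ _ (by decide)) r k
  · exact hasValue_numDown (hx 1) (hx 2) (hx 0) (hx 3) (hx 4) (h1 _) (hd _ _ (by decide))
      (hd _ _ (by decide)) r k
  · exact hasValue_numDown (hx 2) (hx 0) (hx 1) (hx 3) (hx 4) (h1 _) (hd _ _ (by decide))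
      (hd _ _ (by decide)) r k
  · exact hasValue_denDown (hx 3) (hx 4) (hx 0) (hx 1) (hx 2)
      (fun e => hs (by decide) (by simp only [saal]; linear_combination e)) r k
  · exact hasValue_denDown (hx 4) (hx 3) (hx 0) (hx 1) (hx 2)
      (fun e => hs (by decide) (by simp only [saal]; linear_combination e)) r k
  · exact hasValue_numUp (hx 0) (hx 1) (hx 2) (hx 3) (hx 4)
      (fun e => hs (by decide) (by simp only [saal]; linear_combination e)) r k
  · exact hasValue_numUp (hx 1) (hx 2) (hx 0) (hx 3) (hx 4)
      (fun e => hs (by decide) (by simp only [saal]; linear_combination e)) r k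
  · exact hasValue_numUp (hx 2) (hx 0) (hx 1) (hx 3) (hx 4)
      (fun e => hs (by decide) (by simp only [saal]; linear_combination e)) r k
  · exact hasValue_denUp (hx 3) (hx 4) (hx 0) (hx 1) (hx 2) (hd _ _ (by decide))
      (hd _ _ (by decide)) (hd _ _ (by decide)) r k
  · exact hasValue_denUp (hx 4) (hx 3) (hx 0) (hx 1) (hx 2) (hd _ _ (by decide))
      (hd _ _ (by decide)) (hd _ _ (by decide)) r k

lemma hasValue_matrix_mul {M N : Matrix (Fin 2) (Fin 2) (FractionRing R)}
    {M' N' : Matrix (Fin 2) (Fin 2) ℂ} (hM : ∀ r k, HasValue φ (M r k) (M' r k))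
    (hN : ∀ r k, HasValue φ (N r k) (N' r k)) (r k : Fin 2) :
    HasValue φ ((M * N) r k) ((M' * N') r k) := by
  rw [Matrix.mul_apply, Matrix.mul_apply, Fin.sum_univ_two, Fin.sum_univ_two]
  exact ((hM r 0).mul (hN 0 k)).add ((hM r 1).mul (hN 1 k))

lemma hasValue_matrix_one (r k : Fin 2) :
    HasValue φ ((1 : Matrix (Fin 2) (Fin 2) (FractionRing R)) r k)
      ((1 : Matrix (Fin 2) (Fin 2) ℂ) r k) := by
  rw [Matrix.one_apply, Matrix.one_apply]
  split_ifs
  · exact hasValue_one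
  · exact hasValue_zero

lemma hasValue_pathMat (w : List (Fin 5 × Bool)) {x : Fin 5 → FractionRing R} {b : Fin 5 → ℂ}
    (hx : ∀ i, HasValue φ (x i) (b i)) (hb : Regular b) (r k : Fin 2) :
    HasValue φ (pathMat x w r k) (pathMat b w r k) := by
  induction w generalizing x b r k with
  | nil => exact hasValue_matrix_one r k
  | cons e w ih =>
    exact hasValue_matrix_mul (ih (hasValue_shift hx _) (hb.shift _))
      (hasValue_contig hx hb.1 e.1 e.2 fun _ => by simpa using hb.2 2) r k

end Values

/-! ### Transport of the companions along lattice paths -/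

/-- The vector `(h(a), h(a + 𝟏))`. -/
def pairVec (h : (Fin 5 → ℂ) → ℂ) (a : Fin 5 → ℂ) : Fin 2 → ℂ := ![h a, h (shift a 1)]

lemma saal_step_cases (i : Fin 5) (ε : Bool) : saal (step i ε) = 1 ∨ saal (step i ε) = -1 := by
  revert i ε; decide

lemma saal_step_not (i : Fin 5) (ε : Bool) : saal (step i (!ε)) = -saal (step i ε) := by
  revert i ε; decide

lemma ne_two_of_re {z : ℂ} (h : 2 < z.re) : z ≠ 2 := by
  rintro rfl; simp at h

/-! ### Transport by a single step. -/

lemma pairVec_dir {h : (Fin 5 → ℂ) → ℂ} (hh : IsContiguous h) {a : Fin 5 → ℂ} (ha : Generic a)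
    (hs : 2 < (saal a).re) (i : Fin 5) (ε : Bool) (hi : saal (step i ε) = -1) :
    pairVec h (shift a (step i ε)) = (contig a i ε).mulVec (pairVec h a) := by
  have hs2 : saal a - 2 ≠ 0 := sub_ne_zero.2 (ne_two_of_re hs)
  -- The unit steps that lower s are exactly the five directions other than 𝟏.
  obtain ⟨k, hk⟩ : ∃ k : Fin 6, step i ε = dir k ∧ k ≠ 0 := by
    revert hi; revert i ε; decide
  have h1 := hh.one ha (by linarith) k
  have h2 := hh.one (ha.shift 1) (by rw [saal_shift, saal_one]; simp; linarith) k
  rw [dirCoeff_shift_one, shift_shift, shift_shift, show (1 + 1 : Fin 5 → ℤ) = 2 from rfl,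
    add_comm] at h2
  have h3 := hh.two ha hs
  rw [pairVec, shift_shift, hk.1, h2, h1, pairVec]
  have h4 : h (shift a 2) = (phiThree a * h a + psi a * h (shift a 1)) / (saal a - 2) := by
    rw [eq_div_iff hs2, ← h3]; ring
  rw [h4]
  generalize h a = f
  generalize h (shift a 1) = g
  obtain ⟨hk1, hk0⟩ := hk
  have hs0 : a 3 + a 4 - a 0 - a 1 - a 2 - 2 ≠ 0 := hs2
  have hs1 : a 3 + a 4 - a 1 - a 2 - a 0 - 2 ≠ 0 := fun e => hs0 (by linear_combination e)
  have hs3 : a 3 + a 4 - a 2 - a 0 - a 1 - 2 ≠ 0 := fun e => hs0 (by linear_combination e)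
  have hs4 : a 4 + a 3 - a 0 - a 1 - a 2 - 2 ≠ 0 := fun e => hs0 (by linear_combination e)
  have hm : ∀ j : Fin 5, ∀ δ : Bool, dir k = step j δ → i = j ∧ ε = δ := fun j δ e => by
    rw [e] at hk1; clear * - hk1; revert i j ε δ; decide
  fin_cases k
  · exact absurd rfl hk0
  all_goals
    first
    | obtain ⟨rfl, rfl⟩ := hm 0 true rfl
    | obtain ⟨rfl, rfl⟩ := hm 1 true rfl
    | obtain ⟨rfl, rfl⟩ := hm 2 true rfl
    | obtain ⟨rfl, rfl⟩ := hm 3 false rfl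
    | obtain ⟨rfl, rfl⟩ := hm 4 false rfl
    funext j
    fin_cases j <;>
    simp [dirCoeff, contig, numUp, denDown, saal, phiThree, psi, Matrix.mulVec, dotProduct,
      Fin.sum_univ_two] <;> field_simp <;> ring

/-- Unlike in `contig_inv`, integer values of s other than 2 are allowed; the domain of convergence
contains such points. -/
lemma contig_inv_of_ne {a : Fin 5 → ℂ} (ha : Generic a) {i : Fin 5} {ε : Bool}
    (hi : saal (step i ε) = -1) (hs : saal a ≠ 2) :
    contig a i ε * contig (shift a (step i ε)) i (!ε) = 1 := by
  have hs0 : a 3 + a 4 - a 0 - a 1 - a 2 ≠ 2 := hs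
  have hd : ∀ i j : Fin 5, i ≠ j → ∀ n : ℤ, a i - a j ≠ n := ha.2
  have h0 : ∀ i (n : ℤ), a i ≠ n := ha.1
  have hj : ∀ i j, shift a (step i false) j = if j = i then a j - 1 else a j := fun i j => by
    by_cases h : j = i
    · subst h; simp [shift, step, sub_eq_add_neg]
    · simp [shift, step, h]
  rw [mul_eq_one_comm]
  fin_cases i <;> cases ε <;> first | exact absurd hi (by decide) | skip
  · simp [contig, shift_step]
    exact num_mul_one (by simpa using h0 0 0)
      (fun e => hd 0 3 (by decide) (-1) (by push_cast; linear_combination e))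
      (fun e => hd 0 4 (by decide) (-1) (by push_cast; linear_combination e))
      (fun e => hs0 (by linear_combination e))
  · simp [contig, shift_step]
    exact num_mul_one (by simpa using h0 1 0)
      (fun e => hd 1 3 (by decide) (-1) (by push_cast; linear_combination e))
      (fun e => hd 1 4 (by decide) (-1) (by push_cast; linear_combination e))
      (fun e => hs0 (by linear_combination e))
  · simp [contig, shift_step]
    exact num_mul_one (by simpa using h0 2 0)
      (fun e => hd 2 3 (by decide) (-1) (by push_cast; linear_combination e))
      (fun e => hd 2 4 (by decide) (-1) (by push_cast; linear_combination e))
      (fun e => hs0 (by linear_combination e))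
  · simp [contig, hj]
    rw [mul_eq_one_comm]
    have := den_mul_one (b := a 3 - 1) (c := a 4) (x := a 0) (y := a 1) (z := a 2)
      (fun e => hs0 (by linear_combination e))
      (fun e => hd 3 0 (by decide) 1 (by push_cast; linear_combination e))
      (fun e => hd 3 1 (by decide) 1 (by push_cast; linear_combination e))
      (fun e => hd 3 2 (by decide) 1 (by push_cast; linear_combination e))
    rwa [sub_add_cancel] at this
  · simp [contig, hj]
    rw [mul_eq_one_comm]
    have := den_mul_one (b := a 4 - 1) (c := a 3) (x := a 0) (y := a 1) (z := a 2)
      (fun e => hs0 (by linear_combination e))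
      (fun e => hd 4 0 (by decide) 1 (by push_cast; linear_combination e))
      (fun e => hd 4 1 (by decide) 1 (by push_cast; linear_combination e))
      (fun e => hd 4 2 (by decide) 1 (by push_cast; linear_combination e))
    rwa [sub_add_cancel] at this

/-- A step that raises s is the inverse of a step that lowers it, taken from the end point, where Re
s > 2 holds automatically. -/
lemma pairVec_step {h : (Fin 5 → ℂ) → ℂ} (hh : IsContiguous h) {a : Fin 5 → ℂ} (ha : Generic a)
    (hs : 1 < (saal a).re) (i : Fin 5) (ε : Bool) (hs' : 1 < (saal (shift a (step i ε))).re) :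
    pairVec h (shift a (step i ε)) = (contig a i ε).mulVec (pairVec h a) := by
  rcases saal_step_cases i ε with hi | hi
  · have hn : saal (step i (!ε)) = -1 := by rw [saal_step_not, hi]
    have hs2 : 2 < (saal (shift a (step i ε))).re := by
      rw [saal_shift, hi]; simp; linarith
    have hb := ha.shift (step i ε)
    have e := pairVec_dir hh hb hs2 i (!ε) hn
    have e' := contig_inv_of_ne hb hn (ne_two_of_re hs2)
    rw [shift_shift, step_not, shift_zero] at e
    rw [shift_shift, step_not, shift_zero, Bool.not_not, mul_eq_one_comm] at e'
    rw [e, Matrix.mulVec_mulVec, e', Matrix.one_mulVec]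
  · refine pairVec_dir hh ha ?_ i ε hi
    rw [saal_shift, hi] at hs'; simp at hs'; linarith

/-- All points visited by the path lie in the half space `1 < Re s`. -/
def GoodPath : (Fin 5 → ℂ) → List (Fin 5 × Bool) → Prop
  | _, [] => True
  | b, e :: w => 1 < (saal (shift b (step e.1 e.2))).re ∧ GoodPath (shift b (step e.1 e.2)) w

lemma GoodPath.append {b : Fin 5 → ℂ} {w w' : List (Fin 5 × Bool)} (h : GoodPath b w)
    (h' : GoodPath (shift b (endPt w)) w') : GoodPath b (w ++ w') := by
  induction w generalizing b with
  | nil => simpa [endPt, shift_zero] using h'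
  | cons e w ih => exact ⟨h.1, ih h.2 (by rwa [shift_shift])⟩

lemma saal_add (p q : Fin 5 → ℤ) : saal (p + q) = saal p + saal q := by
  simp only [saal, Pi.add_apply]; ring

lemma goodPath_inc {b : Fin 5 → ℂ} {w : List (Fin 5 × Bool)}
    (hw : ∀ e ∈ w, saal (step e.1 e.2) = 1) (hb : 1 < (saal b).re) : GoodPath b w := by
  induction w generalizing b with
  | nil => trivial
  | cons e w ih =>
    have h1 : 1 < (saal (shift b (step e.1 e.2))).re := by
      rw [saal_shift, hw e (by simp)]; simp; linarith
    exact ⟨h1, ih (fun e he => hw e (by simp [he])) h1⟩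

lemma goodPath_dec {b : Fin 5 → ℂ} {w : List (Fin 5 × Bool)}
    (hw : ∀ e ∈ w, saal (step e.1 e.2) = -1) (hb : 1 < (saal (shift b (endPt w))).re) :
    GoodPath b w ∧ saal (endPt w) ≤ 0 := by
  induction w generalizing b with
  | nil => exact ⟨trivial, le_rfl⟩
  | cons e w ih =>
    have h0 := hw e (by simp)
    have hb' : 1 < (saal (shift (shift b (step e.1 e.2)) (endPt w))).re := by rwa [shift_shift]
    obtain ⟨h1, h2⟩ := ih (fun e he => hw e (by simp [he])) hb'
    refine ⟨⟨?_, h1⟩, ?_⟩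
    · rw [saal_shift] at hb'
      have : ((saal (endPt w) : ℤ) : ℝ) ≤ 0 := by exact_mod_cast h2
      simp at hb'; linarith
    · show saal (step e.1 e.2 + endPt w) ≤ 0
      rw [saal_add, h0]; omega

lemma exists_goodPath {b : Fin 5 → ℂ} {p : Fin 5 → ℤ} (hb : 1 < (saal b).re)
    (hp : 1 < (saal (shift b p)).re) : ∃ w, endPt w = p ∧ GoodPath b w := by
  -- All steps that raise s are taken before those that lower it. Along such a path Re s first
  -- increases from its initial value and then decreases to its final value, so it stays above 1.
  set f : Fin 5 × Bool → Bool := fun e => decide (saal (step e.1 e.2) = 1) with hf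
  have hperm := List.filter_append_perm f (axisPath p)
  have he : endPt ((axisPath p).filter f ++ (axisPath p).filter (!f ·)) = p :=
    (endPt_perm hperm).trans (endPt_axisPath p)
  refine ⟨_, he, (goodPath_inc (fun e h => ?_) hb).append (goodPath_dec (fun e h => ?_) ?_).1⟩
  · simpa [hf] using (List.mem_filter.1 h).2
  · exact (saal_step_cases e.1 e.2).resolve_left (by simpa [hf] using (List.mem_filter.1 h).2)
  · rw [shift_shift, ← endPt_append, he]; exact hp

lemma pairVec_path {R : Type*} [CommRing R] [IsDomain R] {φ : R →+* ℂ} {h : (Fin 5 → ℂ) → ℂ}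
    (hh : IsContiguous h) {x : Fin 5 → FractionRing R} {b : Fin 5 → ℂ}
    (hx : ∀ i, HasValue φ (x i) (b i)) (hb : Generic b) (hs : 1 < (saal b).re)
    {w : List (Fin 5 × Bool)} (hw : GoodPath b w) :
    pairVec h (shift b (endPt w)) = (pathMat b w).mulVec (pairVec h b) ∧
      ∀ r k, HasValue φ (pathMat x w r k) (pathMat b w r k) := by
  induction w generalizing x b with
  | nil => exact ⟨by simp [endPt, pathMat, shift_zero], hasValue_matrix_one⟩
  | cons e w ih =>
    obtain ⟨h1, h2⟩ := ih (hasValue_shift hx _) (hb.shift _) hw.1 hw.2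
    refine ⟨?_, hasValue_matrix_mul h2 (hasValue_contig hx hb e.1 e.2 fun hi h => ?_)⟩
    · rw [shift_shift] at h1
      show pairVec h (shift b (step e.1 e.2 + endPt w)) =
        (pathMat (shift b (step e.1 e.2)) w * contig b e.1 e.2).mulVec (pairVec h b)
      rw [h1, pairVec_step hh hb hs e.1 e.2 hw.1, Matrix.mulVec_mulVec]
    -- A step lowering s from s = 2 would end at s = 1, outside the half space of a good path.
    · have := hw.1
      rw [saal_shift, h, hi] at this
      norm_num at this

/-- The vector `(h(b + p), h(b + p + 𝟏))` is obtained by evaluating `A(x; p)` at `b`. -/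
lemma exists_pairVec_shift {R : Type*} [CommRing R] [IsDomain R] {φ : R →+* ℂ}
    {h : (Fin 5 → ℂ) → ℂ} (hh : IsContiguous h) {x : Fin 5 → FractionRing R} {b : Fin 5 → ℂ}
    (hx : ∀ i, HasValue φ (x i) (b i)) (hxr : Regular x) (hb : Generic b) (hs : 1 < (saal b).re)
    {p : Fin 5 → ℤ} (hp : 1 < (saal (shift b p)).re) :
    ∃ M : Matrix (Fin 2) (Fin 2) ℂ, pairVec h (shift b p) = M.mulVec (pairVec h b) ∧
      ∀ r k, HasValue φ (connMat x p r k) (M r k) := by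
  obtain ⟨w, rfl, hw⟩ := exists_goodPath hs hp
  obtain ⟨h1, h2⟩ := pairVec_path hh hx hb hs hw
  exact ⟨_, h1, by rwa [← pathMat_eq_connMat hxr rfl]⟩

/-! ### Determinant and structure of the connection matrices -/

section Connection

variable {F E : Type*} [Field F] [Field E]

/-! ### Cocycle property and compatibility with field homomorphisms. -/

lemma connMat_add {a : Fin 5 → F} (ha : Regular a) (p q : Fin 5 → ℤ) :
    connMat a (p + q) = connMat (shift a p) q * connMat a p := by
  rw [← pathMat_eq_connMat ha (w := axisPath p ++ axisPath q)
    (by rw [endPt_append, endPt_axisPath, endPt_axisPath]), pathMat_append, endPt_axisPath]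
  rfl

lemma connMat_zero (a : Fin 5 → F) : connMat a 0 = 1 := by
  simp [connMat, axisPath, pathMat, List.finRange_succ]

lemma shift_map (f : F →+* E) (a : Fin 5 → F) (p : Fin 5 → ℤ) :
    shift (f ∘ a) p = f ∘ shift a p := by
  funext i; simp [shift]

lemma contig_map (f : F →+* E) (a : Fin 5 → F) (i : Fin 5) (ε : Bool) :
    contig (f ∘ a) i ε = (contig a i ε).map f := by
  ext r k
  cases ε <;> fin_cases i <;> fin_cases r <;> fin_cases k <;>
    simp [contig, numUp, numDown, denUp, denDown, map_ofNat f 2]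

lemma pathMat_map (f : F →+* E) (a : Fin 5 → F) (w : List (Fin 5 × Bool)) :
    pathMat (f ∘ a) w = (pathMat a w).map f := by
  induction w generalizing a with
  | nil => simp [pathMat, Matrix.map_one]
  | cons e w ih => rw [pathMat, pathMat, shift_map, ih, contig_map, Matrix.map_mul]

lemma connMat_map (f : F →+* E) (a : Fin 5 → F) (p : Fin 5 → ℤ) :
    connMat (f ∘ a) p = (connMat a p).map f := pathMat_map f a _

lemma connMat_mul_inv {a : Fin 5 → F} (ha : Regular a) (p : Fin 5 → ℤ) :
    connMat (shift a p) (-p) * connMat a p = 1 := by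
  rw [← connMat_add ha, add_neg_cancel, connMat_zero]

lemma det_connMat_ne_zero {a : Fin 5 → F} (ha : Regular a) (p : Fin 5 → ℤ) :
    (connMat a p).det ≠ 0 := by
  have := congrArg Matrix.det (connMat_mul_inv ha p)
  rw [Matrix.det_mul, Matrix.det_one] at this
  exact right_ne_zero_of_mul_eq_one this

/-! #### The closed form of the determinant -/

lemma poch_add_one {x : F} (hx : ∀ n : ℤ, x + n ≠ 0) (n : ℤ) :
    poch x (n + 1) = poch x n * (x + n) := by
  rcases n with m | m
  · show poch x (Int.ofNat (m + 1)) = _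
    simp [poch, Finset.prod_range_succ]
  · rcases m with _ | m
    · have h := hx (-1)
      have : x - 1 ≠ 0 := by simpa [sub_eq_add_neg] using h
      show poch x (Int.ofNat 0) = poch x (Int.negSucc 0) * (x + _)
      simp [poch, Int.negSucc_eq, ← sub_eq_add_neg, this]
    · show poch x (Int.negSucc m) = _
      have h := hx (Int.negSucc (m + 1))
      have e : x + (Int.negSucc (m + 1) : ℤ) = x - (((m + 1 : ℕ) : F) + 1) := by
        rw [Int.negSucc_eq]; push_cast; ring
      rw [e] at h ⊢
      simp only [poch]
      rw [Finset.prod_range_succ _ (m + 1), mul_inv, mul_assoc, inv_mul_cancel₀ h, mul_one]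

lemma poch_zero (x : F) : poch x 0 = 1 := by
  show poch x (Int.ofNat 0) = 1
  simp [poch]

lemma poch_add {x : F} (hx : ∀ n : ℤ, x + n ≠ 0) (m n : ℤ) :
    poch x (m + n) = poch x m * poch (x + m) n := by
  have hm : ∀ k : ℤ, x + m + k ≠ 0 := fun k => by
    have := hx (m + k); push_cast at this; rwa [← add_assoc] at this
  induction n with
  | zero => simp [poch_zero]
  | succ n ih =>
    rw [← add_assoc, poch_add_one hx, ih, poch_add_one hm]; push_cast; ring
  | pred n ih =>
    have e1 := poch_add_one hx (m + (-(n : ℤ) - 1))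
    have e2 := poch_add_one hm (-(n : ℤ) - 1)
    rw [show m + (-(n : ℤ) - 1) + 1 = m + -n by ring, ih] at e1
    rw [show (-(n : ℤ) - 1) + 1 = -n by ring] at e2
    rw [e2] at e1
    have h0 := hm (-(n : ℤ) - 1)
    push_cast at e1 h0
    refine mul_right_cancel₀ h0 ?_
    linear_combination -e1

lemma Regular.sub_ne {a : Fin 5 → F} (ha : Regular a) {i j : Fin 5} (hij : i ≠ j) (n : ℤ) :
    a i - a j + n ≠ 0 := fun e =>
  ha.1.2 i j hij (-n) (by push_cast; linear_combination e)

lemma Regular.apply_ne {a : Fin 5 → F} (ha : Regular a) (i : Fin 5) (n : ℤ) :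
    a i + n ≠ 0 := fun e => ha.1.1 i (-n) (by push_cast; linear_combination e)

lemma Regular.saal_ne {a : Fin 5 → F} (ha : Regular a) (n : ℤ) :
    saal a - 1 + n ≠ 0 := fun e => ha.2 (1 - n) (by push_cast; linear_combination e)

/-- The closed form obeys the same cocycle rule as the determinant, so the two need only be compared
on unit steps. -/
lemma smallDelta_add {a : Fin 5 → F} (ha : Regular a) (p q : Fin 5 → ℤ) :
    smallDelta a (p + q) = smallDelta a p * smallDelta (shift a p) q := by
  have hs : saal (shift a p) - 1 = saal a - 1 + (saal p : ℤ) := by rw [saal_shift]; ring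
  have hd : ∀ i j : Fin 5, shift a p i - shift a p j = a i - a j + ((p i - p j : ℤ) : F) :=
    fun i j => by simp only [shift]; push_cast; ring
  have hd' : ∀ i j : Fin 5, p i + q i - (p j + q j) = (p i - p j) + (q i - q j) :=
    fun i j => by ring
  have hsg : ((-1 : F)) ^ ((p + q) 0 + (p + q) 1 + (p + q) 2) =
      (-1) ^ (p 0 + p 1 + p 2) * (-1) ^ (q 0 + q 1 + q 2) := by
    rw [← zpow_add₀ (by simp)]; congr 1; simp only [Pi.add_apply]; ring
  simp only [smallDelta]
  rw [hsg, saal_add, hs, poch_add ha.saal_ne]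
  simp only [hd, hd', Pi.add_apply]
  have e1 : ∏ i ∈ ({0, 1, 2} : Finset (Fin 5)), poch (a i) (p i + q i) =
      (∏ i ∈ ({0, 1, 2} : Finset (Fin 5)), poch (a i) (p i)) *
      ∏ i ∈ ({0, 1, 2} : Finset (Fin 5)), poch (shift a p i) (q i) := by
    rw [← Finset.prod_mul_distrib]
    exact Finset.prod_congr rfl fun i _ => poch_add (ha.apply_ne i) _ _
  have e2 : ∏ i ∈ ({0, 1, 2} : Finset (Fin 5)), ∏ j ∈ ({3, 4} : Finset (Fin 5)),
        poch (a j - a i) (p j - p i + (q j - q i)) =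
      (∏ i ∈ ({0, 1, 2} : Finset (Fin 5)), ∏ j ∈ ({3, 4} : Finset (Fin 5)),
        poch (a j - a i) (p j - p i)) *
      ∏ i ∈ ({0, 1, 2} : Finset (Fin 5)), ∏ j ∈ ({3, 4} : Finset (Fin 5)),
        poch (a j - a i + ((p j - p i : ℤ) : F)) (q j - q i) := by
    rw [← Finset.prod_mul_distrib]
    refine Finset.prod_congr rfl fun i hi => ?_
    rw [← Finset.prod_mul_distrib]
    refine Finset.prod_congr rfl fun j hj => poch_add (ha.sub_ne ?_) _ _
    rintro rfl
    revert hi hj; revert j; decide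
  rw [e1, e2]
  ring

lemma smallDelta_zero (a : Fin 5 → F) : smallDelta a 0 = 1 := by
  simp [smallDelta, poch_zero, saal]

lemma poch_one (x : F) : poch x 1 = x := by
  show poch x (Int.ofNat 1) = x
  simp [poch]

lemma poch_neg_one (x : F) : poch x (-1) = (x - 1)⁻¹ := by
  show poch x (Int.negSucc 0) = _
  simp [poch]

lemma det_contig_up {a : Fin 5 → F} (ha : Regular a) (i : Fin 5) :
    (contig a i true).det = smallDelta a (step i true) := by
  have h1 : a 3 + a 4 - a 0 - a 1 - a 2 - 1 ≠ 0 := by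
    simpa [saal] using ha.saal_ne 0
  have h2 : a 3 + a 4 - a 0 - a 1 - a 2 - 1 - 1 ≠ 0 := by
    simpa [saal, sub_eq_add_neg] using ha.saal_ne (-1)
  have hd : ∀ i j : Fin 5, i ≠ j → a i - a j ≠ 0 := fun i j hij => by
    simpa using ha.sub_ne hij 0
  have hd1 : ∀ i j : Fin 5, i ≠ j → a i - a j - 1 ≠ 0 := fun i j hij => by
    simpa [sub_eq_add_neg] using ha.sub_ne hij (-1)
  have d30 := hd 3 0 (by decide)
  have d31 := hd 3 1 (by decide)
  have d32 := hd 3 2 (by decide)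
  have d40 := hd 4 0 (by decide)
  have d41 := hd 4 1 (by decide)
  have d42 := hd 4 2 (by decide)
  have f30 := hd1 3 0 (by decide)
  have f31 := hd1 3 1 (by decide)
  have f32 := hd1 3 2 (by decide)
  have f40 := hd1 4 0 (by decide)
  have f41 := hd1 4 1 (by decide)
  have f42 := hd1 4 2 (by decide)
  have q0 : a 3 + a 4 - a 0 - a 1 - a 2 - 2 ≠ 0 := fun e => h2 (by linear_combination e)
  have q1 : a 3 + a 4 - a 1 - a 2 - a 0 - 2 ≠ 0 := fun e => h2 (by linear_combination e)
  have q2 : a 3 + a 4 - a 2 - a 0 - a 1 - 2 ≠ 0 := fun e => h2 (by linear_combination e)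
  fin_cases i <;>
  simp [smallDelta, saal, step, poch_zero, poch_one, poch_neg_one, contig,
    numUp, denUp, Matrix.det_fin_two] <;> field_simp <;> ring

lemma det_contig {a : Fin 5 → F} (ha : Regular a) (i : Fin 5) (ε : Bool) :
    (contig a i ε).det = smallDelta a (step i ε) := by
  cases ε
  · have e1 := congrArg Matrix.det (contig_inv ha i false)
    have e2 := smallDelta_add ha (step i false) (step i true)
    rw [show step i false + step i true = 0 from step_not i false, smallDelta_zero] at e2
    rw [Matrix.det_mul, Matrix.det_one, Bool.not_false, det_contig_up (ha.shift _)] at e1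
    have h0 := left_ne_zero_of_mul_eq_one e1
    refine mul_left_cancel₀ h0 ?_
    rw [e1, e2, mul_comm]
  · exact det_contig_up ha i

lemma det_pathMat {a : Fin 5 → F} (ha : Regular a) (w : List (Fin 5 × Bool)) :
    (pathMat a w).det = smallDelta a (endPt w) := by
  induction w generalizing a with
  | nil => simp [pathMat, endPt, smallDelta_zero]
  | cons e w ih =>
    rw [pathMat, Matrix.det_mul, ih (ha.shift _), det_contig ha, endPt, smallDelta_add ha, mul_comm]

/-- The closed form of the determinant of the connection matrix. -/
lemma det_connMat {a : Fin 5 → F} (ha : Regular a) (p : Fin 5 → ℤ) :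
    (connMat a p).det = smallDelta a p := by
  rw [connMat, det_pathMat ha, endPt_axisPath]

/-- By the cocycle rule the upper row of A(a; q) is the upper row of A(a + p; q - p) times A(a; p);
its first entry multiplies the upper row of A(a; p) itself and drops out of the determinant. -/
lemma bigDelta_eq {a : Fin 5 → F} (ha : Regular a) (p q : Fin 5 → ℤ) :
    bigDelta a p q = smallDelta a p * rTwo (shift a p) (q - p) := by
  have h := connMat_add ha p (q - p)
  rw [add_sub_cancel] at h
  rw [← det_connMat ha]
  simp only [bigDelta, rOne, rTwo, h, Matrix.det_fin_two, Matrix.mul_apply, Fin.sum_univ_two,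
    Matrix.of_apply, Matrix.cons_val', Matrix.cons_val_zero, Matrix.cons_val_one]
  ring

/-! #### The connection matrix in the direction `𝟏` -/

/-- The connection matrix in the direction `𝟏`. -/
def oneMat (a : Fin 5 → F) : Matrix (Fin 2) (Fin 2) F :=
  !![0, 1; phiThree a / (saal a - 2), psi a / (saal a - 2)]

lemma numUp_eq_denDown_mul {x y z b c : F} (h2 : b + c - x - y - z - 2 ≠ 0)
    (h3 : b + c - x - y - z - 3 ≠ 0) (h4 : b + c - x - y - z - 4 ≠ 0) :
    numUp z (x + 1) (y + 1) b c * (numUp y z (x + 1) b c * numUp x y z b c) =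
      denDown (c + 1) b (x + 1) (y + 1) (z + 1) *
        (denDown (b + 1) (c + 1) (x + 1) (y + 1) (z + 1) *
          !![0, 1; x * y * z / (b + c - x - y - z - 2),
            (1 + (x + y + z) + (x * y + y * z + z * x) - b * c) / (b + c - x - y - z - 2)]) := by
  -- With s as a parameter in place of c, all denominators become s - 2, s - 3 and s - 4.
  obtain ⟨s, rfl⟩ : ∃ s, c = s + x + y + z - b := ⟨b + c - x - y - z, by ring⟩
  have e2 : b + (s + x + y + z - b) - x - y - z - 2 = s - 2 := by ring
  have e3 : b + (s + x + y + z - b) - y - z - (x + 1) - 2 = s - 3 := by ring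
  have e4 : b + (s + x + y + z - b) - z - (x + 1) - (y + 1) - 2 = s - 4 := by ring
  have f4 : s + x + y + z - b + 1 + b - (x + 1) - (y + 1) - (z + 1) - 2 = s - 4 := by ring
  have f3 : b + 1 + (s + x + y + z - b + 1) - (x + 1) - (y + 1) - (z + 1) - 2 = s - 3 := by ring
  have h2' : s - 2 ≠ 0 := by rwa [e2] at h2
  have h3' : s - 3 ≠ 0 := fun e => h3 (by linear_combination e)
  have h4' : s - 4 ≠ 0 := fun e => h4 (by linear_combination e)
  simp only [numUp, denDown, e2, e3, e4, f3, f4, Matrix.mul_fin_two]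
  congr 1
  funext r k
  fin_cases r <;> fin_cases k <;> simp only [Fin.mk_zero, Fin.mk_one, Matrix.cons_val_zero, Matrix.cons_val_one] <;>
  field_simp <;> ring

lemma connMat_one {a : Fin 5 → F} (ha : Regular a) : connMat a 1 = oneMat a := by
  have hs : ∀ n : ℤ, a 3 + a 4 - a 0 - a 1 - a 2 ≠ n := ha.2
  have h := numUp_eq_denDown_mul (x := a 0) (y := a 1) (z := a 2) (b := a 3) (c := a 4)
    (fun e => hs 2 (by push_cast; linear_combination e))
    (fun e => hs 3 (by push_cast; linear_combination e))
    (fun e => hs 4 (by push_cast; linear_combination e))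
  have e1 := pathMat_eq_connMat ha (w := [((0 : Fin 5), true), (1, true), (2, true)]) rfl
  have e2 := pathMat_eq_connMat (ha.shift 1) (w := [((3 : Fin 5), false), (4, false)]) rfl
  set p := endPt [((0 : Fin 5), true), (1, true), (2, true)] with hp
  -- Both sides of e₀ + e₁ + e₂ = 𝟏 - e₃ - e₄ are reached by explicit products of contiguous
  -- matrices. The matrix for the steps -e₃, -e₄ is invertible and can be cancelled, which isolates
  -- A(a; 𝟏).
  have hpq : p = 1 + endPt [((3 : Fin 5), false), (4, false)] := by rw [hp]; decide
  have hj : ∀ (a : Fin 5 → F) i j, shift a (step i false) j = if j = i then a j - 1 else a j :=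
    fun a i j => by
      by_cases h : j = i
      · subst h; simp [shift, step, sub_eq_add_neg]
      · simp [shift, step, h]
  have h1 : ∀ j, shift a 1 j = a j + 1 := fun j => by simp [shift]
  simp only [pathMat, one_mul, contig, shift_step, hj, h1, Fin.reduceEq, if_false, if_true,
    add_sub_cancel_right] at e1 e2
  rw [mul_assoc, h, ← mul_assoc, e2, hpq, connMat_add ha] at e1
  have hd := det_connMat_ne_zero (ha.shift 1) (endPt [((3 : Fin 5), false), (4, false)])
  exact ((Matrix.isUnit_iff_isUnit_det _).2 hd.isUnit).mul_left_cancel e1.symm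

end Connection

/-! ### Nonvanishing of `r(a; p)` -/

section Periods

variable {F : Type*} [Field F]

/-- If r vanishes at all translates, then A(x + q; p) is diagonal with entries ρ_q, ρ_{q+𝟏}.
Comparing the lower rows of the two factorizations of A(x + q; p + 𝟏) at q = 0 and q = 𝟏 and
eliminating the ρ's leaves an identity that expresses the p-periodicity of ψ(x) ψ(x + 𝟏) / (φ₃(x +
𝟏) (s(x) - 2)). -/
lemma recurrence_period {x : Fin 5 → F} (hx : Regular x) {p : Fin 5 → ℤ}
    (h0 : ∀ q, rTwo (shift x q) p = 0) :
    psi (shift x p) * psi (shift x (1 + p)) * phiThree (shift x 1) * (saal x - 2) =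
      phiThree (shift x (1 + p)) * (saal x - 2 + (saal p : ℤ)) * psi x * psi (shift x 1) := by
  have comm : ∀ q, connMat (shift x (q + 1)) p * oneMat (shift x q) =
      oneMat (shift x (q + p)) * connMat (shift x q) p := fun q => by
    rw [← connMat_one (hx.shift _), ← connMat_one (hx.shift _), ← shift_shift x q 1,
      ← shift_shift x q p, ← connMat_add (hx.shift q), ← connMat_add (hx.shift q), add_comm]
  have h01 : ∀ q, connMat (shift x q) p 0 1 = 0 := h0
  have e (q) (r k) := congrFun (congrFun (comm q) r) k
  simp only [Matrix.mul_apply, Fin.sum_univ_two] at e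
  -- The upper row of `oneMat` is (0, 1), so the upper row of `comm` gives the vanishing of the
  -- lower left entry and, in the second column, the relation between the diagonal entries.
  have h10 : ∀ q, connMat (shift x q) p 1 0 = 0 := fun q => by
    have := e q 0 0
    simpa [oneMat, h01] using this.symm
  have hd : ∀ q, connMat (shift x q) p 1 1 = connMat (shift x (q + 1)) p 0 0 := fun q => by
    have := e q 0 1
    simpa [oneMat, h01] using this.symm
  have e0 := e 0 1 1
  have e1 := e 1 1 0
  have e2 := e 1 1 1
  have hρ : connMat (shift x 1) p 0 0 ≠ 0 := fun h => by
    apply det_connMat_ne_zero (hx.shift 1) p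
    rw [Matrix.det_fin_two, h, h01]; ring
  have hs : ∀ n : ℤ, saal x + n ≠ 0 := fun n e => hx.2 (-n) (by push_cast; linear_combination e)
  have s2 : saal x - 2 ≠ 0 := by simpa [sub_eq_add_neg] using hs (-2)
  have s3 : saal x - 3 ≠ 0 := by simpa [sub_eq_add_neg] using hs (-3)
  have t2 : saal x - 2 + (saal p : ℤ) ≠ 0 := fun e =>
    hs (-2 + saal p) (by push_cast; linear_combination e)
  have t3 : saal x - 3 + (saal p : ℤ) ≠ 0 := fun e =>
    hs (-3 + saal p) (by push_cast; linear_combination e)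
  have hd0 := hd 0
  rw [zero_add] at hd0
  simp only [zero_add, h10, h01, hd0, hd 1] at e0 e1 e2
  have f1 : saal (shift x 1) - 2 = saal x - 3 := by rw [saal_shift, saal_one]; push_cast; ring
  have f2 : saal (shift x p) - 2 = saal x - 2 + (saal p : ℤ) := by rw [saal_shift]; ring
  have f3 : saal (shift x (1 + p)) - 2 = saal x - 3 + (saal p : ℤ) := by
    rw [saal_shift, saal_add, saal_one]; push_cast; ring
  simp only [oneMat, shift_zero, f1, f2, f3, Matrix.of_apply, Matrix.cons_val', Matrix.cons_val_zero,
    Matrix.cons_val_one, Matrix.cons_val_fin_one, mul_zero, mul_one, zero_add, add_zero]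
    at e0 e1 e2
  generalize connMat (shift x 1) p 0 0 = ρ1 at *
  generalize connMat (shift x (1 + 1)) p 0 0 = ρ2 at *
  generalize connMat (shift x (1 + 1)) p 1 1 = ρ3 at *
  generalize saal x - 2 = S2 at *
  generalize saal x - 3 = S3 at *
  generalize S2 + (saal p : ℤ) = T2 at *
  generalize S3 + (saal p : ℤ) = T3 at *
  field_simp at e0 e1 e2
  refine mul_left_cancel₀ (mul_ne_zero hρ s3) ?_
  linear_combination -(phiThree (shift x 1) * psi (shift x (1 + p)) * S3) * e0 -
    phiThree (shift x 1) * psi x * T2 * e2 + psi x * T2 * psi (shift x 1) * e1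

/-- The identity expressing that `p` is a period of a certain rational function. -/
def HasPeriod (p : Fin 5 → ℤ) : Prop :=
  ∀ x : Fin 5 → ℂ, psi (shift x p) * psi (shift x (1 + p)) * phiThree (shift x 1) *
      (saal x - 2) =
    phiThree (shift x (1 + p)) * (saal x - 2 + (saal p : ℤ)) * psi x * psi (shift x 1)

lemma HasPeriod.apply_zero {p : Fin 5 → ℤ} (h : HasPeriod p) : p 0 = 0 := by
  -- At this point φ₃(x + 𝟏) = 0 because x₀ = -1, while every factor on the other side except p₀ is
  -- nonzero; the imaginary entries guarantee this for all integers p₁, p₂ and s(p).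
  have e := h ![-1, Complex.I, Complex.I, 0, 0]
  have v2 : ∀ a b c d e : ℂ, (![a, b, c, d, e] : Fin 5 → ℂ) 2 = c := fun _ _ _ _ _ => rfl
  have v3 : ∀ a b c d e : ℂ, (![a, b, c, d, e] : Fin 5 → ℂ) 3 = d := fun _ _ _ _ _ => rfl
  have v4 : ∀ a b c d e : ℂ, (![a, b, c, d, e] : Fin 5 → ℂ) 4 = e := fun _ _ _ _ _ => rfl
  have n1 : Complex.I + (1 + p 1) ≠ 0 := fun e => by simpa using congrArg Complex.im e
  have n2 : Complex.I + (1 + p 2) ≠ 0 := fun e => by simpa using congrArg Complex.im e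
  have n3 : saal ![-1, Complex.I, Complex.I, 0, 0] - 2 + (saal p : ℤ) ≠ 0 := fun e => by
    have := congrArg Complex.im e
    norm_num [saal, v2, v3, v4] at this
  have n4 : psi ![-1, Complex.I, Complex.I, 0, 0] ≠ 0 := fun e => by
    have := congrArg Complex.re e
    norm_num [psi, v2, v3, v4] at this
  have n5 : psi (shift ![-1, Complex.I, Complex.I, 0, 0] 1) ≠ 0 := fun e => by
    have := congrArg Complex.im e
    norm_num [psi, shift, v2, v3, v4] at this
  have e1 : phiThree (shift ![-1, Complex.I, Complex.I, 0, 0] 1) = 0 := by simp [phiThree, shift]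
  have e2 : phiThree (shift ![-1, Complex.I, Complex.I, 0, 0] (1 + p)) =
      p 0 * (Complex.I + (1 + p 1)) * (Complex.I + (1 + p 2)) := by simp [phiThree, shift]
  rw [e1, e2, mul_zero, zero_mul] at e
  have := e.symm
  simp only [mul_eq_zero, n1, n2, n3, n4, n5, or_false] at this
  exact_mod_cast this

lemma HasPeriod.comp_swap {p : Fin 5 → ℤ} (h : HasPeriod p) {i : Fin 5} (hi : i < 3) :
    HasPeriod (p ∘ Equiv.swap 0 i) := by
  obtain ⟨j0, j1, j2, j3, j4⟩ : (Equiv.swap 0 i 0 = i) ∧ ((Equiv.swap 0 i 1 = if i = 1 then 0 else 1)) ∧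
      ((Equiv.swap 0 i 2 = if i = 2 then 0 else 2)) ∧
      (Equiv.swap 0 i 3 = 3) ∧ (Equiv.swap 0 i 4 = 4) := by
    revert i; decide
  have hpsi : ∀ x : Fin 5 → ℂ, psi (x ∘ Equiv.swap 0 i) = psi x := fun x => by
    simp only [psi, Function.comp_apply, j0, j1, j2, j3, j4]
    fin_cases i <;> first | exact absurd hi (by decide) | (simp; try ring)
  have hphi : ∀ x : Fin 5 → ℂ, phiThree (x ∘ Equiv.swap 0 i) = phiThree x := fun x => by
    simp only [phiThree, Function.comp_apply, j0, j1, j2]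
    fin_cases i <;> first | exact absurd hi (by decide) | (simp; first | done | ring1 | exact Or.inl (mul_comm _ _))
  have hsaal : ∀ {R : Type} [CommRing R] (x : Fin 5 → R), saal (x ∘ Equiv.swap 0 i) = saal x :=
    fun x => by
      simp only [saal, Function.comp_apply, j0, j1, j2, j3, j4]
      fin_cases i <;> first | exact absurd hi (by decide) | (simp; try ring)
  intro x
  have e := h (x ∘ Equiv.swap 0 i)
  have hinv : ∀ q : Fin 5 → ℤ, shift (x ∘ Equiv.swap 0 i) q =
      shift x (q ∘ Equiv.swap 0 i) ∘ Equiv.swap 0 i := fun q => by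
    funext k; simp [shift]
  rw [hinv, hinv, hinv, hpsi, hpsi, hpsi, hpsi, hphi, hphi, hsaal] at e
  rw [hsaal]
  exact e

lemma HasPeriod.eq_zero {p : Fin 5 → ℤ} (h : HasPeriod p) : p = 0 := by
  have h0 : p 0 = 0 := h.apply_zero
  have h1 : p 1 = 0 := by simpa using (h.comp_swap (i := 1) (by decide)).apply_zero
  have h2 : p 2 = 0 := by simpa using (h.comp_swap (i := 2) (by decide)).apply_zero
  have v3 : ∀ a b c d e : ℂ, (![a, b, c, d, e] : Fin 5 → ℂ) 3 = d := fun _ _ _ _ _ => rfl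
  have v4 : ∀ a b c d e : ℂ, (![a, b, c, d, e] : Fin 5 → ℂ) 4 = e := fun _ _ _ _ _ => rfl
  -- Here s(x) - 2 = 0 makes one side vanish; the factor s(p) = p₃ + p₄ on the other side must then
  -- vanish.
  have hs : p 4 = -p 3 := by
    have := h ![0, 0, 0, 2, 0]
    simp [psi, phiThree, shift, saal, h0, h1, h2, v3, v4] at this
    norm_num at this
    have h3 : ((p 3 + p 4 : ℤ) : ℂ) = 0 := by push_cast; linear_combination this
    have h4 : p 3 + p 4 = 0 := by exact_mod_cast h3
    omega
  have key : ∀ y z : ℂ, y + z ≠ 2 → (1 - (y + p 3) * (z - p 3)) * (7 - (y + 1 + p 3) * (z + 1 - p 3)) =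
      (1 - y * z) * (7 - (y + 1) * (z + 1)) := fun y z hyz => by
    have := h ![0, 0, 0, y, z]
    simp [psi, phiThree, shift, saal, h0, h1, h2, hs, v3, v4] at this
    have hne : y + z - 2 ≠ 0 := sub_ne_zero.2 hyz
    refine mul_right_cancel₀ hne ?_
    linear_combination this
  have k1 := key 0 1 (by norm_num)
  have k2 := key 0 (-1) (by norm_num)
  have k3 := key 0 0 (by norm_num)
  have k4 := key 1 0 (by norm_num)
  have k5 := key (-1) 0 (by norm_num)
  -- Second differences of `key` in z at y = 0 and in y at z = 0 isolate the quadratic coefficients,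
  -- p₃(p₃ + 1) and -p₃(1 - p₃), which vanish on the unshifted side.
  have m1 : (p 3 : ℂ) * (1 + p 3) = 0 := by linear_combination (k1 + k2 - 2 * k3) / 2
  have m2 : (p 3 : ℂ) * (1 - p 3) = 0 := by linear_combination -(k4 + k5 - 2 * k3) / 2
  have m3 : (p 3 : ℂ) = 0 := by linear_combination (m1 + m2) / 2
  have h3 : p 3 = 0 := by exact_mod_cast m3
  funext i
  fin_cases i
  · exact h0
  · exact h1
  · exact h2
  · exact h3
  · simp [hs, h3]

end Periods

/-! #### Evaluation and translation of rational functions -/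

/-- Evaluation of polynomials at a point of `ℂ⁵`. -/
noncomputable def evalAt (b : Fin 5 → ℂ) : MvPolynomial (Fin 5) ℚ →+* ℂ :=
  (MvPolynomial.aeval b).toRingHom

lemma hasValue_varA (b : Fin 5 → ℂ) (i : Fin 5) : HasValue (evalAt b) (varA i) (b i) := by
  have := hasValue_algebraMap (φ := evalAt b) (MvPolynomial.X i)
  simpa [evalAt, varA] using this

/-- The translation `u(a) ↦ u(a + p)` on polynomials. -/
noncomputable def translatePoly (p : Fin 5 → ℤ) :
    MvPolynomial (Fin 5) ℚ →ₐ[ℚ] MvPolynomial (Fin 5) ℚ :=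
  MvPolynomial.aeval fun i => MvPolynomial.X i + (p i : MvPolynomial (Fin 5) ℚ)

lemma translatePoly_injective (p : Fin 5 → ℤ) : Function.Injective (translatePoly p) := by
  have h : (translatePoly (-p)).comp (translatePoly p) = AlgHom.id ℚ _ := by
    ext i; simp [translatePoly]
  exact Function.LeftInverse.injective (g := translatePoly (-p)) fun x => DFunLike.congr_fun h x

/-- The translation `u(a) ↦ u(a + p)` on rational functions. -/
noncomputable def translateRat (p : Fin 5 → ℤ) : RatA →+* RatA :=
  IsFractionRing.map (A := MvPolynomial (Fin 5) ℚ) (B := MvPolynomial (Fin 5) ℚ)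
    (j := (translatePoly p).toRingHom) (translatePoly_injective p)

lemma translateRat_varA (p : Fin 5 → ℤ) : translateRat p ∘ varA = shift varA p := by
  funext i
  simp only [Function.comp_apply, translateRat, varA, IsFractionRing.map, IsLocalization.map_eq,
    shift]
  simp [translatePoly]

/-- The connection matrix commutes with field homomorphisms, and translation is one of ℚ(a); so
vanishing of r(a; p) is inherited by every translate. -/
lemma rTwo_shift_varA (p q : Fin 5 → ℤ) :
    rTwo (shift varA q) p = translateRat q (rTwo varA p) := by
  rw [← translateRat_varA, rTwo, connMat_map]; rfl

lemma rTwo_varA_ne_zero {p : Fin 5 → ℤ} (hp : p ≠ 0) : rTwo varA p ≠ 0 := by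
  intro h0
  apply hp
  have h := recurrence_period regular_varA (p := p) fun q => by rw [rTwo_shift_varA, h0, map_zero]
  refine HasPeriod.eq_zero fun b => ?_
  have hx := hasValue_varA b
  have l := (((hasValue_psi (hasValue_shift hx p)).mul
    (hasValue_psi (hasValue_shift hx (1 + p)))).mul
    (hasValue_phiThree (hasValue_shift hx 1))).mul ((hasValue_saal hx).sub hasValue_two)
  have r := (((hasValue_phiThree (hasValue_shift hx (1 + p))).mul
    (((hasValue_saal hx).sub hasValue_two).add (hasValue_int (saal p)))).mul (hasValue_psi hx)).mul
    (hasValue_psi (hasValue_shift hx 1))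
  rw [h] at l
  exact l.unique r

lemma smallDelta_ne_zero (p : Fin 5 → ℤ) : smallDelta varA p ≠ 0 := by
  rw [← det_connMat regular_varA]; exact det_connMat_ne_zero regular_varA p

lemma bigDelta_varA_ne_zero {p q : Fin 5 → ℤ} (hpq : p ≠ q) : bigDelta varA p q ≠ 0 := by
  rw [bigDelta_eq regular_varA, rTwo_shift_varA]
  refine mul_ne_zero (smallDelta_ne_zero p) fun h => ?_
  rw [map_eq_zero] at h
  exact rTwo_varA_ne_zero (sub_ne_zero.2 hpq.symm) h

/-! ### A Riccati equation without rational solutions -/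

section Degree

open Polynomial in
lemma riccati_natDegree {A : Type*} [CommRing A] [IsDomain A] {s ψ φ p q p' q' : A[X]}
    (hs : s.natDegree = 2) (hψ : ψ.natDegree ≤ 2) (hφ : φ.natDegree = 3)
    (hp' : p' ≠ 0) (hq : q ≠ 0) (hq' : q' ≠ 0)
    (hpp : p'.natDegree = p.natDegree) (hqq : q'.natDegree = q.natDegree) :
    p * (s * p' + ψ * q') ≠ φ * q * q' := by
  intro e
  have hs0 : s ≠ 0 := by rintro rfl; simp at hs
  have hφ0 : φ ≠ 0 := by rintro rfl; simp at hφ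
  have hr : (φ * q * q').natDegree = 3 + 2 * q.natDegree := by
    rw [natDegree_mul (mul_ne_zero hφ0 hq) hq', natDegree_mul hφ0 hq, hφ, hqq]; ring
  have h1 : (s * p').natDegree = 2 + p.natDegree := by rw [natDegree_mul hs0 hp', hs, hpp]
  have h2 : (ψ * q').natDegree ≤ 2 + q.natDegree := natDegree_mul_le.trans (by omega)
  have h3 : (s * p' + ψ * q').natDegree ≤ max (2 + p.natDegree) (2 + q.natDegree) :=
    (natDegree_add_le _ _).trans (max_le_max h1.le h2)
  have h4 : (p * (s * p' + ψ * q')).natDegree ≤ _ := natDegree_mul_le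
  -- If deg p ≤ deg q, the left side has degree at most 2 + 2 deg q, less than 3 + 2 deg q on the
  -- right. Otherwise the first summand dominates without cancellation, and the left side has the
  -- even degree 2 + 2 deg p against an odd degree on the right.
  rcases le_or_gt p.natDegree q.natDegree with h | h
  · rw [e, hr] at h4; omega
  · have h5 : (s * p' + ψ * q').natDegree = 2 + p.natDegree := by
      rw [natDegree_add_eq_left_of_natDegree_lt (by omega), h1]
    have h0 : p ≠ 0 := by rintro rfl; simp at h
    have h6 : s * p' + ψ * q' ≠ 0 := by
      intro h6; rw [h6] at h5; simp at h5; omega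
    have := natDegree_mul h0 h6
    rw [e, hr, h5] at this
    omega

/-- The weights of the variables. -/
def wt : Fin 5 → ℕ := ![1, 1, 1, 2, 0]

/-- The total weight of a monomial. -/
def monWt (m : Fin 5 →₀ ℕ) : ℕ := ∑ i, m i * wt i

/-! ### Weighted degree of polynomials and its invariance under translation. -/

variable {K L : Type*} [Field K] [Field L]

/-- The substitution `Xᵢ ↦ Xᵢ T ^ wt i`. -/
noncomputable def weightHom (K : Type*) [Field K] :
    MvPolynomial (Fin 5) K →ₐ[K] Polynomial (MvPolynomial (Fin 5) K) :=
  MvPolynomial.aeval fun i => Polynomial.C (MvPolynomial.X i) * Polynomial.X ^ wt i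

lemma weightHom_monomial (m : Fin 5 →₀ ℕ) (c : K) :
    weightHom K (MvPolynomial.monomial m c) =
      Polynomial.monomial (monWt m) (MvPolynomial.monomial m c) := by
  rw [weightHom, MvPolynomial.aeval_monomial, ← Polynomial.C_mul_X_pow_eq_monomial,
    MvPolynomial.monomial_eq, Finsupp.prod_fintype _ _ (by simp), Finsupp.prod_fintype _ _ (by simp)]
  simp only [mul_pow, Finset.prod_mul_distrib, map_mul, map_prod, map_pow, ← pow_mul,
    Finset.prod_pow_eq_pow_sum, monWt, mul_comm (wt _), mul_assoc]
  rfl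

lemma coeff_weightHom (P : MvPolynomial (Fin 5) K) (n : ℕ) (m : Fin 5 →₀ ℕ) :
    ((weightHom K P).coeff n).coeff m = if monWt m = n then P.coeff m else 0 := by
  classical
  induction P using MvPolynomial.induction_on' with
  | monomial u a =>
    rw [weightHom_monomial, Polynomial.coeff_monomial, MvPolynomial.coeff_monomial]
    by_cases h : u = m
    · subst h; split_ifs <;> simp_all
    · split_ifs <;> simp [h]
  | add p q hp hq =>
    rw [map_add, Polynomial.coeff_add, MvPolynomial.coeff_add, hp, hq, MvPolynomial.coeff_add]
    split_ifs <;> simp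

lemma natDegree_weightHom_le {P : MvPolynomial (Fin 5) K} {n : ℕ} :
    (weightHom K P).natDegree ≤ n ↔ ∀ m ∈ P.support, monWt m ≤ n := by
  rw [Polynomial.natDegree_le_iff_coeff_eq_zero]
  constructor
  · intro h m hm
    by_contra! hlt
    have := congrArg (MvPolynomial.coeff m) (h _ hlt)
    rw [coeff_weightHom, if_pos rfl] at this
    exact MvPolynomial.mem_support_iff.1 hm (by simpa using this)
  · intro h N hN
    ext m
    rw [coeff_weightHom]
    split_ifs with e
    · have : m ∉ P.support := fun hm => by have := h m hm; omega
      simpa using this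
    · simp

lemma weightHom_injective : Function.Injective (weightHom K) := by
  rw [injective_iff_map_eq_zero]
  intro P hP
  ext m
  have := coeff_weightHom P (monWt m) m
  rw [hP, if_pos rfl] at this
  simpa using this.symm

lemma natDegree_weightHom_map (f : K →+* L) (P : MvPolynomial (Fin 5) K) :
    (weightHom L (MvPolynomial.map f P)).natDegree = (weightHom K P).natDegree := by
  refine eq_of_forall_ge_iff fun n => ?_
  rw [natDegree_weightHom_le, natDegree_weightHom_le,
    MvPolynomial.support_map_of_injective _ f.injective]

/-- The translation of all variables by the same constant. -/
noncomputable def translateVars (c : K) : MvPolynomial (Fin 5) K →ₐ[K] MvPolynomial (Fin 5) K :=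
  MvPolynomial.aeval fun i => MvPolynomial.X i + MvPolynomial.C c

/-- Replacing a variable by itself plus a constant adds only terms of lower or equal weight, since
no weight is negative. Applied also to the inverse translation, this gives equality. -/
lemma natDegree_weightHom_translate_le (c : K) (P : MvPolynomial (Fin 5) K) :
    (weightHom K (translateVars c P)).natDegree ≤ (weightHom K P).natDegree := by
  have h := natDegree_weightHom_le.1 (le_refl (weightHom K P).natDegree)
  generalize (weightHom K P).natDegree = n at *
  rw [P.as_sum, map_sum, map_sum]
  refine Polynomial.natDegree_sum_le_of_forall_le _ _ fun m hm => le_trans ?_ (h m hm)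
  rw [translateVars, MvPolynomial.aeval_monomial, Finsupp.prod_fintype _ _ (by simp), map_mul,
    map_prod]
  refine Polynomial.natDegree_mul_le.trans ?_
  have h0 : (weightHom K (algebraMap K _ (MvPolynomial.coeff m P))).natDegree = 0 := by
    rw [AlgHom.commutes]
    exact Polynomial.natDegree_C _
  rw [h0, zero_add]
  refine (Polynomial.natDegree_prod_le _ _).trans (Finset.sum_le_sum fun i _ => ?_)
  rw [map_pow]
  refine Polynomial.natDegree_pow_le.trans (Nat.mul_le_mul_left _ ?_)
  rw [natDegree_weightHom_le]
  have e : (MvPolynomial.X i + MvPolynomial.C c : MvPolynomial (Fin 5) K) =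
      MvPolynomial.monomial (Finsupp.single i 1) 1 + MvPolynomial.monomial 0 c := rfl
  intro k hk
  classical
  rw [e] at hk
  rcases Finset.mem_union.1 (MvPolynomial.support_add hk) with hk | hk
  · have := Finset.mem_singleton.1 (MvPolynomial.support_monomial_subset hk)
    subst this
    simp [monWt, Finsupp.single_apply]
  · have := Finset.mem_singleton.1 (MvPolynomial.support_monomial_subset hk)
    subst this
    simp [monWt]

lemma translateVars_neg (c : K) (P : MvPolynomial (Fin 5) K) :
    translateVars (-c) (translateVars c P) = P := by
  have h : (translateVars (-c)).comp (translateVars c) = AlgHom.id K _ := by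
    ext i; simp [translateVars]
  exact DFunLike.congr_fun h P

lemma natDegree_weightHom_translate (c : K) (P : MvPolynomial (Fin 5) K) :
    (weightHom K (translateVars c P)).natDegree = (weightHom K P).natDegree := by
  refine (natDegree_weightHom_translate_le c P).antisymm ?_
  have := natDegree_weightHom_translate_le (-c) (translateVars c P)
  rwa [translateVars_neg] at this

/-- The translation by `𝟏`, acting by `τ` on the coefficients. -/
noncomputable def twist (τ : K →+* K) : MvPolynomial (Fin 5) K →+* MvPolynomial (Fin 5) K :=
  (translateVars (1 : K) : MvPolynomial (Fin 5) K →+* MvPolynomial (Fin 5) K).comp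
    (MvPolynomial.map τ)

lemma twist_apply (τ : K →+* K) (P : MvPolynomial (Fin 5) K) :
    twist τ P = translateVars 1 (MvPolynomial.map τ P) := by
  rw [twist, RingHom.comp_apply, RingHom.coe_coe]

lemma natDegree_weightHom_twist (τ : K →+* K) (P : MvPolynomial (Fin 5) K) :
    (weightHom K (twist τ P)).natDegree = (weightHom K P).natDegree := by
  rw [twist_apply, natDegree_weightHom_translate, natDegree_weightHom_map]

lemma twist_injective (τ : K →+* K) : Function.Injective (twist τ) := fun P Q h => by
  rw [twist_apply, twist_apply] at h
  have := congrArg (translateVars (-1 : K)) h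
  rw [translateVars_neg, translateVars_neg] at this
  exact MvPolynomial.map_injective τ τ.injective this

/-- The weights (1, 1, 1, 2, 0) give s - 2 the degree 2, keep ψ at degree at most 2, since a₃a₄ also
has weight 2, and leave φ₃ with degree 3. With the ordinary degree s would have degree 1, and degree
q + 1 for P against q for Q would not be excluded. -/
lemma riccati_polynomial (τ : K →+* K) {P Q : MvPolynomial (Fin 5) K}
    (h : P * ((saal MvPolynomial.X - 2) * twist τ P + psi MvPolynomial.X * twist τ Q) =
      phiThree MvPolynomial.X * Q * twist τ Q) : P = 0 ∧ Q = 0 := by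
  have hw : ∀ i, weightHom K (MvPolynomial.X i) =
      Polynomial.C (MvPolynomial.X i) * Polynomial.X ^ wt i := fun i => by simp [weightHom]
  have ht : ∀ {P}, twist τ P = 0 ↔ P = 0 := fun {P} => map_eq_zero_iff _ (twist_injective τ)
  have hs : (weightHom K (saal MvPolynomial.X - 2)).natDegree = 2 := by
    have e : weightHom K (saal MvPolynomial.X - 2) =
        Polynomial.C (MvPolynomial.X 3) * Polynomial.X ^ 2 +
        Polynomial.C (-(MvPolynomial.X 0 + MvPolynomial.X 1 + MvPolynomial.X 2)) * Polynomial.X +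
        Polynomial.C (MvPolynomial.X 4 - 2) := by
      simp only [saal, map_sub, map_add, map_neg, hw, map_ofNat]
      simp [wt]
      ring
    rw [e]
    exact Polynomial.natDegree_quadratic (MvPolynomial.X_ne_zero 3)
  have hψ : (weightHom K (psi MvPolynomial.X)).natDegree ≤ 2 := by
    simp only [psi, map_sub, map_add, map_mul, map_one, hw]
    simp only [wt, Matrix.cons_val]
    compute_degree
  have hφ : (weightHom K (phiThree MvPolynomial.X)).natDegree = 3 := by
    have e : weightHom K (phiThree MvPolynomial.X) =
        Polynomial.C (MvPolynomial.X 0 * MvPolynomial.X 1 * MvPolynomial.X 2) *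
          Polynomial.X ^ 3 := by
      simp only [phiThree, map_mul, hw]
      simp [wt]
      ring
    rw [e]
    exact Polynomial.natDegree_C_mul_X_pow 3 _ (mul_ne_zero (mul_ne_zero (MvPolynomial.X_ne_zero 0)
      (MvPolynomial.X_ne_zero 1)) (MvPolynomial.X_ne_zero 2))
  have hs0 : (saal MvPolynomial.X - 2 : MvPolynomial (Fin 5) K) ≠ 0 := fun e => by
    rw [e] at hs; simp at hs
  have hφ0 : (phiThree MvPolynomial.X : MvPolynomial (Fin 5) K) ≠ 0 := fun e => by
    rw [e] at hφ; simp at hφ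
  have hi : ∀ {P}, P ≠ 0 → weightHom K P ≠ 0 := fun {P} hP =>
    (map_ne_zero_iff _ weightHom_injective).2 hP
  by_cases hQ : Q = 0
  · subst hQ
    simpa [hs0, ht] using h
  by_cases hP : P = 0
  · subst hP
    simp [hφ0, ht, hQ] at h
  exfalso
  have h' := congrArg (weightHom K) h
  simp only [map_mul, map_add] at h'
  exact riccati_natDegree hs hψ hφ (hi (mt ht.1 hP)) (hi hQ) (hi (mt ht.1 hQ))
    (natDegree_weightHom_twist τ P) (natDegree_weightHom_twist τ Q) h'

/-! #### Rational functions over a field with an endomorphism -/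

variable {M : Type*} [Field M] {c : Fin 5 → M} {T : M →+* M} {k : Subfield M}

lemma exists_polynomial_of_mem_closure {x : M}
    (hx : x ∈ Subfield.closure ((k : Set M) ∪ Set.range c)) :
    ∃ P D : MvPolynomial (Fin 5) k, x * MvPolynomial.aeval c D = MvPolynomial.aeval c P ∧
      D ≠ 0 := by
  obtain ⟨y, hy, z, hz, rfl⟩ := Subfield.mem_closure_iff.1 hx
  have hle : Subring.closure ((k : Set M) ∪ Set.range c) ≤
      (MvPolynomial.aeval (R := k) c : MvPolynomial (Fin 5) k →+* M).range := by
    rw [Subring.closure_le]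
    rintro w (hw | ⟨i, rfl⟩)
    · exact ⟨MvPolynomial.C ⟨w, hw⟩, by simp; rfl⟩
    · exact ⟨MvPolynomial.X i, by simp⟩
  obtain ⟨P, rfl⟩ := hle hy
  obtain ⟨D, rfl⟩ := hle hz
  by_cases hD : MvPolynomial.aeval c D = (0 : M)
  -- If the denominator is zero, the quotient is zero by convention.
  · exact ⟨0, 1, by simp [hD], one_ne_zero⟩
  · refine ⟨P, D, div_mul_cancel₀ _ hD, ?_⟩
    rintro rfl
    simp at hD

lemma map_aeval_twist {τ : k →+* k} (hτ : ∀ f : k, (τ f : M) = T f) (hc : ∀ i, T (c i) = c i + 1)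
    (P : MvPolynomial (Fin 5) k) :
    T (MvPolynomial.aeval c P) = MvPolynomial.aeval c (twist τ P) := by
  have h : T.comp (MvPolynomial.aeval (R := k) c : MvPolynomial (Fin 5) k →+* M) =
      (MvPolynomial.aeval (R := k) c : MvPolynomial (Fin 5) k →+* M).comp (twist τ) := by
    refine MvPolynomial.ringHom_ext (fun r => ?_) fun i => ?_
    · simp only [RingHom.comp_apply, RingHom.coe_coe, twist_apply, MvPolynomial.map_C,
        translateVars, MvPolynomial.aeval_C, MvPolynomial.algebraMap_eq]
      exact (hτ r).symm
    · simp [twist_apply, translateVars, hc]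
  exact RingHom.congr_fun h P

lemma riccati_closure (hT : ∀ f ∈ k, T f ∈ k) (hc : ∀ i, T (c i) = c i + 1)
    (hal : AlgebraicIndependent k c) {x y : M}
    (hx : x ∈ Subfield.closure ((k : Set M) ∪ Set.range c))
    (hy : y ∈ Subfield.closure ((k : Set M) ∪ Set.range c))
    (h : x * ((saal c - 2) * T x + psi c * T y) = phiThree c * y * T y) : x = 0 ∧ y = 0 := by
  obtain ⟨P, D, hP, hD⟩ := exists_polynomial_of_mem_closure hx
  obtain ⟨Q, E, hQ, hE⟩ := exists_polynomial_of_mem_closure hy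
  obtain ⟨τ, hτ⟩ : ∃ τ : k →+* k, ∀ f : k, (τ f : M) = T f :=
    ⟨(T.comp k.subtype).codRestrict k fun f => hT f f.2, fun _ => rfl⟩
  have hinj : Function.Injective (MvPolynomial.aeval c : MvPolynomial (Fin 5) k →ₐ[k] M) := hal
  have htw := map_aeval_twist hτ hc
  generalize hα : (MvPolynomial.aeval c : MvPolynomial (Fin 5) k →ₐ[k] M) = α at *
  have hX : ∀ i, α (MvPolynomial.X i) = c i := fun i => by simp [← hα]
  have hsX : α (saal MvPolynomial.X - 2) = saal c - 2 := by
    simp only [saal, map_sub, map_add, hX, map_ofNat]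
  have hψX : α (psi MvPolynomial.X) = psi c := by
    simp only [psi, map_sub, map_add, map_mul, map_one, hX]
  have hφX : α (phiThree MvPolynomial.X) = phiThree c := by
    simp only [phiThree, map_mul, hX]
  have hP' := congrArg T hP
  have hQ' := congrArg T hQ
  rw [map_mul, htw, htw] at hP' hQ'
  -- The Riccati equation is homogeneous: multiplying both unknowns by the common denominator DE
  -- multiplies it by DE times its translate, so denominators can be cleared.
  have key : (P * E) * ((saal MvPolynomial.X - 2) * twist τ (P * E) +
      psi MvPolynomial.X * twist τ (Q * D)) =
      phiThree MvPolynomial.X * (Q * D) * twist τ (Q * D) := by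
    apply hinj
    simp only [map_mul, map_add, hsX, hψX, hφX, ← hP', ← hQ', ← hP, ← hQ]
    linear_combination (α D * α E * α (twist τ D) * α (twist τ E)) * h
  obtain ⟨h1, h2⟩ := riccati_polynomial _ key
  have hD0 : α D ≠ 0 := (map_ne_zero_iff _ hinj).2 hD
  have hE0 : α E ≠ 0 := (map_ne_zero_iff _ hinj).2 hE
  have hP0 : P = 0 := (mul_eq_zero.1 h1).resolve_right hE
  have hQ0 : Q = 0 := (mul_eq_zero.1 h2).resolve_right hD
  rw [hP0, map_zero] at hP
  rw [hQ0, map_zero] at hQ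
  exact ⟨(mul_eq_zero.1 hP).resolve_right hD0, (mul_eq_zero.1 hQ).resolve_right hE0⟩

end Degree

/-! ### Translation of meromorphic functions. -/

lemma meroShift_algebraMap (f : Entire) :
    meroShift (algebraMap Entire Mero f) = algebraMap Entire Mero (translateEntire f) := by
  simp only [meroShift, IsFractionRing.map, IsLocalization.map_eq]

lemma meroShift_coordA (i : Fin 5) : meroShift (coordA i) = coordA i + 1 := by
  rw [coordA, meroShift_algebraMap, ← map_one (algebraMap Entire Mero), ← map_add]
  rfl

/-! ### Real points as a set of uniqueness -/

/-- The inclusion of `ℝ⁵` in `ℂ⁵`. -/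
def toC (x : Fin 5 → ℝ) : Fin 5 → ℂ := fun i => x i

lemma continuous_toC : Continuous toC :=
  continuous_pi fun i => Complex.continuous_ofReal.comp (continuous_apply i)

/-- Regularity removes integer level sets of finitely many nonzero linear forms; for each form an
open dense set remains. -/
lemma dense_regular : Dense {x : Fin 5 → ℝ | Regular (toC x)} := by
  have key : ∀ l : (Fin 5 → ℝ) →ₗ[ℝ] ℝ, l ≠ 0 →
      IsOpen {x | ∀ n : ℤ, l x ≠ n} ∧ Dense {x | ∀ n : ℤ, l x ≠ n} := fun l hl => by
    have e : {x | ∀ n : ℤ, l x ≠ n} = l ⁻¹' (Set.range ((↑) : ℤ → ℝ))ᶜ := by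
      ext x; simp [eq_comm]
    rw [e]
    refine ⟨Int.isClosedEmbedding_coe_real.isClosed_range.isOpen_compl.preimage
      l.continuous_of_finiteDimensional, Dense.preimage ?_
      (l.isOpenMap_of_finiteDimensional (LinearMap.surjective hl))⟩
    exact (Set.countable_range _).dense_compl ℝ
  let π : Fin 5 → (Fin 5 → ℝ) →ₗ[ℝ] ℝ := fun i => LinearMap.proj i
  let l : Option (Fin 5 × Fin 5) → (Fin 5 → ℝ) →ₗ[ℝ] ℝ := fun o => match o with
    | none => π 3 + π 4 - π 0 - π 1 - π 2
    | some (i, j) => if i = j then π i else π i - π j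
  have hl : ∀ o, l o ≠ 0 := by
    intro o h
    match o with
    | none =>
      have := LinearMap.congr_fun h (Pi.single 3 1)
      simp [l, π] at this
    | some (i, j) =>
      have := LinearMap.congr_fun h (Pi.single i 1)
      by_cases hij : i = j
      · simp [l, π, hij] at this
      · simp [l, π, hij] at this
  refine (dense_iInter_of_isOpen (fun o => (key _ (hl o)).1) fun o => (key _ (hl o)).2).mono ?_
  intro x hx
  rw [Set.mem_iInter] at hx
  refine ⟨⟨fun i n e => ?_, fun i j hij n e => ?_⟩, fun n e => ?_⟩
  · refine hx (some (i, i)) n ?_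
    simp only [toC] at e
    simp only [l, π, if_true, LinearMap.proj_apply]
    exact_mod_cast e
  · refine hx (some (i, j)) n ?_
    simp only [toC] at e
    simp only [l, π, if_neg hij, LinearMap.sub_apply, LinearMap.proj_apply]
    exact_mod_cast e
  · refine hx none n ?_
    simp only [toC, saal] at e
    simp only [l, π, LinearMap.sub_apply, LinearMap.add_apply, LinearMap.proj_apply]
    exact_mod_cast e

/-- The restriction to a complex line is entire in one variable, and its real zeros accumulate at 0.
-/
lemma entire_line_eq_zero (f : Entire) {a v : Fin 5 → ℂ}
    (h : ∀ᶠ t : ℝ in 𝓝 0, f.1 (a + (t : ℂ) • v) = 0) (z : ℂ) : f.1 (a + z • v) = 0 := by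
  have hg : AnalyticOnNhd ℂ (fun z : ℂ => f.1 (a + z • v)) Set.univ := fun z _ =>
    (f.2 (a + z • v) (Set.mem_univ _)).fun_comp (f := fun z : ℂ => a + z • v)
      (analyticAt_const.add (analyticAt_id.smul analyticAt_const))
  have hfreq : ∃ᶠ z : ℂ in 𝓝[≠] 0, f.1 (a + z • v) = 0 := by
    have ht : Tendsto ((↑) : ℝ → ℂ) (𝓝[≠] 0) (𝓝[≠] 0) := by
      refine tendsto_nhdsWithin_of_tendsto_nhds_of_eventually_within _ ?_ ?_
      · exact (Complex.continuous_ofReal.tendsto' 0 0 (by simp)).mono_left nhdsWithin_le_nhds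
      · filter_upwards [self_mem_nhdsWithin] with t ht
        simpa using ht
    exact ht.frequently (h.filter_mono nhdsWithin_le_nhds).frequently
  have := hg.eq_of_frequently_eq (g := fun _ => (0 : ℂ)) analyticOnNhd_const hfreq
  exact congrFun this z

/-- Density and continuity give vanishing on O; real lines through a point of O extend it to ℝ⁵, and
the complex line z ↦ Re w + z Im w, taken at z = i, extends it to ℂ⁵. -/
lemma entire_eq_zero {f : Entire} {O : Set (Fin 5 → ℝ)} (hO : IsOpen O) (hne : O.Nonempty)
    (h : ∀ x ∈ O, Regular (toC x) → f.1 (toC x) = 0) : f = 0 := by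
  have hcf : Continuous f.1 := continuous_iff_continuousAt.2 fun a =>
    (f.2 a (Set.mem_univ a)).continuousAt
  have hO0 : ∀ x ∈ O, f.1 (toC x) = 0 := by
    have hcl : IsClosed {x | f.1 (toC x) = 0} :=
      isClosed_eq (hcf.comp continuous_toC) continuous_const
    intro x hx
    exact hcl.closure_subset_iff.2 (fun y hy => h y hy.1 hy.2)
      (dense_regular.open_subset_closure_inter hO hx)
  obtain ⟨x₀, hx₀⟩ := hne
  have hreal : ∀ y, f.1 (toC y) = 0 := fun y => by
    have hc : Continuous fun t : ℝ => x₀ + t • (y - x₀) := by fun_prop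
    have hev : ∀ᶠ t : ℝ in 𝓝 0, x₀ + t • (y - x₀) ∈ O :=
      hc.tendsto 0 (hO.mem_nhds (by simpa using hx₀))
    have := entire_line_eq_zero f (a := toC x₀) (v := toC (y - x₀)) (by
      filter_upwards [hev] with t ht
      have e := hO0 _ ht
      convert e using 2
      funext i; simp [toC]) 1
    convert this using 2
    funext i; simp [toC]
  apply Subtype.ext
  funext w
  have := entire_line_eq_zero f (a := toC fun i => (w i).re) (v := toC fun i => (w i).im)
    (Eventually.of_forall fun t => by
      have e := hreal fun i => (w i).re + t * (w i).im
      convert e using 2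
      funext i; simp [toC]) Complex.I
  have e : (toC fun i => (w i).re) + Complex.I • (toC fun i => (w i).im) = w := by
    funext i
    simp [toC, mul_comm Complex.I, Complex.re_add_im]
  rwa [e] at this

/-- Evaluation of entire functions. -/
def evalEntire (a : Fin 5 → ℂ) : Entire →+* ℂ where
  toFun f := f.1 a
  map_one' := rfl
  map_mul' _ _ := rfl
  map_zero' := rfl
  map_add' _ _ := rfl

lemma mero_eq_zero {m : Mero} {O : Set (Fin 5 → ℝ)} (hO : IsOpen O) (hne : O.Nonempty)
    (h : ∀ x ∈ O, Regular (toC x) → HasValue (evalEntire (toC x)) m 0) : m = 0 := by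
  obtain ⟨P, Q, hQ, rfl⟩ := IsFractionRing.div_surjective (A := Entire) m
  have hP : P = 0 := by
    refine entire_eq_zero hO hne fun x hx hr => ?_
    obtain ⟨P', Q', hQ', e, e0⟩ := h x hx hr
    rw [div_eq_div_iff (by
        rw [Ne, IsFractionRing.to_map_eq_zero_iff]; exact nonZeroDivisors.ne_zero hQ)
      (algebraMap_ne_zero_of_value hQ'), ← map_mul, ← map_mul] at e
    have e1 := congrArg (evalEntire (toC x)) (IsFractionRing.injective Entire Mero e)
    have e2 : evalEntire (toC x) P' = 0 := by
      rcases div_eq_zero_iff.1 e0.symm with e2 | e2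
      · exact e2
      · exact absurd e2 hQ'
    rw [map_mul, map_mul, e2, zero_mul] at e1
    exact (mul_eq_zero.1 e1).resolve_right hQ'
  rw [hP, map_zero, zero_div]

lemma hasValue_coordA (a : Fin 5 → ℂ) (i : Fin 5) : HasValue (evalEntire a) (coordA i) (a i) :=
  hasValue_algebraMap (φ := evalEntire a) _

lemma HasValue.meroShift {a : Fin 5 → ℂ} {m : Mero} {c : ℂ}
    (h : HasValue (evalEntire (shift a 1)) m c) : HasValue (evalEntire a) (meroShift m) c := by
  have e : ∀ f, evalEntire a (translateEntire f) = evalEntire (shift a 1) f := fun f => by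
    have e : shift a 1 = a + 1 := by funext i; simp [shift]
    rw [e]
    rfl
  obtain ⟨P, Q, hQ, rfl, rfl⟩ := h
  exact ⟨translateEntire P, translateEntire Q, by rwa [e],
    by rw [map_div₀, meroShift_algebraMap, meroShift_algebraMap], by rw [e, e]⟩

/-! ### Polynomials as entire functions -/

lemma eq_zero_of_evalAt {P : MvPolynomial (Fin 5) ℚ} (h : ∀ b, evalAt b P = 0) : P = 0 := by
  apply MvPolynomial.map_injective (algebraMap ℚ ℂ) (algebraMap ℚ ℂ).injective
  rw [map_zero]
  refine MvPolynomial.funext fun b => ?_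
  rw [MvPolynomial.eval_map, map_zero]
  exact h b

/-- Polynomials as entire functions. -/
noncomputable def polyEntire : MvPolynomial (Fin 5) ℚ →+* Entire :=
  MvPolynomial.eval₂Hom ((algebraMap ℂ Entire).comp (algebraMap ℚ ℂ)) fun i =>
    ⟨fun a => a i, (ContinuousLinearMap.proj (R := ℂ) (φ := fun _ : Fin 5 => ℂ) i).analyticOnNhd _⟩

lemma evalEntire_polyEntire (P : MvPolynomial (Fin 5) ℚ) (b : Fin 5 → ℂ) :
    evalEntire b (polyEntire P) = evalAt b P := by
  have h : (evalEntire b).comp polyEntire = evalAt b := by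
    refine MvPolynomial.ringHom_ext (fun r => ?_) fun i => ?_
    · simp only [RingHom.comp_apply, polyEntire, MvPolynomial.eval₂Hom_C, evalAt]
      simp
      rfl
    · simp only [RingHom.comp_apply, polyEntire, MvPolynomial.eval₂Hom_X', evalAt]
      simp [evalEntire]
  exact RingHom.congr_fun h P

lemma polyEntire_injective : Function.Injective polyEntire := by
  rw [injective_iff_map_eq_zero]
  intro P hP
  exact eq_zero_of_evalAt fun b => by rw [← evalEntire_polyEntire, hP, map_zero]

/-- Rational functions as meromorphic functions. -/
noncomputable def ratMero : RatA →+* Mero :=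
  IsFractionRing.map polyEntire_injective

lemma ratMero_algebraMap (P : MvPolynomial (Fin 5) ℚ) :
    ratMero (algebraMap _ RatA P) = algebraMap Entire Mero (polyEntire P) := by
  simp only [ratMero, IsFractionRing.map, IsLocalization.map_eq]

lemma ratMero_varA : ratMero ∘ varA = coordA := by
  funext i
  rw [Function.comp_apply, varA, ratMero_algebraMap, coordA]
  simp [polyEntire]

lemma bigDelta_map {F E : Type*} [Field F] [Field E] (f : F →+* E) (a : Fin 5 → F)
    (p q : Fin 5 → ℤ) : bigDelta (f ∘ a) p q = f (bigDelta a p q) := by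
  simp [bigDelta, Matrix.det_fin_two, rOne, rTwo, connMat_map]

lemma bigDelta_coordA_ne_zero {p q : Fin 5 → ℤ} (hpq : p ≠ q) : bigDelta coordA p q ≠ 0 := by
  rw [← ratMero_varA, bigDelta_map, map_ne_zero]
  exact bigDelta_varA_ne_zero hpq

/-- The matrix can be formed inside the subfield K(a) and is compatible with the inclusion. -/
lemma connMat_coordA_mem (K : Subfield Mero) (p : Fin 5 → ℤ) (r k : Fin 2) :
    connMat coordA p r k ∈ adjoinA K := by
  have hc : ∀ i, coordA i ∈ adjoinA K := fun i => Subfield.subset_closure (Or.inr ⟨i, rfl⟩)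
  have e : coordA = (adjoinA K).subtype ∘ fun i => (⟨coordA i, hc i⟩ : adjoinA K) := rfl
  rw [e, connMat_map]
  exact Subtype.prop _

/-! ### Linear independence -/

/-- Real points at which the series of a companion has positive terms. -/
def posSet (ν : SingPt) (i : Fin 3) (N : ℝ) : Set (Fin 5 → ℝ) :=
  {x | (∀ j, 0 < (invol ν i (toC x) j).re) ∧ N < (saal (toC x)).re}

lemma isOpen_posSet (ν : SingPt) (i : Fin 3) (N : ℝ) : IsOpen (posSet ν i N) := by
  have hc : ∀ j, Continuous fun x : Fin 5 → ℝ => toC x j := fun j =>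
    (continuous_apply j).comp continuous_toC
  have hi : ∀ j, Continuous fun x : Fin 5 → ℝ => invol ν i (toC x) j := by
    have h0 := hc 0; have h1 := hc 1; have h2 := hc 2; have h3 := hc 3; have h4 := hc 4
    intro j
    cases ν <;> fin_cases i <;> fin_cases j <;> simp [invol] <;> fun_prop
  have hs : Continuous fun x : Fin 5 → ℝ => saal (toC x) :=
    ((((hc 3).add (hc 4)).sub (hc 0)).sub (hc 1)).sub (hc 2)
  have h1 : IsOpen {x : Fin 5 → ℝ | ∀ j, 0 < (invol ν i (toC x) j).re} := by
    rw [Set.ofPred_forall]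
    exact isOpen_iInter_of_finite fun j =>
      isOpen_lt continuous_const (Complex.continuous_re.comp (hi j))
  exact h1.inter (isOpen_lt continuous_const (Complex.continuous_re.comp hs))

lemma im_invol_toC (ν : SingPt) (i : Fin 3) (x : Fin 5 → ℝ) (j : Fin 5) :
    (invol ν i (toC x) j).im = 0 := by
  cases ν <;> fin_cases i <;> fin_cases j <;> simp [invol, toC]

lemma posSet_nonempty (ν : SingPt) (i : Fin 3) (N : ℝ) : (posSet ν i N).Nonempty := by
  set b : Fin 5 → ℝ := ![1, 1, 1, |N| + 3, 1] with hb
  have hx : toC (fun j => (invol ν i (toC b) j).re) = invol ν i (toC b) := by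
    funext j
    exact Complex.ext rfl (by simp [toC, im_invol_toC])
  -- The image of the positive point b under the involution is real, the involution brings it back
  -- to b, and s, here |N| + 1, is unchanged.
  refine ⟨fun j => (invol ν i (toC b) j).re, ?_, ?_⟩
  · rw [hx, invol_invol]
    intro j
    have := abs_nonneg N
    fin_cases j <;> simp [toC, hb]
    linarith
  · rw [hx, saal_invol]
    have : (saal (toC b)).re = |N| + 3 + 1 - 1 - 1 - 1 := by
      simp [saal, toC, hb]
    rw [this]
    linarith [le_abs_self N]

lemma companion_ne_zero {ν : SingPt} {i : Fin 3} {N : ℝ} (hN : 0 ≤ N) {x : Fin 5 → ℝ}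
    (hx : x ∈ posSet ν i N) (hr : Regular (toC x)) : companion ν i (toC x) ≠ 0 := by
  rw [companion_eq]
  exact mul_ne_zero (compFactor_ne_zero _ _) (hgf_ne_zero (hr.1.invol ν i)
    (by rw [saal_invol]; linarith [hx.2]) (im_invol_toC ν i x) hx.1)

lemma apply_shift {h : (Fin 5 → ℂ) → ℂ} (hh : IsContiguous h) {b : Fin 5 → ℂ} (hb : Regular b)
    (hs : 1 < (saal b).re) {p : Fin 5 → ℤ} (hp : 1 < (saal (shift b p)).re) :
    h (shift b p) = rOne b p * h b + rTwo b p * h (shift b 1) := by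
  obtain ⟨w, rfl, hw⟩ := exists_goodPath hs hp
  have e := (pairVec_path hh (hasValue_varA b) hb.1 hs hw).1
  rw [pathMat_eq_connMat hb rfl] at e
  have e0 := congrFun e 0
  rw [rOne, rTwo]
  simpa [pairVec, Matrix.mulVec, dotProduct, Fin.sum_univ_two] using e0

/-- X and Y need not lie in K(a), but they share the factor ζ with elements x, y that do. The
equation is homogeneous, so ζ T(ζ) cancels; the matrix with rows (α, β), (γ, δ) is then inverted. -/
lemma eq_zero_of_riccati {M : Type*} [Field M] {c : Fin 5 → M} {T : M →+* M} {k : Subfield M}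
    (hT : ∀ f ∈ k, T f ∈ k) (hc : ∀ i, T (c i) = c i + 1) (hal : AlgebraicIndependent k c)
    {X Y ζ x y α β γ δ : M} (hζ : ζ ≠ 0) (hX : X = ζ * x) (hY : Y = ζ * y)
    (hx : x ∈ Subfield.closure ((k : Set M) ∪ Set.range c))
    (hy : y ∈ Subfield.closure ((k : Set M) ∪ Set.range c))
    (hα : α ∈ Subfield.closure ((k : Set M) ∪ Set.range c))
    (hβ : β ∈ Subfield.closure ((k : Set M) ∪ Set.range c))
    (hγ : γ ∈ Subfield.closure ((k : Set M) ∪ Set.range c))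
    (hδ : δ ∈ Subfield.closure ((k : Set M) ∪ Set.range c)) (hdet : α * δ - β * γ ≠ 0)
    (h : (X * α + Y * γ) * ((saal c - 2) * T (X * α + Y * γ) + psi c * T (X * β + Y * δ)) -
      phiThree c * (X * β + Y * δ) * T (X * β + Y * δ) = 0) : x = 0 ∧ y = 0 := by
  have hu := add_mem (mul_mem hx hα) (mul_mem hy hγ)
  have hv := add_mem (mul_mem hx hβ) (mul_mem hy hδ)
  have hU : X * α + Y * γ = ζ * (x * α + y * γ) := by rw [hX, hY]; ring
  have hV : X * β + Y * δ = ζ * (x * β + y * δ) := by rw [hX, hY]; ring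
  rw [hU, hV, map_mul, map_mul] at h
  obtain ⟨h1, h2⟩ := riccati_closure hT hc hal hu hv (by
    refine mul_left_cancel₀ (mul_ne_zero hζ ((map_ne_zero T).2 hζ)) ?_
    linear_combination h)
  constructor
  · refine (mul_eq_zero.1 ?_).resolve_right hdet
    linear_combination δ * h1 - γ * h2
  · refine (mul_eq_zero.1 ?_).resolve_right hdet
    linear_combination α * h2 - β * h1

/-- The relation at a, its translate and the recurrence are three linear equations in h(a), h(a +
𝟏), h(a + 2·𝟏). Eliminating the last two leaves the Riccati expression times h(a). Real points where
h(a) is a nonzero factor times a series of positive terms form a set of uniqueness, so the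
expression vanishes identically. -/
lemma riccati_of_relation (ν : SingPt) (i : Fin 3) {p q : Fin 5 → ℤ} (N : ℝ) {X Y : Entire}
    (hrel : ∀ a, Regular a → N < (saal a).re →
      X.1 a * companion ν i (shift a p) + Y.1 a * companion ν i (shift a q) = 0)
    {U V : Mero} (hU : U = algebraMap Entire Mero X * rOne coordA p +
      algebraMap Entire Mero Y * rOne coordA q)
    (hV : V = algebraMap Entire Mero X * rTwo coordA p +
      algebraMap Entire Mero Y * rTwo coordA q) :
    U * ((saal coordA - 2) * meroShift U + psi coordA * meroShift V) -
      phiThree coordA * V * meroShift V = 0 := by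
  have hc : IsContiguous (companion ν i) := isContiguous_companion ν i
  let u : (Fin 5 → ℂ) → ℂ := fun a => X.1 a * rOne a p + Y.1 a * rOne a q
  let v : (Fin 5 → ℂ) → ℂ := fun a => X.1 a * rTwo a p + Y.1 a * rTwo a q
  have hval : ∀ b, Regular b → HasValue (evalEntire b) U (u b) ∧ HasValue (evalEntire b) V (v b) :=
    fun b hb => by
      have hm (p) (r k) := hasValue_pathMat (axisPath p) (hasValue_coordA b) hb r k
      have hX := hasValue_algebraMap (φ := evalEntire b) X
      have hY := hasValue_algebraMap (φ := evalEntire b) Y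
      rw [hU, hV]
      exact ⟨(hX.mul (hm p 0 0)).add (hY.mul (hm q 0 0)),
        (hX.mul (hm p 0 1)).add (hY.mul (hm q 0 1))⟩
  clear hU hV
  have b0 := abs_nonneg N
  have b1 := neg_abs_le ((saal p : ℤ) : ℝ)
  have b2 := neg_abs_le ((saal q : ℤ) : ℝ)
  have b3 := abs_nonneg ((saal p : ℤ) : ℝ)
  have b4 := abs_nonneg ((saal q : ℤ) : ℝ)
  have b5 := le_abs_self N
  -- This bound covers the base points a and a + 𝟏: after losing 1 from s, their translates by p and
  -- q still satisfy Re s > 1, the relation is available, and Re s(a) > 2 for the recurrence.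
  obtain ⟨N', hN'⟩ : ∃ N', N' = |N| + |((saal p : ℤ) : ℝ)| + |((saal q : ℤ) : ℝ)| + 3 := ⟨_, rfl⟩
  refine mero_eq_zero (isOpen_posSet ν i N') (posSet_nonempty ν i N') fun t ht hr => ?_
  have hne : companion ν i (toC t) ≠ 0 := companion_ne_zero (by linarith) ht hr
  have hs := ht.2
  generalize toC t = a at *
  have hs1 : (saal (shift a 1)).re = (saal a).re - 1 := by
    rw [saal_shift, saal_one]; simp; ring
  have hzero : ∀ b, Regular b → (saal a).re - 1 ≤ (saal b).re →
      u b * companion ν i b + v b * companion ν i (shift b 1) = 0 := fun b hb hsb => by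
    have h1 := apply_shift hc hb (p := p) (by linarith) (by rw [saal_shift]; simp; linarith)
    have h2 := apply_shift hc hb (p := q) (by linarith) (by rw [saal_shift]; simp; linarith)
    have h3 := hrel b hb (by linarith)
    rw [h1, h2] at h3
    linear_combination h3
  have e0 := hzero a hr (by linarith)
  have e1 := hzero (shift a 1) (hr.shift 1) (by rw [hs1])
  have e2 := hc.two hr.1 (by linarith)
  rw [shift_shift, show (1 + 1 : Fin 5 → ℤ) = 2 from rfl] at e1
  have hx := hasValue_coordA a
  have hU1 := (hval _ (hr.shift 1)).1.meroShift
  have hV1 := (hval _ (hr.shift 1)).2.meroShift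
  obtain ⟨hU0, hV0⟩ := hval a hr
  have hfin := (hU0.mul ((((hasValue_saal hx).sub hasValue_two).mul hU1).add
    ((hasValue_psi hx).mul hV1))).sub (((hasValue_phiThree hx).mul hV0).mul hV1)
  convert hfin using 1
  symm
  refine (mul_eq_zero.1 ?_).resolve_right hne
  generalize u (shift a 1) = u1 at *
  generalize v (shift a 1) = v1 at *
  linear_combination ((saal a - 2) * u1 + psi a * v1) * e0 - v a * (saal a - 2) * e1 +
    v a * v1 * e2

lemma eq_zero_of_entire_relation {K : Subfield Mero} (hK : ∀ f ∈ K, meroShift f ∈ K)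
    (hal : AlgebraicIndependent K coordA) (ν : SingPt) (i : Fin 3) {p q : Fin 5 → ℤ}
    (hpq : p ≠ q) (N : ℝ) {X Y Z : Entire} (hZ : Z ≠ 0)
    (hx : algebraMap Entire Mero X / algebraMap Entire Mero Z ∈ adjoinA K)
    (hy : algebraMap Entire Mero Y / algebraMap Entire Mero Z ∈ adjoinA K)
    (hrel : ∀ a, Regular a → N < (saal a).re →
      X.1 a * companion ν i (shift a p) + Y.1 a * companion ν i (shift a q) = 0) :
    algebraMap Entire Mero X / algebraMap Entire Mero Z = 0 ∧
      algebraMap Entire Mero Y / algebraMap Entire Mero Z = 0 := by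
  have hZ0 : algebraMap Entire Mero Z ≠ 0 := by
    rwa [Ne, IsFractionRing.to_map_eq_zero_iff]
  have hm := connMat_coordA_mem K
  have hΔ := bigDelta_coordA_ne_zero hpq
  rw [bigDelta, Matrix.det_fin_two_of] at hΔ
  exact eq_zero_of_riccati hK meroShift_coordA hal hZ0 (mul_div_cancel₀ _ hZ0).symm
    (mul_div_cancel₀ _ hZ0).symm hx hy (hm p 0 0) (hm p 0 1) (hm q 0 0) (hm q 0 1) hΔ
    (riccati_of_relation ν i N hrel rfl rfl)

lemma mem_convSet_of_lt {p : Fin 5 → ℤ} {a : Fin 5 → ℂ} (ha : Generic a)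
    (h : |((saal p : ℤ) : ℝ)| < (saal a).re) : a ∈ convSet p := by
  refine ⟨ha, ?_⟩
  rw [saal_shift]
  have := neg_abs_le ((saal p : ℤ) : ℝ)
  simp
  linarith

lemma linIndepOver_companion {K : Subfield Mero} (hK : ∀ f ∈ K, meroShift f ∈ K)
    (hal : AlgebraicIndependent K coordA) (ν : SingPt) (i : Fin 3) {p q : Fin 5 → ℤ}
    (hpq : p ≠ q) : LinIndepOver (adjoinA K) (convSet p ∩ convSet q)
      (fun a => companion ν i (shift a p)) (fun a => companion ν i (shift a q)) := by
  rintro x hx y hy ⟨X, Y, Z, hZ, rfl, rfl, hrel⟩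
  refine eq_zero_of_entire_relation hK hal ν i hpq (max |((saal p : ℤ) : ℝ)| |((saal q : ℤ) : ℝ)|) hZ hx hy
    fun a ha hs => hrel a ⟨mem_convSet_of_lt ha.1 ?_, mem_convSet_of_lt ha.1 ?_⟩
  · exact (le_max_left _ _).trans_lt hs
  · exact (le_max_right _ _).trans_lt hs

/-! ### The three-term relation -/

lemma RegularAt.hasValue {u : RatA} {a : Fin 5 → ℂ} (h : RegularAt u a) :
    HasValue (evalAt a) u (valueAt u a) :=
  ⟨_, _, h, (IsFractionRing.mk'_num_den' (MvPolynomial (Fin 5) ℚ) u).symm, rfl⟩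

/-- Only Re s > 0 is known at a, a + p and a + q, so transport cannot start at a. From b = a - 𝟏 the
numbers h(a), h(a + p), h(a + q) are the second components of the vectors at b, b + p, b + q, where
Re s > 1. The lower rows at b are the upper rows at a multiplied by A(b; 𝟏), so the hypotheses on
upper rows turn into the required identity (0, 1) for lower rows. -/
lemma threeTermRel_of_rows {h : (Fin 5 → ℂ) → ℂ} (hh : IsContiguous h) {p q : Fin 5 → ℤ}
    {u v : RatA} (h1 : u * rOne varA p + v * rOne varA q = 1)
    (h2 : u * rTwo varA p + v * rTwo varA q = 0) : ThreeTermRel h p q u v := by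
  rintro a ⟨⟨ha0, hap⟩, haq⟩ hu hv
  set x := shift varA (-1) with hx
  set b := shift a (-1) with hb
  have hxr : Regular x := regular_varA.shift _
  have hx1 : shift x 1 = varA := by rw [hx, shift_shift, neg_add_cancel, shift_zero]
  have hb1 : ∀ p, shift (shift b p) 1 = shift a p := fun p => by
    rw [hb, shift_shift, shift_shift]; congr 1; abel
  have hxv := hasValue_shift (hasValue_varA a) (-1)
  have hsb : ∀ p, a ∈ convSet p → 1 < (saal (shift b p)).re := fun p hp => by
    have e := hp.2
    rw [← hb1, saal_shift _ 1, saal_one] at e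
    simp at e
    linarith
  have hs : 1 < (saal b).re := by simpa [shift_zero] using hsb 0 ha0
  -- Since the upper row of A(·; 𝟏) is (0, 1), the upper row of the product through x + p is the
  -- lower row of A(x; p).
  have row : ∀ p k, connMat x p 1 k =
      rOne varA p * oneMat x 0 k + rTwo varA p * oneMat x 1 k := fun p k => by
    have e : connMat (shift x p) 1 * connMat x p = connMat (shift x 1) p * connMat x 1 := by
      rw [← connMat_add hxr, ← connMat_add hxr, add_comm]
    rw [connMat_one (hxr.shift p), connMat_one hxr, hx1] at e
    have e0 := congrFun (congrFun e 0) k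
    simp only [Matrix.mul_apply, Fin.sum_univ_two] at e0
    rw [rOne, rTwo, ← e0]
    simp [oneMat]
  obtain ⟨M, hM, hMv⟩ := exists_pairVec_shift hh hxv hxr (Generic.shift ha0.1 (-1)) hs (hsb p hap)
  obtain ⟨M', hM', hMv'⟩ := exists_pairVec_shift hh hxv hxr (Generic.shift ha0.1 (-1)) hs (hsb q haq)
  have i0 : u * connMat x p 1 0 + v * connMat x q 1 0 = 0 := by
    rw [row, row]
    simp only [oneMat, Matrix.of_apply, Matrix.cons_val', Matrix.cons_val_zero,
      Matrix.cons_val_one, Matrix.cons_val_fin_one]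
    linear_combination (phiThree x / (saal x - 2)) * h2
  have i1 : u * connMat x p 1 1 + v * connMat x q 1 1 = 1 := by
    rw [row, row]
    simp only [oneMat, Matrix.of_apply, Matrix.cons_val', Matrix.cons_val_zero,
      Matrix.cons_val_one, Matrix.cons_val_fin_one]
    linear_combination (psi x / (saal x - 2)) * h2 + h1
  have v0 := (hu.hasValue.mul (hMv 1 0)).add (hv.hasValue.mul (hMv' 1 0))
  have v1 := (hu.hasValue.mul (hMv 1 1)).add (hv.hasValue.mul (hMv' 1 1))
  rw [i0] at v0
  rw [i1] at v1
  have w0 := v0.unique hasValue_zero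
  have w1 := v1.unique hasValue_one
  rw [← hb] at hM hM'
  have c := congrFun hM 1
  have c' := congrFun hM' 1
  have hba : shift b 1 = a := by rw [hb, shift_shift, neg_add_cancel, shift_zero]
  simp only [pairVec, hb1, hba, Matrix.mulVec, dotProduct, Fin.sum_univ_two, Matrix.cons_val_zero,
    Matrix.cons_val_one] at c c'
  rw [c, c']
  linear_combination -(h b) * w0 - h a * w1

/-- The rational constants as meromorphic functions. -/
noncomputable def ratConst : ℚ →+* Mero := 
  ratMero.comp ((algebraMap (MvPolynomial (Fin 5) ℚ) RatA).comp MvPolynomial.C)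

lemma meroShift_mem_ratConst : ∀ f ∈ ratConst.fieldRange, meroShift f ∈ ratConst.fieldRange := by
  rintro _ ⟨q, rfl⟩
  refine ⟨q, ?_⟩
  exact RingHom.congr_fun (RingHom.ext_rat ratConst (meroShift.comp ratConst)) q

/-- The coordinate functions are the images of the variables of ℚ(a) under an embedding of fields.
-/
lemma algebraicIndependent_ratConst : AlgebraicIndependent ratConst.fieldRange coordA := by
  rw [algebraicIndependent_iff_injective_aeval, injective_iff_map_eq_zero]
  intro P hP
  obtain ⟨P, rfl⟩ := MvPolynomial.map_surjective _ ratConst.rangeRestrictField_bijective.2 P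
  have e : (MvPolynomial.aeval (R := ratConst.fieldRange) coordA :
      MvPolynomial (Fin 5) ratConst.fieldRange →+* Mero).comp
      (MvPolynomial.map ratConst.rangeRestrictField) =
      ratMero.comp (algebraMap (MvPolynomial (Fin 5) ℚ) RatA) := by
    refine MvPolynomial.ringHom_ext (fun r => ?_) fun i => ?_
    · simp only [RingHom.comp_apply, RingHom.coe_coe, MvPolynomial.map_C, MvPolynomial.aeval_C]
      rfl
    · simp only [RingHom.comp_apply, RingHom.coe_coe, MvPolynomial.map_X, MvPolynomial.aeval_X]
      exact (congrFun ratMero_varA i).symm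
  have e0 := RingHom.congr_fun e P
  simp only [RingHom.comp_apply, RingHom.coe_coe] at e0
  rw [hP] at e0
  have h0 := (map_eq_zero ratMero).1 e0.symm
  rw [IsFractionRing.to_map_eq_zero_iff] at h0
  rw [h0, map_zero]

lemma polyEntire_mem_adjoinA (P : MvPolynomial (Fin 5) ℚ) :
    algebraMap Entire Mero (polyEntire P) ∈ adjoinA ratConst.fieldRange := by
  rw [← ratMero_algebraMap]
  induction P using MvPolynomial.induction_on with
  | C r => exact Subfield.subset_closure (Or.inl ⟨r, rfl⟩)
  | add P Q hP hQ => rw [map_add, map_add]; exact add_mem hP hQ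
  | mul_X P i hP =>
    rw [map_mul, map_mul]
    exact mul_mem hP (Subfield.subset_closure (Or.inr ⟨i, (congrFun ratMero_varA i).symm⟩))

lemma exists_fraction (w : RatA) : ∃ n d : MvPolynomial (Fin 5) ℚ, d ≠ 0 ∧
    algebraMap _ RatA n = w * algebraMap _ RatA d ∧ ∀ a, evalAt a d ≠ 0 → RegularAt w a ∧
      evalAt a n = valueAt w a * evalAt a d := by
  have hd := nonZeroDivisors.ne_zero (IsFractionRing.den (MvPolynomial (Fin 5) ℚ) w).2
  refine ⟨_, _, hd, ?_, fun a ha => ⟨ha, (div_mul_cancel₀ _ ha).symm⟩⟩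
  have h0 : algebraMap (MvPolynomial (Fin 5) ℚ) RatA
      (IsFractionRing.den (MvPolynomial (Fin 5) ℚ) w : MvPolynomial (Fin 5) ℚ) ≠ 0 := by
    rwa [Ne, IsFractionRing.to_map_eq_zero_iff]
  exact (div_eq_iff h0).1 (IsFractionRing.mk'_num_den' (MvPolynomial (Fin 5) ℚ) w)

lemma eq_of_cross_mul {M : Type*} [Field M] {w w' n n' d d' e : M} (hd : d ≠ 0) (hd' : d' ≠ 0)
    (he : e ≠ 0) (hn : n = w * d) (hn' : n' = w' * d') (h : (n * d' - n' * d) * e = 0) :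
    w' = w := by
  have h0 := (mul_eq_zero.1 h).resolve_right he
  rw [hn, hn'] at h0
  exact mul_right_cancel₀ (mul_ne_zero hd hd') (by linear_combination -h0)

/-- The difference of two relations is a linear relation between h(a + p) and h(a + q) with rational
coefficients; after clearing denominators, linear independence over the rational functions applies.
-/
lemma threeTermRel_unique {ν : SingPt} {i : Fin 3} {p q : Fin 5 → ℤ} (hpq : p ≠ q)
    {u v u' v' : RatA} (h : ThreeTermRel (companion ν i) p q u v)
    (h' : ThreeTermRel (companion ν i) p q u' v') : u' = u ∧ v' = v := by
  obtain ⟨n1, d1, hd1, e1, r1⟩ := exists_fraction u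
  obtain ⟨n2, d2, hd2, e2, r2⟩ := exists_fraction v
  obtain ⟨n3, d3, hd3, e3, r3⟩ := exists_fraction u'
  obtain ⟨n4, d4, hd4, e4, r4⟩ := exists_fraction v'
  -- The two relations are only available where no denominator vanishes. The extra factor D in X and
  -- Y makes the combined relation trivially true at the remaining points.
  obtain ⟨D, hD⟩ : ∃ D, D = d1 * d2 * d3 * d4 := ⟨_, rfl⟩
  have hD0 : D ≠ 0 := hD ▸ mul_ne_zero (mul_ne_zero (mul_ne_zero hd1 hd2) hd3) hd4
  obtain ⟨X, hX⟩ : ∃ X, X = (n1 * d3 - n3 * d1) * (d2 * d4 * D) := ⟨_, rfl⟩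
  obtain ⟨Y, hY⟩ : ∃ Y, Y = (n2 * d4 - n4 * d2) * (d1 * d3 * D) := ⟨_, rfl⟩
  have hrel : ∀ a, Regular a → max |((saal p : ℤ) : ℝ)| |((saal q : ℤ) : ℝ)| < (saal a).re →
      (polyEntire X).1 a * companion ν i (shift a p) +
        (polyEntire Y).1 a * companion ν i (shift a q) = 0 := by
    intro a ha hs
    have hXa : (polyEntire X).1 a = evalAt a X := evalEntire_polyEntire X a
    have hYa : (polyEntire Y).1 a = evalAt a Y := evalEntire_polyEntire Y a
    rw [hXa, hYa]
    by_cases hDa : evalAt a D = 0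
    · simp only [hX, hY, map_mul, hDa, mul_zero, zero_mul, add_zero]
    · have hDa' := hDa
      simp only [hD, map_mul, mul_eq_zero, not_or] at hDa'
      obtain ⟨⟨⟨ha1, ha2⟩, ha3⟩, ha4⟩ := hDa'
      have hp := (le_max_left _ _).trans_lt hs
      have hq := (le_max_right _ _).trans_lt hs
      have hmem : a ∈ convSet 0 ∩ convSet p ∩ convSet q :=
        ⟨⟨mem_convSet_of_lt ha.1 (by simpa [saal] using (abs_nonneg _).trans_lt hp),
          mem_convSet_of_lt ha.1 hp⟩, mem_convSet_of_lt ha.1 hq⟩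
      have t := h a hmem (r1 a ha1).1 (r2 a ha2).1
      have t' := h' a hmem (r3 a ha3).1 (r4 a ha4).1
      simp only [hX, hY, map_mul, map_sub, (r1 a ha1).2, (r2 a ha2).2, (r3 a ha3).2, (r4 a ha4).2]
      linear_combination (evalAt a D * evalAt a d1 * evalAt a d2 * evalAt a d3 * evalAt a d4) *
        (t' - t)
  obtain ⟨hX0, hY0⟩ := eq_zero_of_entire_relation meroShift_mem_ratConst algebraicIndependent_ratConst ν i hpq _
    (Z := 1) one_ne_zero (by rw [map_one, div_one]; exact polyEntire_mem_adjoinA X)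
    (by rw [map_one, div_one]; exact polyEntire_mem_adjoinA Y) hrel
  rw [map_one, div_one, ← ratMero_algebraMap, map_eq_zero] at hX0 hY0
  have hne : ∀ {d : MvPolynomial (Fin 5) ℚ}, d ≠ 0 → algebraMap _ RatA d ≠ 0 := fun {d} hd => by
    rwa [Ne, IsFractionRing.to_map_eq_zero_iff]
  rw [hX, map_mul, map_sub, map_mul, map_mul] at hX0
  rw [hY, map_mul, map_sub, map_mul, map_mul] at hY0
  exact ⟨eq_of_cross_mul (hne hd1) (hne hd3) (hne (mul_ne_zero (mul_ne_zero hd2 hd4) hD0)) e1 e3 hX0,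
    eq_of_cross_mul (hne hd2) (hne hd4) (hne (mul_ne_zero (mul_ne_zero hd1 hd3) hD0)) e2 e4 hY0⟩

end HypThreeTerm

theorem proposition5p1 (p q : Fin 5 → ℤ) (hpq : p ≠ q) :
    -- the determinant
    (bigDelta varA p q = smallDelta varA p * rTwo (shift varA p) (q - p) ∧
      bigDelta varA p q ≠ 0) ∧
    -- linear independence over `K(a)`
    (∀ K : Subfield Mero, (∀ f ∈ K, meroShift f ∈ K) → AlgebraicIndependent K coordA →
      ∀ (ν : SingPt) (i : Fin 3),
        LinIndepOver (adjoinA K) (convSet p ∩ convSet q)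
          (fun a => companion ν i (shift a p)) (fun a => companion ν i (shift a q))) ∧
    -- the three-term relation, common to the six companions, and its uniqueness for each of them
    (∃ u v : RatA,
      u = rTwo varA q / bigDelta varA p q ∧
      u = rTwo varA q / (smallDelta varA p * rTwo (shift varA p) (q - p)) ∧
      v = -(rTwo varA p / bigDelta varA p q) ∧
      v = -(rTwo varA p / (smallDelta varA p * rTwo (shift varA p) (q - p))) ∧
      ∀ (ν : SingPt) (i : Fin 3),
        ThreeTermRel (companion ν i) p q u v ∧
        ∀ u' v' : RatA, ThreeTermRel (companion ν i) p q u' v' → u' = u ∧ v' = v) := by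
  have hΔ := bigDelta_eq regular_varA p q
  have hΔ0 := bigDelta_varA_ne_zero hpq
  have hdet : bigDelta varA p q =
      rOne varA p * rTwo varA q - rTwo varA p * rOne varA q := Matrix.det_fin_two_of _ _ _ _
  refine ⟨⟨hΔ, hΔ0⟩, fun K hK hal ν i => linIndepOver_companion hK hal ν i hpq,
    _, _, rfl, by rw [hΔ], rfl, by rw [hΔ], fun ν i => ?_⟩
  have hrel : ThreeTermRel (companion ν i) p q (rTwo varA q / bigDelta varA p q)
      (-(rTwo varA p / bigDelta varA p q)) := by
    -- Cramer's rule: u times the upper row of A(a; p) plus v times that of A(a; q) must equal (1,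
    -- 0).
    refine threeTermRel_of_rows (isContiguous_companion ν i) ?_ ?_
    · field_simp
      rw [hdet]; ring
    · field_simp
      ring
  exact ⟨hrel, fun u' v' h' => threeTermRel_unique hpq hrel h'⟩
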